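/- **The skew fields.** Throughout $[x,y]=xy-yx$. For $l=1$ let $\mathcal A_1$ be the associative unital $\mathbb C$-algebra with generators $f_0,f_1,f_2,\alpha_0,\alpha_1,h$ and relations $$[f_1,f_0]=2hf_2,\qquad [f_0,f_2]=[f_2,f_1]=h,\qquad [f_i,\alpha_j]=[\alpha_0,\alpha_1]=[h,\alpha_j]=[f_i,h]=0 .$$ For $l\ge 2$ let $\mathcal A_l$ be the associative unital $\mathbb C$-algebra with generators $f_i,\alpha_i$ $(i\in\mathbb Z/(l+1)\mathbb Z)$ and $h$ and relations $$[f_i,f_{i+1}]=h,\qquad [f_i,f_j]=0\ (j\ne i\pm1),\qquad [f_i,\alpha_j]=[\alpha_i,\alpha_j]=[h,f_j]=[h,\alpha_j]=0 .$$ $\mathcal A_l$ is an Ore domain; $\mathcal K_l$ denotes its quotient skew field. **The Hamiltonian.** Put $k=\alpha_0+\cdots+\alpha_l$. For $l=1$ let $H_0=\tfrac12(f_0f_1+f_1f_0)+\alpha_1f_2$. For $l\ge2$ let $\Gamma=\mathbb Z/(l+1)\mathbb Z$ and, for $0\le i\le l$, $\varpi_i=\sum_{r=1}^{l}\bigl(\min\{i,r\}-\tfrac{ir}{l+1}\bigr)\alpha_r$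 (so $\varpi_0=0$). The connected components of a proper subset $C\subset\Gamma$ are the sets $\{i,i+1,\dots,i+m-1\}\subseteq C$ with $1\le m\le l$, $i-1\notin C$, $i+m\notin C$; $m$ is the length. Let $\chi(C)$ be the sum of $\varpi_i-\varpi_{i+1}+\cdots+(-1)^{m-1}\varpi_{i+m-1}$ over the connected components of $C$, let $f_C$ be the product of the (mutually commuting) elements $f_if_{i+1}\cdots f_{i+m-1}$ over the connected components of $C$, and let $S_d$ be the set of the $K\subseteq\Gamma$ with $|K|=d$ such that every connected component of $\Gamma\setminus K$ has even length. Define $$H_0=\begin{cases} f_0f_1f_2+hf_1+\sum_{K\in S_1}\chi(\Gamma\setminus K)f_K & (l=2),\\ \sum_{K\in S_3}f_K+\sum_{K\in S_1}\chi(\Gamma\setminus K)f_K & (l=2n,\ n\ge2),\\ f_0f_1f_2f_3+hf_1f_2+\sum_{K\in S_2}\chi(\Gamma\setminus K)f_K+\bigl(\sum_{i=1}^{3}(-1)^{i-1}\varpi_i\bigr)^2 & (l=3),\\ \sum_{K\in S_4}f_K+\sum_{K\in S_2}\chi(\Gamma\setminus K)f_K+\bigl(\sum_{i=1}^{l}(-1)^{i-1}\varpi_i\bigr)^2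 & (l=2n+1,\ n\ge2). \end{cases}$$ **The derivation.** $\partial$ is the $\mathbb C$-derivation of $\mathcal K_l$ with $\partial\alpha_i=\frac1h[H_0,\alpha_i]$, $\partial h=\frac1h[H_0,h]$ and $$\partial f_i=\tfrac1h[H_0,f_i]+\delta_{i,0}k\quad(l=1\text{ or }l\text{ even}),\qquad \partial f_i=\tfrac1h[H_0,f_i]-(-1)^i\tfrac k2f_i+\delta_{i,0}kx_0\quad(l\ge 3\text{ odd}),$$ where $0\le i\le l$ for $l\ge2$ and $0\le i\le2$ for $l=1$ in the formulas for $\partial f_i$, and $x_0=f_0+f_2+\cdots+f_{l-1}$. **The automorphisms.** For $l=1$, $s_0,s_1,\pi$ are the $\mathbb C$-algebra automorphisms of $\mathcal K_1$ fixing $h$ with $$s_0(f_0)=f_0,\quad s_0(f_1)=f_1-f_2\tfrac{\alpha_0}{f_0}-\tfrac{\alpha_0}{f_0}f_2-\tfrac{\alpha_0^2}{f_0^2},\quad s_0(f_2)=f_2+\tfrac{\alpha_0}{f_0},$$ $$s_1(f_0)=f_0+f_2\tfrac{\alpha_1}{f_1}+\tfrac{\alpha_1}{f_1}f_2-\tfrac{\alpha_1^2}{f_1^2},\quad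 s_1(f_1)=f_1,\quad s_1(f_2)=f_2-\tfrac{\alpha_1}{f_1},$$ $$s_0(\alpha_0)=-\alpha_0,\quad s_0(\alpha_1)=\alpha_1+2\alpha_0,\quad s_1(\alpha_0)=\alpha_0+2\alpha_1,\quad s_1(\alpha_1)=-\alpha_1,$$ $$\pi(f_0)=f_1,\quad \pi(f_1)=f_0,\quad \pi(f_2)=-f_2,\quad \pi(\alpha_0)=\alpha_1,\quad \pi(\alpha_1)=\alpha_0 .$$ For $l\ge2$, $s_i$ $(i\in\Gamma)$ and $\pi$ are the $\mathbb C$-algebra automorphisms of $\mathcal K_l$ fixing $h$ with $$s_i(f_j)=f_j+\tfrac{\alpha_i}{f_i}u_{ij},\qquad s_i(\alpha_j)=\alpha_j-\alpha_ia_{ij},\qquad \pi(f_j)=f_{j+1},\qquad \pi(\alpha_j)=\alpha_{j+1},$$ where $u_{i,i\pm1}=\pm1$, $u_{ij}=0$ otherwise, and $a_{ii}=2$, $a_{i,i\pm1}=-1$, $a_{ij}=0$ otherwise. **Theorem 1.2.** Let $l\ge1$. The derivation $\partial$ and the automorphisms $s_0,\dots,s_l,\pi$ of $\mathcal K_l$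 exist and are uniquely determined by the prescribed values on the generators, and $\partial$ commutes with the action of the extended affine Weyl group $\widetilde W=\langle s_0,\dots,s_l,\pi\rangle$ of type $A_l^{(1)}$: for every $w$ in the subgroup of $\mathrm{Aut}_{\mathbb C}(\mathcal K_l)$ generated by $s_0,\dots,s_l,\pi$ and every $\varphi\in\mathcal K_l$, $$\partial(w(\varphi))=w(\partial(\varphi)).$$ -/

import Mathlib

namespace QP

/-! ### A criterion for being an Ore domain

The facts of this section show that the algebras defined below are Ore domains: they act on a
polynomial ring in such a way that every generator acts as a variable, up to lower degree. -/

section Filtered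

open MvPolynomial

variable {G : Type} {A : Type} [Ring A] [Algebra ℂ A]

/-- Polynomials all of whose monomials have total degree less than `k`. -/
noncomputable def degLT (G : Type) (k : ℕ) : Submodule ℂ (MvPolynomial G ℂ) :=
  restrictSupport ℂ {m | m.degree < k}

theorem mem_degLT {k : ℕ} {p : MvPolynomial G ℂ} :
    p ∈ degLT G k ↔ ∀ m, p.coeff m ≠ 0 → m.degree < k := by
  simp only [degLT, mem_restrictSupport_iff, Set.subset_def, SetLike.mem_coe,
    mem_support_iff, Set.mem_ofPred_eq]

theorem degLT_mono {k k' : ℕ} (h : k ≤ k') : degLT G k ≤ degLT G k' := fun p hp => by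
  rw [mem_degLT] at *
  exact fun m hm => (hp m hm).trans_le h

theorem degLT_zero {p : MvPolynomial G ℂ} (hp : p ∈ degLT G 0) : p = 0 := by
  rw [mem_degLT] at hp
  ext m
  by_contra h
  exact absurd (hp m h) (Nat.not_lt_zero _)

theorem homog_degree {n : ℕ} {p : MvPolynomial G ℂ} (hp : p.IsHomogeneous n) {m : G →₀ ℕ}
    (hm : p.coeff m ≠ 0) : m.degree = n := by
  have h := hp hm
  have h2 : (Finsupp.degree m) = Finsupp.weight (1 : G → ℕ) m := by
    simp [Finsupp.weight_apply, Finsupp.degree_apply, Finsupp.sum]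
  rw [h2, h]

theorem homog_mul_mem {n k : ℕ} {p q : MvPolynomial G ℂ} (hp : p.IsHomogeneous n)
    (hq : q ∈ degLT G k) : p * q ∈ degLT G (n + k) := by
  classical
  rw [mem_degLT] at *
  intro m hm
  rw [coeff_mul] at hm
  obtain ⟨⟨x, y⟩, hxy, hne⟩ := Finset.exists_ne_zero_of_sum_ne_zero hm
  have h1 := homog_degree hp (left_ne_zero_of_mul hne)
  have h2 := hq y (right_ne_zero_of_mul hne)
  have hxy' : x + y = m := Finset.HasAntidiagonal.mem_antidiagonal.1 hxy
  simp only at h1 h2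
  rw [← hxy', map_add]
  omega

theorem homog_eq_zero {n : ℕ} {p : MvPolynomial G ℂ} (hp : p.IsHomogeneous n)
    (h : p ∈ degLT G n) : p = 0 := by
  rw [mem_degLT] at h
  ext m
  by_contra hm
  have h1 := homog_degree hp hm
  have h2 := h m hm
  omega

theorem homog_mem {n : ℕ} {p : MvPolynomial G ℂ} (hp : p.IsHomogeneous n) :
    p ∈ degLT G (n + 1) := by
  rw [mem_degLT]
  intro m hm
  have h1 := homog_degree hp hm
  omega

variable (g : G → A)

/-- The span of the generators. -/
def linPart : Submodule ℂ A := Submodule.span ℂ (Set.range g)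

/-- The span of the generators and of `1`. -/
def filt : Submodule ℂ A := 1 ⊔ linPart g

theorem one_le_filt : (1 : Submodule ℂ A) ≤ filt g := le_sup_left

theorem gen_mem_filt (x : G) : g x ∈ filt g :=
  Submodule.mem_sup_right (Submodule.subset_span ⟨x, rfl⟩)

theorem filt_pow_mono {m n : ℕ} (h : m ≤ n) : filt g ^ m ≤ filt g ^ n :=
  pow_le_pow_right₀ (one_le_filt g) h

theorem filt_pow_succ_le (n : ℕ) : filt g ^ (n + 1) ≤ linPart g ^ (n + 1) ⊔ filt g ^ n := by
  induction n with
  | zero => simp [filt, sup_comm]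
  | succ n ih =>
    rw [pow_succ]
    calc filt g ^ (n + 1) * filt g ≤ (linPart g ^ (n + 1) ⊔ filt g ^ n) * filt g :=
          mul_le_mul' ih le_rfl
      _ ≤ _ := by
        rw [Submodule.sup_mul, ← pow_succ]
        refine sup_le ?_ le_sup_right
        rw [filt, Submodule.mul_sup, mul_one, ← pow_succ]
        refine sup_le (le_sup_of_le_right ?_) le_sup_left
        exact pow_le_pow_left' le_sup_right _

theorem word_mem (l : List G) : (l.map g).prod ∈ filt g ^ l.length := by
  induction l with
  | nil => exact Submodule.one_le.1 (le_refl (1 : Submodule ℂ A))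
  | cons x l ih =>
    rw [List.map_cons, List.prod_cons, List.length_cons, pow_succ']
    exact Submodule.mul_mem_mul (gen_mem_filt g x) ih

theorem word_perm (hc : ∀ x y, g x * g y - g y * g x ∈ filt g) {l l' : List G}
    (h : l.Perm l') : ∀ n, l.length = n + 1 →
    (l.map g).prod - (l'.map g).prod ∈ filt g ^ n := by
  induction h with
  | nil => simp
  | cons x h ih =>
    rename_i l₁ l₂
    intro n hn
    rcases n with _ | n
    · have : l₁ = [] := by simpa using hn
      subst this
      have := h.nil_eq
      subst this
      simp
    · rw [List.map_cons, List.prod_cons, List.map_cons, List.prod_cons, ← mul_sub, pow_succ']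
      exact Submodule.mul_mem_mul (gen_mem_filt g x) (ih n (by simpa using hn))
  | swap x y l =>
    intro n hn
    simp only [List.length_cons, Nat.add_right_cancel_iff] at hn
    subst hn
    simp only [List.map_cons, List.prod_cons, ← mul_assoc, ← sub_mul]
    rw [pow_succ']
    exact Submodule.mul_mem_mul (hc _ _) (word_mem g l)
  | trans h₁ h₂ ih₁ ih₂ =>
    intro n hn
    have := add_mem (ih₁ n hn) (ih₂ n (h₁.length_eq ▸ hn))
    simpa using this

/-- The linear map which sends a monomial to the product of the corresponding generators, in some
order. -/
noncomputable def ordered : MvPolynomial G ℂ →ₗ[ℂ] A :=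
  (basisMonomials G ℂ).constr ℂ fun m => ((Finsupp.toMultiset m).toList.map g).prod

theorem ordered_monomial (m : G →₀ ℕ) :
    ordered g (monomial m 1) = ((Finsupp.toMultiset m).toList.map g).prod := by
  have := (basisMonomials G ℂ).constr_basis ℂ
    (fun m => ((Finsupp.toMultiset m).toList.map g).prod) m
  simpa [ordered] using this

theorem exists_homog (hc : ∀ x y, g x * g y - g y * g x ∈ filt g) (n : ℕ) (a : A)
    (ha : a ∈ filt g ^ (n + 1)) :
    ∃ p : MvPolynomial G ℂ, p.IsHomogeneous (n + 1) ∧ a - ordered g p ∈ filt g ^ n := by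
  classical
  obtain ⟨b, hb, d, hd, rfl⟩ := Submodule.mem_sup.1 (filt_pow_succ_le g n ha)
  suffices h : ∃ p : MvPolynomial G ℂ, p.IsHomogeneous (n + 1) ∧ b - ordered g p ∈ filt g ^ n by
    obtain ⟨p, hp, hpb⟩ := h
    refine ⟨p, hp, ?_⟩
    have := add_mem hpb hd
    rwa [sub_add_eq_add_sub] at this
  clear ha hd
  rw [linPart, Submodule.span_pow] at hb
  induction hb using Submodule.span_induction with
  | mem x hx =>
    obtain ⟨w, rfl⟩ := Set.mem_pow.1 hx
    choose v hv using fun i => (w i).2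
    have hl : (List.ofFn fun i => (w i : A)) = (List.ofFn v).map g := by
      rw [List.map_ofFn]
      congr 1
      funext i
      exact (hv i).symm
    rw [hl]
    refine ⟨monomial (Multiset.toFinsupp (List.ofFn v : Multiset G)) 1, ?_, ?_⟩
    · apply isHomogeneous_monomial
      have h2 := Finsupp.card_toMultiset (Multiset.toFinsupp (List.ofFn v : Multiset G))
      rw [Multiset.toFinsupp_toMultiset] at h2
      simpa [Finsupp.degree_apply, Finsupp.sum] using h2.symm
    · rw [ordered_monomial]
      refine word_perm g hc ?_ n (by simp)
      rw [← Multiset.coe_eq_coe]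
      simp
  | zero => exact ⟨0, isHomogeneous_zero _ _ _, by simp⟩
  | add x y _ _ hx hy =>
    obtain ⟨p, hp, hp'⟩ := hx
    obtain ⟨q, hq, hq'⟩ := hy
    refine ⟨p + q, hp.add hq, ?_⟩
    have := add_mem hp' hq'
    rw [map_add]
    convert this using 1
    abel
  | smul c x _ hx =>
    obtain ⟨p, hp, hp'⟩ := hx
    refine ⟨c • p, (homogeneousSubmodule G ℂ (n + 1)).smul_mem c hp, ?_⟩
    rw [map_smul, ← smul_sub]
    exact Submodule.smul_mem _ _ hp'

variable {g} (ρ : A →ₐ[ℂ] Module.End ℂ (MvPolynomial G ℂ))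

theorem rep_filt (hρ : ∀ x k, ∀ q ∈ degLT G (k + 1), ρ (g x) q - X x * q ∈ degLT G (k + 1))
    (n k : ℕ) (a : A) (ha : a ∈ filt g ^ n) (q : MvPolynomial G ℂ) (hq : q ∈ degLT G (k + 1)) :
    ρ a q ∈ degLT G (n + k + 1) := by
  induction n generalizing a with
  | zero =>
    rw [pow_zero, Submodule.mem_one] at ha
    obtain ⟨c, rfl⟩ := ha
    rw [AlgHom.commutes, Module.algebraMap_end_apply]
    simpa using Submodule.smul_mem _ c hq
  | succ n ih =>
    rw [pow_succ'] at ha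
    induction ha using Submodule.mul_induction_on' with
    | add x _ y _ hx hy => rw [map_add]; exact add_mem hx hy
    | mem_mul_mem x hx y hy =>
      have hy' := ih y hy
      rw [map_mul, Module.End.mul_apply]
      generalize ρ y q = r at hy'
      obtain ⟨b, hb, d, hd, rfl⟩ := Submodule.mem_sup.1 hx
      rw [map_add]
      refine add_mem (degLT_mono (by omega) (?_ : _ ∈ degLT G (n + k + 1))) ?_
      · rw [Submodule.mem_one] at hb
        obtain ⟨c, rfl⟩ := hb
        rw [AlgHom.commutes, Module.algebraMap_end_apply]
        exact Submodule.smul_mem _ c hy'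
      · clear hx
        induction hd using Submodule.span_induction with
        | mem z hz =>
          obtain ⟨x, rfl⟩ := hz
          have h1 := degLT_mono (Nat.le_succ _) (hρ x _ r hy')
          have h2 := homog_mul_mem (isHomogeneous_X ℂ x) hy'
          have h3 := add_mem h1 (degLT_mono (le_of_eq (by omega)) h2)
          rw [sub_add_cancel] at h3
          exact degLT_mono (by omega) h3
        | zero => simp
        | add u v _ _ hu hv => 
          rw [map_add]
          exact add_mem hu hv
        | smul c u _ hu => 
          rw [map_smul]
          exact Submodule.smul_mem _ c hu

/-- The operator `a` has leading symbol `p` of degree `n`. -/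
def HasSym (n : ℕ) (a : A) (p : MvPolynomial G ℂ) : Prop :=
  ∀ k, ∀ q ∈ degLT G (k + 1), ρ a q - p * q ∈ degLT G (n + k)

theorem hasSym_word (hρ : ∀ x k, ∀ q ∈ degLT G (k + 1), ρ (g x) q - X x * q ∈ degLT G (k + 1))
    (l : List G) : HasSym ρ l.length (l.map g).prod (l.map X).prod := by
  induction l with
  | nil => intro k q hq; simp
  | cons x l ih =>
    intro k q hq
    have h1 := rep_filt ρ hρ l.length k _ (word_mem g l) q hq
    have h2 := hρ x _ _ h1
    have h3 := homog_mul_mem (isHomogeneous_X ℂ x) (ih k q hq)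
    have h4 := add_mem h2 (degLT_mono (by omega) h3)
    simp only [List.map_cons, List.prod_cons, map_mul, Module.End.mul_apply, List.length_cons]
    refine degLT_mono (k := l.length + k + 1) (by omega) ?_
    convert h4 using 1
    ring

theorem hasSym_ordered
    (hρ : ∀ x k, ∀ q ∈ degLT G (k + 1), ρ (g x) q - X x * q ∈ degLT G (k + 1))
    {n : ℕ} {p : MvPolynomial G ℂ} (hp : p.IsHomogeneous n) :
    HasSym ρ n (ordered g p) p := by
  classical
  intro k q hq
  have hsum : ∀ m ∈ p.support,
      ρ (ordered g (monomial m (p.coeff m))) q - monomial m (p.coeff m) * q ∈ degLT G (n + k) := by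
    intro m hm
    have hd := homog_degree hp (mem_support_iff.1 hm)
    have h := hasSym_word ρ hρ (Finsupp.toMultiset m).toList k q hq
    have hlen : (Finsupp.toMultiset m).toList.length = n := by
      rw [Multiset.length_toList, Finsupp.card_toMultiset, ← hd]
      simp [Finsupp.degree_apply, Finsupp.sum]
    have hX : ((Finsupp.toMultiset m).toList.map (X : G → MvPolynomial G ℂ)).prod
        = monomial m 1 := by
      rw [← Multiset.prod_coe, ← Multiset.map_coe, Multiset.coe_toList, Finsupp.toMultiset_map,
        Finsupp.prod_toMultiset, Finsupp.prod_mapDomain_index (by simp) (by simp [pow_add]),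
        monomial_eq]
      simp
    rw [hlen, hX, ← ordered_monomial] at h
    have h' := Submodule.smul_mem _ (p.coeff m) h
    have hm1 : monomial m (p.coeff m) = p.coeff m • (monomial m 1 : MvPolynomial G ℂ) := by
      rw [smul_monomial, smul_eq_mul, mul_one]
    rw [hm1, map_smul, map_smul, LinearMap.smul_apply, smul_mul_assoc, ← smul_sub]
    exact h'
  have := Submodule.sum_mem _ hsum
  rw [Finset.sum_sub_distrib, ← Finset.sum_mul, ← LinearMap.sum_apply, ← map_sum, ← map_sum,
    ← as_sum] at this
  exact this

theorem exists_sym (hc : ∀ x y, g x * g y - g y * g x ∈ filt g)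
    (hρ : ∀ x k, ∀ q ∈ degLT G (k + 1), ρ (g x) q - X x * q ∈ degLT G (k + 1))
    (n : ℕ) (a : A) (ha : a ∈ filt g ^ n) (h0 : a ≠ 0) :
    ∃ m, ∃ p : MvPolynomial G ℂ, p ≠ 0 ∧ p.IsHomogeneous m ∧ HasSym ρ m a p := by
  induction n with
  | zero =>
    rw [pow_zero, Submodule.mem_one] at ha
    obtain ⟨c, rfl⟩ := ha
    refine ⟨0, C c, ?_, isHomogeneous_C _ _, fun k q hq => ?_⟩
    · rintro h
      rw [C_eq_zero] at h
      simp [h] at h0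
    · rw [AlgHom.commutes, Module.algebraMap_end_apply, ← smul_eq_C_mul, sub_self]
      exact Submodule.zero_mem _
  | succ n ih =>
    obtain ⟨p, hp, hpa⟩ := exists_homog g hc n a ha
    by_cases hp0 : p = 0
    · subst hp0
      exact ih (by simpa using hpa)
    · refine ⟨n + 1, p, hp0, hp, fun k q hq => ?_⟩
      have h1 := hasSym_ordered ρ hρ hp k q hq
      have h2 := rep_filt ρ hρ n k _ hpa q hq
      have h3 := add_mem h1 (degLT_mono (by omega) h2)
      convert h3 using 1
      simp

theorem exists_filt (hg : Algebra.adjoin ℂ (Set.range g) = ⊤) (a : A) :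
    ∃ n, a ∈ filt g ^ n := by
  have ha : a ∈ Algebra.adjoin ℂ (Set.range g) := hg ▸ Algebra.mem_top
  induction ha using Algebra.adjoin_induction with
  | mem x hx => obtain ⟨y, rfl⟩ := hx; exact ⟨1, by simpa using gen_mem_filt g y⟩
  | algebraMap r => exact ⟨0, by rw [pow_zero]; exact Submodule.mem_one.2 ⟨r, rfl⟩⟩
  | add x y _ _ hx hy =>
    obtain ⟨m, hm⟩ := hx
    obtain ⟨n, hn⟩ := hy
    exact ⟨max m n, add_mem (filt_pow_mono g (le_max_left _ _) hm)
      (filt_pow_mono g (le_max_right _ _) hn)⟩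
  | mul x y _ _ hx hy =>
    obtain ⟨m, hm⟩ := hx
    obtain ⟨n, hn⟩ := hy
    exact ⟨m + n, by rw [pow_add]; exact Submodule.mul_mem_mul hm hn⟩

theorem one_mem_degLT : (1 : MvPolynomial G ℂ) ∈ degLT G (0 + 1) :=
  homog_mem (isHomogeneous_one G ℂ)

theorem rep_one_ne_zero (hg : Algebra.adjoin ℂ (Set.range g) = ⊤)
    (hc : ∀ x y, g x * g y - g y * g x ∈ filt g)
    (hρ : ∀ x k, ∀ q ∈ degLT G (k + 1), ρ (g x) q - X x * q ∈ degLT G (k + 1))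
    {a : A} (ha : a ≠ 0) : ρ a 1 ≠ 0 := by
  obtain ⟨n, hn⟩ := exists_filt hg a
  obtain ⟨m, p, hp0, hp, hs⟩ := exists_sym ρ hc hρ n a hn ha
  intro h
  have := hs 0 1 one_mem_degLT
  rw [h, zero_sub, mul_one, Submodule.neg_mem_iff] at this
  exact hp0 (homog_eq_zero hp this)

theorem noZeroDivisors_of_rep (hg : Algebra.adjoin ℂ (Set.range g) = ⊤)
    (hc : ∀ x y, g x * g y - g y * g x ∈ filt g)
    (hρ : ∀ x k, ∀ q ∈ degLT G (k + 1), ρ (g x) q - X x * q ∈ degLT G (k + 1)) :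
    NoZeroDivisors A := by
  refine ⟨fun {a b} hab => ?_⟩
  by_contra! h
  obtain ⟨n, hn⟩ := exists_filt hg a
  obtain ⟨m, p, hp0, hp, hs⟩ := exists_sym ρ hc hρ n a hn h.1
  obtain ⟨n', hn'⟩ := exists_filt hg b
  obtain ⟨m', p', hp0', hp', hs'⟩ := exists_sym ρ hc hρ n' b hn' h.2
  have h1 := hs' 0 1 one_mem_degLT
  rw [mul_one, add_zero] at h1
  have h2 : ρ b 1 ∈ degLT G (m' + 1) := by
    have := add_mem (degLT_mono (Nat.le_succ m') h1) (homog_mem hp')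
    rwa [sub_add_cancel] at this
  have h3 := hs m' _ h2
  rw [← Module.End.mul_apply, ← map_mul, hab, map_zero, LinearMap.zero_apply, zero_sub,
    Submodule.neg_mem_iff] at h3
  have h4 := sub_mem h3 (homog_mul_mem hp h1)
  rw [← mul_sub, sub_sub_cancel] at h4
  exact mul_ne_zero hp0 hp0' (homog_eq_zero (hp.mul hp') h4)

theorem finrank_degLT_le [Finite G] (n : ℕ) :
    Module.Finite ℂ (degLT G n) ∧ Module.finrank ℂ (degLT G n) ≤ n ^ Nat.card G := by
  classical
  have := Fintype.ofFinite G
  have hinj : Function.Injective (fun (m : {m : G →₀ ℕ | m.degree < n}) (x : G) =>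
      (⟨m.1 x, (Finsupp.le_degree x m.1).trans_lt m.2⟩ : Fin n)) := by
    intro m m' h
    ext x
    have := congrFun h x
    simpa using this
  have hf : Finite {m : G →₀ ℕ | m.degree < n} := Finite.of_injective _ hinj
  have b := basisRestrictSupport (σ := G) ℂ {m : G →₀ ℕ | m.degree < n}
  refine ⟨Module.Finite.of_basis b, ?_⟩
  rw [degLT, Module.finrank_eq_nat_card_basis b]
  refine (Nat.card_le_card_of_injective _ hinj).trans ?_
  simp

theorem exists_common_multiple [Finite G] (hg : Algebra.adjoin ℂ (Set.range g) = ⊤)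
    (hc : ∀ x y, g x * g y - g y * g x ∈ filt g)
    (hρ : ∀ x k, ∀ q ∈ degLT G (k + 1), ρ (g x) q - X x * q ∈ degLT G (k + 1))
    (a s : A) (hs : s ≠ 0) : ∃ r t : A, t ≠ 0 ∧ t * a = r * s := by
  classical
  have hd : NoZeroDivisors A := noZeroDivisors_of_rep ρ hg hc hρ
  obtain ⟨d₁, hd₁⟩ := exists_filt hg a
  obtain ⟨d₂, hd₂⟩ := exists_filt hg s
  obtain ⟨d, h1, h2⟩ : ∃ d, d₁ ≤ d ∧ d₂ ≤ d := ⟨max d₁ d₂, le_max_left _ _, le_max_right _ _⟩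
  replace hd₁ := filt_pow_mono g h1 hd₁
  replace hd₂ := filt_pow_mono g h2 hd₂
  by_contra! hcon
  -- every filtration step is finite-dimensional, with polynomially bounded dimension
  have hdim : ∀ n, Module.Finite ℂ ↥(filt g ^ n) ∧
      Module.finrank ℂ ↥(filt g ^ n) ≤ (n + 1) ^ Nat.card G := by
    intro n
    obtain ⟨hfin, hle⟩ := finrank_degLT_le (G := G) (n + 1)
    let φ : ↥(filt g ^ n) →ₗ[ℂ] degLT G (n + 1) :=
      { toFun := fun x => ⟨ρ x.1 1, rep_filt ρ hρ n 0 x.1 x.2 1 one_mem_degLT⟩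
        map_add' := fun x y => by ext1; simp
        map_smul' := fun c x => by ext1; simp }
    have hφ : Function.Injective φ := by
      rw [← LinearMap.ker_eq_bot, LinearMap.ker_eq_bot']
      intro x hx
      by_contra hne
      exact rep_one_ne_zero ρ hg hc hρ (a := x.1) (by simpa using hne) (congrArg Subtype.val hx)
    exact ⟨Module.Finite.of_injective φ hφ, (LinearMap.finrank_le_finrank_of_injective hφ).trans hle⟩
  have hdouble : ∀ n, 2 * Module.finrank ℂ ↥(filt g ^ n) ≤
      Module.finrank ℂ ↥(filt g ^ (n + d)) := by
    intro n
    have := (hdim n).1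
    have := (hdim (n + d)).1
    let φ : (↥(filt g ^ n) × ↥(filt g ^ n)) →ₗ[ℂ] ↥(filt g ^ (n + d)) :=
      { toFun := fun x => ⟨x.1.1 * a - x.2.1 * s, by
          rw [pow_add]
          exact sub_mem (Submodule.mul_mem_mul x.1.2 hd₁) (Submodule.mul_mem_mul x.2.2 hd₂)⟩
        map_add' := fun x y => by ext1; simp [add_mul]; abel
        map_smul' := fun c x => by ext1; simp [smul_sub] }
    have hφ : Function.Injective φ := by
      rw [← LinearMap.ker_eq_bot, LinearMap.ker_eq_bot']
      rintro ⟨x, y⟩ hx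
      have hx' : x.1 * a - y.1 * s = 0 := congrArg Subtype.val hx
      have hx0 : x.1 = 0 := by
        by_contra hne
        exact hcon y.1 x.1 hne (sub_eq_zero.1 hx')
      rw [hx0, zero_mul, zero_sub, neg_eq_zero, mul_eq_zero, or_iff_left hs] at hx'
      ext1
      · exact Subtype.ext hx0
      · exact Subtype.ext hx'
    have h := LinearMap.finrank_le_finrank_of_injective hφ
    rw [Module.finrank_prod] at h
    omega
  have hpos : 1 ≤ Module.finrank ℂ ↥(filt g ^ 0) := by
    have := (hdim 0).1
    rw [Nat.one_le_iff_ne_zero, ← Nat.pos_iff_ne_zero, Module.finrank_pos_iff]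
    refine ⟨⟨1, by rw [pow_zero]; exact Submodule.one_le.1 (le_refl (1 : Submodule ℂ A))⟩, 0, ?_⟩
    intro h
    have h1 : (1 : A) = 0 := congrArg Subtype.val h
    exact hs (by rw [← mul_one s, h1, mul_zero])
  have hexp : ∀ m, 2 ^ m ≤ (m * d + 1) ^ Nat.card G := by
    intro m
    refine le_trans ?_ (hdim (m * d)).2
    induction m with
    | zero =>
      rw [Nat.zero_mul, pow_zero]
      exact hpos
    | succ m ih =>
      have := hdouble (m * d)
      rw [Nat.succ_mul, pow_succ]
      omega
  -- exponential growth contradicts polynomial growth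
  have hlim := tendsto_pow_const_div_const_pow_of_one_lt (Nat.card G) (r := (2 : ℝ)) one_lt_two
  have hev := (hlim.eventually_lt_const
    (show (0 : ℝ) < ((d + 1 : ℝ) ^ Nat.card G)⁻¹ by positivity)).and
      (Filter.eventually_ge_atTop 1)
  obtain ⟨m, hm, hm1⟩ := hev.exists
  have h3 : ((2 : ℝ) ^ m) ≤ (m * d + 1) ^ Nat.card G := by exact_mod_cast hexp m
  have h4 : ((m : ℝ) * d + 1) ^ Nat.card G ≤ ((d + 1 : ℝ) * m) ^ Nat.card G := by
    have hm1' : (1 : ℝ) ≤ m := by exact_mod_cast hm1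
    refine pow_le_pow_left₀ (by positivity) ?_ _
    nlinarith
  rw [div_lt_iff₀ (by positivity), ← div_eq_inv_mul, lt_div_iff₀ (by positivity),
    ← mul_pow, mul_comm (m : ℝ)] at hm
  linarith

end Filtered

/-! ### Generators and the action on polynomials -/

/-- Names of generators: `f i` (`i ∈ ι`), `α j` (`j ∈ κ`) and `h`. -/
inductive Gen (ι κ : Type) : Type
  | f (i : ι)
  | α (j : κ)
  | h

theorem Gen.finite (ι κ : Type) [Finite ι] [Finite κ] : Finite (Gen ι κ) := by
  refine Finite.of_surjective
    (fun x : ι ⊕ κ ⊕ Unit => (match x with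
      | Sum.inl i => Gen.f i
      | Sum.inr (Sum.inl j) => Gen.α j
      | Sum.inr (Sum.inr _) => Gen.h : Gen ι κ)) ?_
  rintro (i | j | _)
  · exact ⟨Sum.inl i, rfl⟩
  · exact ⟨Sum.inr (Sum.inl j), rfl⟩
  · exact ⟨Sum.inr (Sum.inr ()), rfl⟩

section Rep

open MvPolynomial

variable {ι κ : Type} (c : ι → ι → ℤ)

/-- The values on variables of the derivation which is added to the multiplication operators. -/
noncomputable def shift : Gen ι κ → Gen ι κ → MvPolynomial (Gen ι κ) ℂ
  | .f i, .f j => C ((c i j : ℂ) / 2) * X .h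
  | _, _ => 0

/-- The operator on polynomials by which a generator acts. -/
noncomputable def op (x : Gen ι κ) : Module.End ℂ (MvPolynomial (Gen ι κ) ℂ) :=
  LinearMap.mulLeft ℂ (X x) + (mkDerivation ℂ (shift c x)).toLinearMap

theorem op_apply (x : Gen ι κ) (q : MvPolynomial (Gen ι κ) ℂ) :
    op c x q = X x * q + mkDerivation ℂ (shift c x) q := rfl

theorem shift_shift (x y z : Gen ι κ) : mkDerivation ℂ (shift c x) (shift c y z) = 0 := by
  rcases y with i | j | _ <;> rcases z with i' | j' | _ <;> simp only [shift, map_zero]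
  rw [Derivation.leibniz, mkDerivation_X, derivation_C]
  rcases x with i | j | _ <;> simp [shift]

theorem op_comm (x y : Gen ι κ) :
    op c x * op c y - op c y * op c x = LinearMap.mulLeft ℂ (shift c x y - shift c y x) := by
  have hD : ⁅mkDerivation ℂ (shift c x), mkDerivation ℂ (shift c y)⁆ = 0 := by
    apply derivation_ext
    intro z
    rw [Derivation.commutator_apply, mkDerivation_X, mkDerivation_X, shift_shift, shift_shift]
    simp
  refine LinearMap.ext fun q => ?_
  have hq := congrArg (fun D => D q) hD
  simp only [Derivation.commutator_apply, Derivation.coe_zero, Pi.zero_apply] at hq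
  simp only [LinearMap.sub_apply, Module.End.mul_apply, op_apply, map_add, Derivation.leibniz,
    mkDerivation_X, smul_eq_mul, LinearMap.mulLeft_apply]
  linear_combination hq

theorem op_h : op c (Gen.h : Gen ι κ) = LinearMap.mulLeft ℂ (X Gen.h) := by
  refine LinearMap.ext fun q => ?_
  have : mkDerivation ℂ (shift c (Gen.h : Gen ι κ)) = 0 := by
    apply derivation_ext
    intro z
    simp [shift]
  rw [op_apply, this]
  simp

theorem op_comm_ff (hc : ∀ i j, c j i = - c i j) (i j : ι) :
    op c (.f i : Gen ι κ) * op c (.f j) - op c (.f j) * op c (.f i) = (c i j : ℂ) • op c .h := by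
  rw [op_comm, op_h]
  refine LinearMap.ext fun q => ?_
  simp only [shift, hc i j, LinearMap.mulLeft_apply, LinearMap.smul_apply, smul_eq_C_mul]
  rw [← sub_mul, ← C_sub]
  push_cast
  rw [show (c i j : ℂ) / 2 - -(c i j : ℂ) / 2 = c i j by ring]
  ring

theorem op_comm_zero (x y : Gen ι κ) (hx : shift c x y = 0) (hy : shift c y x = 0) :
    op c x * op c y - op c y * op c x = 0 := by
  rw [op_comm, hx, hy]
  refine LinearMap.ext fun q => ?_
  simp

theorem shift_degree (x : Gen ι κ) (k : ℕ) (q : MvPolynomial (Gen ι κ) ℂ)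
    (hq : q ∈ degLT (Gen ι κ) (k + 1)) :
    mkDerivation ℂ (shift c x) q ∈ degLT (Gen ι κ) (k + 1) := by
  classical
  rw [show mkDerivation ℂ (shift c x) q =
      ∑ m ∈ q.support, mkDerivation ℂ (shift c x) (monomial m (coeff m q)) by
    conv_lhs => rw [q.as_sum, map_sum]]
  refine Submodule.sum_mem _ fun m hm => ?_
  have hd := mem_degLT.1 hq m (mem_support_iff.1 hm)
  rw [mkDerivation_monomial, Finsupp.sum]
  refine Submodule.smul_mem _ _ (Submodule.sum_mem _ fun y hy => ?_)
  have hy0 : m y ≠ 0 := Finsupp.mem_support_iff.1 hy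
  have hle : Finsupp.single y 1 ≤ m := by
    rw [Finsupp.single_le_iff]
    omega
  have hdeg : (m - Finsupp.single y 1).degree + 1 = m.degree := by
    conv_rhs => rw [← tsub_add_cancel_of_le hle]
    rw [map_add, Finsupp.degree_single]
  have h1 : (monomial (m - Finsupp.single y 1) (m y : ℂ)).IsHomogeneous
      (m - Finsupp.single y 1).degree := isHomogeneous_monomial _ rfl
  have h2 : shift c x y ∈ degLT (Gen ι κ) 2 := by
    cases x <;> cases y <;> simp only [shift, Submodule.zero_mem]
    rw [← smul_eq_C_mul]
    exact Submodule.smul_mem _ _ (homog_mem (isHomogeneous_X ℂ _))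
  rw [smul_eq_mul]
  exact degLT_mono (by omega) (homog_mul_mem h1 h2)

theorem op_degree (x : Gen ι κ) (k : ℕ) (q : MvPolynomial (Gen ι κ) ℂ)
    (hq : q ∈ degLT (Gen ι κ) (k + 1)) : op c x q - X x * q ∈ degLT (Gen ι κ) (k + 1) := by
  rw [op_apply, add_sub_cancel_left]
  exact shift_degree c x k q hq

end Rep

/-- The Ore set structure given by common left multiples. -/
@[reducible]
noncomputable def oreSetOf {R : Type} [Ring R] [NoZeroDivisors R] [Nontrivial R]
    (H : ∀ a s : R, s ≠ 0 → ∃ r t : R, t ≠ 0 ∧ t * a = r * s) :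
    OreLocalization.OreSet (nonZeroDivisors R) :=
  Classical.choice <| OreLocalization.nonempty_oreSet_iff_of_noZeroDivisors.2 fun a s => by
    obtain ⟨r, t, ht, h⟩ := H a s (nonZeroDivisors.ne_zero s.2)
    exact ⟨r, ⟨t, mem_nonZeroDivisors_of_ne_zero ht⟩, h⟩

/-- `D` satisfies the Leibniz rule (so that it is a `ℂ`-derivation of the algebra `R`). -/
def IsDerivation {R : Type} [Ring R] [Algebra ℂ R] (D : R →ₗ[ℂ] R) : Prop :=
  ∀ x y, D (x * y) = D x * y + x * D y

/-! ### The case `l = 1` -/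

section Identities

variable {R : Type} [Ring R] (x a b : R)

theorem ident₁ : a * (x - a - b ^ 2) - (x - a - b ^ 2) * a - 2 * (b * a - a * b) * b =
    -(x * a - a * x) + (b * (b * a - a * b) - (b * a - a * b) * b) := by noncomm_ring

theorem ident₂ : (x - a - b ^ 2) * b - b * (x - a - b ^ 2) =
    (x * b - b * x) + (b * a - a * b) := by noncomm_ring

theorem ident₃ : (x + a + b ^ 2) * a - a * (x + a + b ^ 2) =
    -(a * x - x * a) + b * (b * a - a * b) + (b * a - a * b) * b := by noncomm_ring

theorem ident₄ : (x + a + b ^ 2) * b - b * (x + a + b ^ 2) =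
    (x * b - b * x) - (b * a - a * b) := by noncomm_ring

theorem ident₅ : x + a + b ^ 2 - a - b ^ 2 = x := by noncomm_ring

theorem ident₆ : -(2 * a * b) + a * b + a * b = 0 := by noncomm_ring

end Identities

/-- The defining relations for `l = 1`. -/
inductive RelOne : FreeAlgebra ℂ (Gen (Fin 3) (Fin 2)) → FreeAlgebra ℂ (Gen (Fin 3) (Fin 2)) → Prop
  | f1f0 : RelOne
      (FreeAlgebra.ι ℂ (.f 1) * FreeAlgebra.ι ℂ (.f 0) - FreeAlgebra.ι ℂ (.f 0) * FreeAlgebra.ι ℂ (.f 1))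
      (2 * FreeAlgebra.ι ℂ .h * FreeAlgebra.ι ℂ (.f 2))
  | f0f2 : RelOne
      (FreeAlgebra.ι ℂ (.f 0) * FreeAlgebra.ι ℂ (.f 2) - FreeAlgebra.ι ℂ (.f 2) * FreeAlgebra.ι ℂ (.f 0))
      (FreeAlgebra.ι ℂ .h)
  | f2f1 : RelOne
      (FreeAlgebra.ι ℂ (.f 2) * FreeAlgebra.ι ℂ (.f 1) - FreeAlgebra.ι ℂ (.f 1) * FreeAlgebra.ι ℂ (.f 2))
      (FreeAlgebra.ι ℂ .h)
  | fα (i : Fin 3) (j : Fin 2) : RelOne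
      (FreeAlgebra.ι ℂ (.f i) * FreeAlgebra.ι ℂ (.α j) - FreeAlgebra.ι ℂ (.α j) * FreeAlgebra.ι ℂ (.f i)) 0
  | αα (i j : Fin 2) : RelOne
      (FreeAlgebra.ι ℂ (.α i) * FreeAlgebra.ι ℂ (.α j) - FreeAlgebra.ι ℂ (.α j) * FreeAlgebra.ι ℂ (.α i)) 0
  | hα (j : Fin 2) : RelOne
      (FreeAlgebra.ι ℂ .h * FreeAlgebra.ι ℂ (.α j) - FreeAlgebra.ι ℂ (.α j) * FreeAlgebra.ι ℂ .h) 0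
  | fh (i : Fin 3) : RelOne
      (FreeAlgebra.ι ℂ (.f i) * FreeAlgebra.ι ℂ .h - FreeAlgebra.ι ℂ .h * FreeAlgebra.ι ℂ (.f i)) 0

/-- The algebra over `ℂ` with the generators `f₀, f₁, f₂, α₀, α₁, h` and the relations `RelOne`. -/
abbrev AlgOne : Type := RingQuot RelOne

/-- The generators of `AlgOne`. -/
noncomputable def AlgOne.gen (x : Gen (Fin 3) (Fin 2)) : AlgOne :=
  RingQuot.mkAlgHom ℂ RelOne (FreeAlgebra.ι ℂ x)

/-- Commutator coefficients in the coordinates `f₀ + f₁ + f₂²`, `f₁`, `f₂`. -/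
def cOne (i j : Fin 3) : ℤ := if i = 2 ∧ j = 1 then 1 else if i = 1 ∧ j = 2 then -1 else 0

/-- The generators `f₀ + f₁ + f₂²`, `f₁`, `f₂`, `α₀`, `α₁`, `h` of `AlgOne`. -/
noncomputable def AlgOne.gen' : Gen (Fin 3) (Fin 2) → AlgOne
  | .f i => if i = 0 then AlgOne.gen (.f 0) + AlgOne.gen (.f 1) + AlgOne.gen (.f 2) ^ 2
      else AlgOne.gen (.f i)
  | x => AlgOne.gen x

/-- The operators by which the generators of `AlgOne` act on polynomials. -/
noncomputable def AlgOne.opOne :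
    Gen (Fin 3) (Fin 2) → Module.End ℂ (MvPolynomial (Gen (Fin 3) (Fin 2)) ℂ)
  | .f i => if i = 0 then op cOne (.f 0) - op cOne (.f 1) - op cOne (.f 2) ^ 2
      else op cOne (.f i)
  | x => op cOne x

theorem AlgOne.exists_rep :
    ∃ ρ : AlgOne →ₐ[ℂ] Module.End ℂ (MvPolynomial (Gen (Fin 3) (Fin 2)) ℂ),
      ∀ x, ρ (AlgOne.gen x) = AlgOne.opOne x := by
  have hc : ∀ i j : Fin 3, cOne j i = - cOne i j := by decide
  have e21 := op_comm_ff (κ := Fin 2) cOne hc 2 1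
  have e01 := op_comm_ff (κ := Fin 2) cOne hc 0 1
  have e02 := op_comm_ff (κ := Fin 2) cOne hc 0 2
  rw [show cOne 2 1 = 1 by decide, Int.cast_one, one_smul] at e21
  rw [show cOne 0 1 = 0 by decide, Int.cast_zero, zero_smul] at e01
  rw [show cOne 0 2 = 0 by decide, Int.cast_zero, zero_smul] at e02
  have efh : ∀ i : Fin 3, Commute (op cOne (.f i : Gen (Fin 3) (Fin 2))) (op cOne .h) := fun i =>
    sub_eq_zero.1 (op_comm_zero cOne _ _ rfl rfl)
  have efα : ∀ (i : Fin 3) (j : Fin 2), Commute (op cOne (.f i)) (op cOne (.α j)) := fun i j =>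
    sub_eq_zero.1 (op_comm_zero cOne _ _ rfl rfl)
  have e2h := efh 2
  refine ⟨RingQuot.liftAlgHom ℂ ⟨FreeAlgebra.lift ℂ AlgOne.opOne, ?_⟩, fun x => ?_⟩
  · intro x y hxy
    cases hxy with
    | f1f0 =>
      simp only [map_sub, map_mul, FreeAlgebra.lift_ι_apply, AlgOne.opOne, map_ofNat]
      simp only [if_true, if_neg (show (1 : Fin 3) ≠ 0 by decide),
        if_neg (show (2 : Fin 3) ≠ 0 by decide)]
      generalize op cOne (Gen.f 0 : Gen (Fin 3) (Fin 2)) = x at *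
      generalize op cOne (Gen.f 1 : Gen (Fin 3) (Fin 2)) = a at *
      generalize op cOne (Gen.f 2 : Gen (Fin 3) (Fin 2)) = b at *
      rw [← e21] at e2h ⊢
      have e2h' := sub_eq_zero.2 e2h.eq
      rw [← sub_eq_zero]
      rw [ident₁ x a b, e01, e2h']
      simp
    | f0f2 =>
      simp only [map_sub, map_mul, FreeAlgebra.lift_ι_apply, AlgOne.opOne]
      simp only [if_true, if_neg (show (2 : Fin 3) ≠ 0 by decide)]
      rw [← e21]
      generalize op cOne (Gen.f 0 : Gen (Fin 3) (Fin 2)) = x at *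
      generalize op cOne (Gen.f 1 : Gen (Fin 3) (Fin 2)) = a at *
      generalize op cOne (Gen.f 2 : Gen (Fin 3) (Fin 2)) = b at *
      rw [ident₂ x a b, e02, zero_add]
    | f2f1 =>
      simp only [map_sub, map_mul, FreeAlgebra.lift_ι_apply, AlgOne.opOne]
      simpa only [if_neg (show (1 : Fin 3) ≠ 0 by decide),
        if_neg (show (2 : Fin 3) ≠ 0 by decide)] using e21
    | fα i j =>
      simp only [map_sub, map_mul, map_zero, FreeAlgebra.lift_ι_apply, AlgOne.opOne]
      rw [sub_eq_zero]
      split_ifs with h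
      · exact (((efα 0 j).sub_left (efα 1 j)).sub_left ((efα 2 j).pow_left 2)).eq
      · exact (efα i j).eq
    | αα i j =>
      simp only [map_sub, map_mul, map_zero, FreeAlgebra.lift_ι_apply, AlgOne.opOne]
      exact op_comm_zero cOne _ _ rfl rfl
    | hα j =>
      simp only [map_sub, map_mul, map_zero, FreeAlgebra.lift_ι_apply, AlgOne.opOne]
      exact op_comm_zero cOne _ _ rfl rfl
    | fh i =>
      simp only [map_sub, map_mul, map_zero, FreeAlgebra.lift_ι_apply, AlgOne.opOne]
      rw [sub_eq_zero]
      split_ifs with h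
      · exact (((efh 0).sub_left (efh 1)).sub_left ((efh 2).pow_left 2)).eq
      · exact (efh i).eq
  · rw [AlgOne.gen, RingQuot.liftAlgHom_mkAlgHom_apply, FreeAlgebra.lift_ι_apply]

theorem AlgOne.adjoin_gen : Algebra.adjoin ℂ (Set.range AlgOne.gen) = ⊤ := by
  rw [show AlgOne.gen = RingQuot.mkAlgHom ℂ RelOne ∘ FreeAlgebra.ι ℂ from rfl, Set.range_comp,
    ← AlgHom.map_adjoin, FreeAlgebra.adjoin_range_ι, Algebra.map_top, AlgHom.range_eq_top]
  exact RingQuot.mkAlgHom_surjective ℂ RelOne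

theorem AlgOne.adjoin_gen' : Algebra.adjoin ℂ (Set.range AlgOne.gen') = ⊤ := by
  rw [← top_le_iff, ← AlgOne.adjoin_gen, Algebra.adjoin_le_iff]
  have hmem : ∀ x, AlgOne.gen' x ∈ Algebra.adjoin ℂ (Set.range AlgOne.gen') :=
    fun x => Algebra.subset_adjoin ⟨x, rfl⟩
  rintro _ ⟨x, rfl⟩
  rcases x with i | j | _
  · fin_cases i
    · have h := sub_mem (sub_mem (hmem (.f 0)) (hmem (.f 1))) (pow_mem (hmem (.f 2)) 2)
      simp only [AlgOne.gen', if_true, if_neg (show (1 : Fin 3) ≠ 0 by decide),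
        if_neg (show (2 : Fin 3) ≠ 0 by decide), ident₅] at h
      exact h
    · exact hmem (.f 1)
    · exact hmem (.f 2)
  · exact hmem (.α j)
  · exact hmem .h

theorem AlgOne.rel {x y : FreeAlgebra ℂ (Gen (Fin 3) (Fin 2))} (h : RelOne x y) :
    RingQuot.mkAlgHom ℂ RelOne x = RingQuot.mkAlgHom ℂ RelOne y :=
  RingQuot.mkAlgHom_rel ℂ h

theorem AlgOne.comm_mem (x y : Gen (Fin 3) (Fin 2)) :
    AlgOne.gen' x * AlgOne.gen' y - AlgOne.gen' y * AlgOne.gen' x ∈ filt AlgOne.gen' := by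
  have e10 := AlgOne.rel .f1f0
  have e02 := AlgOne.rel .f0f2
  have e21 := AlgOne.rel .f2f1
  have efα := fun i j => AlgOne.rel (.fα i j)
  have eαα := fun i j => AlgOne.rel (.αα i j)
  have ehα := fun j => AlgOne.rel (.hα j)
  have efh := fun i => AlgOne.rel (.fh i)
  simp only [map_sub, map_mul, map_zero, map_ofNat] at e10 e02 e21 efα eαα ehα efh
  change AlgOne.gen _ * AlgOne.gen _ - AlgOne.gen _ * AlgOne.gen _ =
    2 * AlgOne.gen _ * AlgOne.gen _ at e10
  change AlgOne.gen _ * AlgOne.gen _ - AlgOne.gen _ * AlgOne.gen _ = AlgOne.gen _ at e02 e21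
  change ∀ i j, AlgOne.gen _ * AlgOne.gen _ - AlgOne.gen _ * AlgOne.gen _ = 0 at efα eαα
  change ∀ j, AlgOne.gen _ * AlgOne.gen _ - AlgOne.gen _ * AlgOne.gen _ = 0 at ehα efh
  simp only [sub_eq_zero] at efα eαα ehα efh
  have cα : ∀ j x, Commute (AlgOne.gen (.α j)) (AlgOne.gen' x) := by
    intro j x
    rcases x with i | i | _
    · rw [AlgOne.gen']
      split_ifs
      · exact ((Commute.symm (efα 0 j)).add_right (Commute.symm (efα 1 j))).add_right
          ((Commute.symm (efα 2 j)).pow_right 2)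
      · exact (efα i j).symm
    · exact eαα j i
    · exact (ehα j).symm
  have ch : ∀ x, Commute (AlgOne.gen .h) (AlgOne.gen' x) := by
    intro x
    rcases x with i | i | _
    · rw [AlgOne.gen']
      split_ifs
      · exact ((Commute.symm (efh 0)).add_right (Commute.symm (efh 1))).add_right
          ((Commute.symm (efh 2)).pow_right 2)
      · exact (efh i).symm
    · exact ehα i
    · exact Commute.refl _
  have x1 : Commute (AlgOne.gen' (.f 0)) (AlgOne.gen (.f 1)) := by
    have h2 := efh 2
    simp only [AlgOne.gen', if_true]
    rw [commute_iff_eq, ← sub_eq_zero]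
    generalize AlgOne.gen (.f 0) = a at *
    generalize AlgOne.gen (.f 1) = b at *
    generalize AlgOne.gen (.f 2) = c at *
    generalize AlgOne.gen .h = h at *
    rw [ident₃ a b c, e10, e21, h2, ident₆]
  have x2 : Commute (AlgOne.gen' (.f 0)) (AlgOne.gen (.f 2)) := by
    simp only [AlgOne.gen', if_true]
    rw [commute_iff_eq, ← sub_eq_zero]
    generalize AlgOne.gen (.f 0) = a at *
    generalize AlgOne.gen (.f 1) = b at *
    generalize AlgOne.gen (.f 2) = c at *
    rw [ident₄ a b c, e02, e21, sub_self]
  have hmem : AlgOne.gen .h ∈ filt AlgOne.gen' := gen_mem_filt AlgOne.gen' .h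
  have key : ∀ {x y : AlgOne}, Commute x y → x * y - y * x ∈ filt AlgOne.gen' := fun h => by
    rw [h.eq, sub_self]; exact Submodule.zero_mem _
  rcases x with i | j | _
  · rcases y with i' | j' | _
    · fin_cases i <;> fin_cases i'
      · exact key (Commute.refl _)
      · exact key x1
      · exact key x2
      · exact key x1.symm
      · exact key (Commute.refl _)
      · change AlgOne.gen (.f 1) * AlgOne.gen (.f 2) - AlgOne.gen (.f 2) * AlgOne.gen (.f 1) ∈ _
        rw [← neg_sub, e21]
        exact Submodule.neg_mem _ hmem
      · exact key x2.symm
      · change AlgOne.gen (.f 2) * AlgOne.gen (.f 1) - AlgOne.gen (.f 1) * AlgOne.gen (.f 2) ∈ _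
        rw [e21]
        exact hmem
      · exact key (Commute.refl _)
    · exact key (cα j' _).symm
    · exact key (ch _).symm
  · exact key (cα j y)
  · exact key (ch y)

theorem AlgOne.exists_rep' :
    ∃ ρ : AlgOne →ₐ[ℂ] Module.End ℂ (MvPolynomial (Gen (Fin 3) (Fin 2)) ℂ),
      ∀ x, ρ (AlgOne.gen' x) = op cOne x := by
  obtain ⟨ρ, hρ⟩ := AlgOne.exists_rep
  refine ⟨ρ, fun x => ?_⟩
  rcases x with i | j | _
  · rw [AlgOne.gen']
    split_ifs with h
    · subst h
      simp only [map_add, map_pow, hρ, AlgOne.opOne, if_true,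
        if_neg (show (1 : Fin 3) ≠ 0 by decide), if_neg (show (2 : Fin 3) ≠ 0 by decide)]
      abel
    · rw [hρ, AlgOne.opOne, if_neg h]
  · exact hρ _
  · exact hρ _

instance : Nontrivial AlgOne :=
  AlgOne.exists_rep.choose.toRingHom.domain_nontrivial

instance : NoZeroDivisors AlgOne := by
  obtain ⟨ρ, hρ⟩ := AlgOne.exists_rep'
  exact noZeroDivisors_of_rep ρ AlgOne.adjoin_gen' AlgOne.comm_mem
    (fun x k q hq => by rw [hρ]; exact op_degree cOne x k q hq)

theorem AlgOne.ore (a s : AlgOne) (hs : s ≠ 0) : ∃ r t : AlgOne, t ≠ 0 ∧ t * a = r * s := by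
  have := Gen.finite (Fin 3) (Fin 2)
  obtain ⟨ρ, hρ⟩ := AlgOne.exists_rep'
  exact exists_common_multiple ρ AlgOne.adjoin_gen' AlgOne.comm_mem
    (fun x k q hq => by rw [hρ]; exact op_degree cOne x k q hq) a s hs

noncomputable instance : OreLocalization.OreSet (nonZeroDivisors AlgOne) := oreSetOf AlgOne.ore

/-- The skew field `𝒦₁`: the quotient skew field of the Ore domain `AlgOne`. -/
def KOne : Type := OreLocalization (nonZeroDivisors AlgOne) AlgOne

noncomputable instance : DivisionRing KOne :=
  inferInstanceAs (DivisionRing (OreLocalization (nonZeroDivisors AlgOne) AlgOne))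

noncomputable instance : Algebra ℂ KOne :=
  inferInstanceAs (Algebra ℂ (OreLocalization (nonZeroDivisors AlgOne) AlgOne))

namespace KOne

/-- The canonical map of `AlgOne` to its quotient skew field. -/
noncomputable def of : AlgOne →+* KOne := OreLocalization.numeratorRingHom

/-- The generator `f_i` of `𝒦₁`. -/
noncomputable def f (i : Fin 3) : KOne := of (AlgOne.gen (.f i))

/-- The generator `α_i` of `𝒦₁`. -/
noncomputable def α (i : Fin 2) : KOne := of (AlgOne.gen (.α i))

/-- The generator `h` of `𝒦₁`. -/
noncomputable def h : KOne := of (AlgOne.gen .h)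

/-- The Hamiltonian `H₀ = (f₀ f₁ + f₁ f₀) / 2 + α₁ f₂`. -/
noncomputable def H₀ : KOne := (1 / 2 : ℂ) • (f 0 * f 1 + f 1 * f 0) + α 1 * f 2

/-- `k = α₀ + α₁`. -/
noncomputable def k : KOne := α 0 + α 1

/-- `D` is a `ℂ`-derivation of `𝒦₁` with the values on the generators prescribed by `H₀`. -/
structure IsHamiltonianDerivation (D : KOne →ₗ[ℂ] KOne) : Prop where
  leibniz : IsDerivation D
  map_f : ∀ i, D (f i) = h⁻¹ * (H₀ * f i - f i * H₀) + if i = 0 then k else 0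
  map_α : ∀ i, D (α i) = h⁻¹ * (H₀ * α i - α i * H₀)
  map_h : D h = h⁻¹ * (H₀ * h - h * H₀)

/-- `s` is the `ℂ`-algebra automorphism `s₀` of `𝒦₁`. -/
structure IsS0 (s : KOne ≃ₐ[ℂ] KOne) : Prop where
  map_f0 : s (f 0) = f 0
  map_f1 : s (f 1) = f 1 - f 2 * (α 0 / f 0) - α 0 / f 0 * f 2 - α 0 ^ 2 / f 0 ^ 2
  map_f2 : s (f 2) = f 2 + α 0 / f 0
  map_α0 : s (α 0) = -α 0
  map_α1 : s (α 1) = α 1 + 2 * α 0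
  map_h : s h = h

/-- `s` is the `ℂ`-algebra automorphism `s₁` of `𝒦₁`. -/
structure IsS1 (s : KOne ≃ₐ[ℂ] KOne) : Prop where
  map_f0 : s (f 0) = f 0 + f 2 * (α 1 / f 1) + α 1 / f 1 * f 2 - α 1 ^ 2 / f 1 ^ 2
  map_f1 : s (f 1) = f 1
  map_f2 : s (f 2) = f 2 - α 1 / f 1
  map_α0 : s (α 0) = α 0 + 2 * α 1
  map_α1 : s (α 1) = -α 1
  map_h : s h = h

/-- `p` is the `ℂ`-algebra automorphism `π` of `𝒦₁`. -/
structure IsPi (p : KOne ≃ₐ[ℂ] KOne) : Prop where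
  map_f0 : p (f 0) = f 1
  map_f1 : p (f 1) = f 0
  map_f2 : p (f 2) = -f 2
  map_α0 : p (α 0) = α 1
  map_α1 : p (α 1) = α 0
  map_h : p h = h

end KOne

/-! ### The case `l ≥ 2`

Indices are elements of `ZMod (l + 1)`. The definitions make sense for every `l`, but are meant
for `l ≥ 2`. -/

/-- The matrix `U`: `u_{i,i+1} = 1`, `u_{i,i-1} = -1`, and all other entries vanish. -/
def u (l : ℕ) (i j : ZMod (l + 1)) : ℤ := (if j = i + 1 then 1 else 0) - (if j = i - 1 then 1 else 0)

/-- The generalized Cartan matrix of type `A_l^{(1)}`. -/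
def cartan (l : ℕ) (i j : ZMod (l + 1)) : ℤ :=
  if j = i then 2 else if j = i + 1 ∨ j = i - 1 then -1 else 0

/-- The defining relations for `l ≥ 2`: `[f_i, f_{i+1}] = h`, `[f_i, f_j] = 0` for `j ≠ i ± 1`
(that is, `[f_i, f_j] = u_{ij} h`), and the `α_j` and `h` are central. -/
inductive Rel (l : ℕ) : FreeAlgebra ℂ (Gen (ZMod (l + 1)) (ZMod (l + 1))) →
    FreeAlgebra ℂ (Gen (ZMod (l + 1)) (ZMod (l + 1))) → Prop
  | ff (i j : ZMod (l + 1)) : Rel l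
      (FreeAlgebra.ι ℂ (.f i) * FreeAlgebra.ι ℂ (.f j) - FreeAlgebra.ι ℂ (.f j) * FreeAlgebra.ι ℂ (.f i))
      ((u l i j : ℂ) • FreeAlgebra.ι ℂ .h)
  | fα (i j : ZMod (l + 1)) : Rel l
      (FreeAlgebra.ι ℂ (.f i) * FreeAlgebra.ι ℂ (.α j) - FreeAlgebra.ι ℂ (.α j) * FreeAlgebra.ι ℂ (.f i)) 0
  | αα (i j : ZMod (l + 1)) : Rel l
      (FreeAlgebra.ι ℂ (.α i) * FreeAlgebra.ι ℂ (.α j) - FreeAlgebra.ι ℂ (.α j) * FreeAlgebra.ι ℂ (.α i)) 0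
  | hf (j : ZMod (l + 1)) : Rel l
      (FreeAlgebra.ι ℂ .h * FreeAlgebra.ι ℂ (.f j) - FreeAlgebra.ι ℂ (.f j) * FreeAlgebra.ι ℂ .h) 0
  | hα (j : ZMod (l + 1)) : Rel l
      (FreeAlgebra.ι ℂ .h * FreeAlgebra.ι ℂ (.α j) - FreeAlgebra.ι ℂ (.α j) * FreeAlgebra.ι ℂ .h) 0

/-- The algebra over `ℂ` with the generators `f_i`, `α_i` (`i ∈ ZMod (l + 1)`), `h` and the relations
`Rel l`. -/
abbrev Alg (l : ℕ) : Type := RingQuot (Rel l)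

/-- The generators of `Alg l`. -/
noncomputable def Alg.gen (l : ℕ) (x : Gen (ZMod (l + 1)) (ZMod (l + 1))) : Alg l :=
  RingQuot.mkAlgHom ℂ (Rel l) (FreeAlgebra.ι ℂ x)

theorem u_antisymm (l : ℕ) (i j : ZMod (l + 1)) : u l j i = - u l i j := by
  have h1 : i = j + 1 ↔ j = i - 1 := by rw [eq_sub_iff_add_eq, eq_comm]
  have h2 : i = j - 1 ↔ j = i + 1 := by rw [eq_sub_iff_add_eq, eq_comm]
  simp only [u, h1, h2]
  ring

theorem Alg.exists_rep (l : ℕ) :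
    ∃ ρ : Alg l →ₐ[ℂ] Module.End ℂ (MvPolynomial (Gen (ZMod (l + 1)) (ZMod (l + 1))) ℂ),
      ∀ x, ρ (Alg.gen l x) = op (u l) x := by
  refine ⟨RingQuot.liftAlgHom ℂ ⟨FreeAlgebra.lift ℂ (op (u l)), ?_⟩, fun x => ?_⟩
  · intro x y hxy
    cases hxy with
    | ff i j =>
      simp only [map_sub, map_mul, map_smul, FreeAlgebra.lift_ι_apply]
      exact op_comm_ff (u l) (u_antisymm l) i j
    | fα i j =>
      simp only [map_sub, map_mul, map_zero, FreeAlgebra.lift_ι_apply]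
      exact op_comm_zero (u l) _ _ rfl rfl
    | αα i j =>
      simp only [map_sub, map_mul, map_zero, FreeAlgebra.lift_ι_apply]
      exact op_comm_zero (u l) _ _ rfl rfl
    | hf j =>
      simp only [map_sub, map_mul, map_zero, FreeAlgebra.lift_ι_apply]
      exact op_comm_zero (u l) _ _ rfl rfl
    | hα j =>
      simp only [map_sub, map_mul, map_zero, FreeAlgebra.lift_ι_apply]
      exact op_comm_zero (u l) _ _ rfl rfl
  · rw [Alg.gen, RingQuot.liftAlgHom_mkAlgHom_apply, FreeAlgebra.lift_ι_apply]

theorem Alg.adjoin_gen (l : ℕ) : Algebra.adjoin ℂ (Set.range (Alg.gen l)) = ⊤ := by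
  rw [show Alg.gen l = RingQuot.mkAlgHom ℂ (Rel l) ∘ FreeAlgebra.ι ℂ from rfl, Set.range_comp,
    ← AlgHom.map_adjoin, FreeAlgebra.adjoin_range_ι, Algebra.map_top, AlgHom.range_eq_top]
  exact RingQuot.mkAlgHom_surjective ℂ (Rel l)

theorem Alg.ff (l : ℕ) (i j : ZMod (l + 1)) :
    Alg.gen l (.f i) * Alg.gen l (.f j) - Alg.gen l (.f j) * Alg.gen l (.f i)
      = (u l i j : ℂ) • Alg.gen l .h := by
  have h := RingQuot.mkAlgHom_rel ℂ (Rel.ff (l := l) i j)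
  simp only [map_sub, map_mul, map_smul] at h
  exact h

theorem Alg.fα (l : ℕ) (i j : ZMod (l + 1)) : Commute (Alg.gen l (.f i)) (Alg.gen l (.α j)) := by
  have h := RingQuot.mkAlgHom_rel ℂ (Rel.fα (l := l) i j)
  simp only [map_sub, map_mul, map_zero] at h
  exact sub_eq_zero.1 h

theorem Alg.αα (l : ℕ) (i j : ZMod (l + 1)) : Commute (Alg.gen l (.α i)) (Alg.gen l (.α j)) := by
  have h := RingQuot.mkAlgHom_rel ℂ (Rel.αα (l := l) i j)
  simp only [map_sub, map_mul, map_zero] at h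
  exact sub_eq_zero.1 h

theorem Alg.hf (l : ℕ) (j : ZMod (l + 1)) : Commute (Alg.gen l .h) (Alg.gen l (.f j)) := by
  have h := RingQuot.mkAlgHom_rel ℂ (Rel.hf (l := l) j)
  simp only [map_sub, map_mul, map_zero] at h
  exact sub_eq_zero.1 h

theorem Alg.hα (l : ℕ) (j : ZMod (l + 1)) : Commute (Alg.gen l .h) (Alg.gen l (.α j)) := by
  have h := RingQuot.mkAlgHom_rel ℂ (Rel.hα (l := l) j)
  simp only [map_sub, map_mul, map_zero] at h
  exact sub_eq_zero.1 h

theorem Alg.comm_mem (l : ℕ) (x y : Gen (ZMod (l + 1)) (ZMod (l + 1))) :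
    Alg.gen l x * Alg.gen l y - Alg.gen l y * Alg.gen l x ∈ filt (Alg.gen l) := by
  have key : ∀ {x y : Alg l}, Commute x y → x * y - y * x ∈ filt (Alg.gen l) := fun h => by
    rw [h.eq, sub_self]; exact Submodule.zero_mem _
  rcases x with i | i | _ <;> rcases y with j | j | _
  · rw [Alg.ff]
    exact Submodule.smul_mem _ _ (gen_mem_filt _ _)
  · exact key (Alg.fα l i j)
  · exact key (Alg.hf l i).symm
  · exact key (Alg.fα l j i).symm
  · exact key (Alg.αα l i j)
  · exact key (Alg.hα l i).symm
  · exact key (Alg.hf l j)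
  · exact key (Alg.hα l j)
  · exact key (Commute.refl _)

instance (l : ℕ) : Nontrivial (Alg l) :=
  (Alg.exists_rep l).choose.toRingHom.domain_nontrivial

instance (l : ℕ) : NoZeroDivisors (Alg l) := by
  obtain ⟨ρ, hρ⟩ := Alg.exists_rep l
  exact noZeroDivisors_of_rep ρ (Alg.adjoin_gen l) (Alg.comm_mem l)
    (fun x k q hq => by rw [hρ]; exact op_degree (u l) x k q hq)

theorem Alg.ore (l : ℕ) (a s : Alg l) (hs : s ≠ 0) : ∃ r t : Alg l, t ≠ 0 ∧ t * a = r * s := by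
  have : Finite (ZMod (l + 1)) := Finite.of_fintype _
  have := Gen.finite (ZMod (l + 1)) (ZMod (l + 1))
  obtain ⟨ρ, hρ⟩ := Alg.exists_rep l
  exact exists_common_multiple ρ (Alg.adjoin_gen l) (Alg.comm_mem l)
    (fun x k q hq => by rw [hρ]; exact op_degree (u l) x k q hq) a s hs

noncomputable instance (l : ℕ) : OreLocalization.OreSet (nonZeroDivisors (Alg l)) :=
  oreSetOf (Alg.ore l)

/-- The skew field `𝒦_l` (`l ≥ 2`): the quotient skew field of the Ore domain `Alg l`. -/
def K (l : ℕ) : Type := OreLocalization (nonZeroDivisors (Alg l)) (Alg l)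

noncomputable instance (l : ℕ) : DivisionRing (K l) :=
  inferInstanceAs (DivisionRing (OreLocalization (nonZeroDivisors (Alg l)) (Alg l)))

noncomputable instance (l : ℕ) : Algebra ℂ (K l) :=
  inferInstanceAs (Algebra ℂ (OreLocalization (nonZeroDivisors (Alg l)) (Alg l)))

namespace K

/-- The canonical map of `Alg l` to its quotient skew field. -/
noncomputable def of (l : ℕ) : Alg l →+* K l := OreLocalization.numeratorRingHom

variable (l : ℕ)

/-- The generator `f_i` of `𝒦_l`. -/
noncomputable def f (i : ZMod (l + 1)) : K l := of l (Alg.gen l (.f i))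

/-- The generator `α_i` of `𝒦_l`. -/
noncomputable def α (i : ZMod (l + 1)) : K l := of l (Alg.gen l (.α i))

/-- The generator `h` of `𝒦_l`. -/
noncomputable def h : K l := of l (Alg.gen l .h)

/-- The fundamental weights: `ϖ_i = ∑_{r=1}^l (min{i,r} - i r / (l+1)) α_r` for `0 ≤ i ≤ l`; in
particular `ϖ_0 = 0`. -/
noncomputable def varpi (i : ZMod (l + 1)) : K l :=
  ∑ r ∈ Finset.Icc 1 l,
    (((min i.val r : ℕ) : ℂ) - (i.val : ℂ) * (r : ℂ) / ((l : ℂ) + 1)) • α l (r : ZMod (l + 1))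

/-- The connected components of a proper subset `C` of `ZMod (l + 1)`: the pair `(i, m)`, where
`1 ≤ m ≤ l`, stands for the component `{i, i+1, …, i+m-1}`, which is contained in `C` while `i-1` and
`i+m` are not in `C`. -/
def components (C : Finset (ZMod (l + 1))) : Finset (ZMod (l + 1) × ℕ) :=
  (Finset.univ ×ˢ Finset.Icc 1 l).filter fun c =>
    c.1 - 1 ∉ C ∧ (∀ t < c.2, c.1 + (t : ZMod (l + 1)) ∈ C) ∧ c.1 + (c.2 : ZMod (l + 1)) ∉ C

/-- `χ(C)`: the sum of `ϖ_i - ϖ_{i+1} + ⋯ + (-1)^{m-1} ϖ_{i+m-1}` over the connected components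
`{i, …, i+m-1}` of `C`. -/
noncomputable def χ (C : Finset (ZMod (l + 1))) : K l :=
  ∑ c ∈ components l C, ∑ t ∈ Finset.range c.2, (-1) ^ t * varpi l (c.1 + (t : ZMod (l + 1)))

/-- `S_d`: the set of the `K ⊆ ZMod (l + 1)` with `d` elements such that all connected components of the
complement of `K` have even length. -/
def S (d : ℕ) : Finset (Finset (ZMod (l + 1))) :=
  (Finset.powersetCard d Finset.univ).filter fun K => ∀ c ∈ components l Kᶜ, Even c.2

/-- The ordered product `f_i f_{i+1} ⋯ f_{i+m-1}`. -/
noncomputable def fRun (i : ZMod (l + 1)) (m : ℕ) : K l :=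
  ((List.range m).map fun t : ℕ => f l (i + (t : ZMod (l + 1)))).prod

theorem f_commute {i j : ZMod (l + 1)} (h1 : j ≠ i + 1) (h2 : i ≠ j + 1) :
    Commute (f l i) (f l j) := by
  have h3 : j ≠ i - 1 := fun h => h2 (by rw [h, sub_add_cancel])
  have h := Alg.ff l i j
  rw [u, if_neg h1, if_neg h3, sub_self, Int.cast_zero, zero_smul, sub_eq_zero] at h
  exact (show Commute _ _ from h).map (of l)

theorem components_aux {C : Finset (ZMod (l + 1))} {c d : ZMod (l + 1) × ℕ}
    (hc : c ∈ components l C) (hd : d ∈ components l C) {s t : ℕ} (hs : s < c.2) (ht : t < d.2)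
    (hst : s ≤ t) (h : c.1 + (s : ZMod (l + 1)) = d.1 + (t : ZMod (l + 1))) : c = d := by
  obtain ⟨i, m⟩ := c
  obtain ⟨j, m'⟩ := d
  simp only [components, Finset.mem_filter] at hc hd hs ht h
  obtain ⟨-, hc1, hc2, hc3⟩ := hc
  obtain ⟨-, hd1, hd2, hd3⟩ := hd
  have hi : i = j + ((t - s : ℕ) : ZMod (l + 1)) := by
    rw [Nat.cast_sub hst]
    linear_combination h
  have hts : t - s = 0 := by
    by_contra hne
    refine hc1 ?_
    have := hd2 (t - s - 1) (by omega)
    rwa [Nat.cast_sub (by omega), Nat.cast_one, ← add_sub_assoc, ← hi] at this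
  rw [hts, Nat.cast_zero, add_zero] at hi
  subst hi
  rcases lt_trichotomy m m' with hm | hm | hm
  · exact absurd (hd2 m hm) hc3
  · rw [hm]
  · exact absurd (hc2 m' hm) hd3

theorem components_disjoint {C : Finset (ZMod (l + 1))} {c d : ZMod (l + 1) × ℕ}
    (hc : c ∈ components l C) (hd : d ∈ components l C) (hne : c ≠ d) {s t : ℕ}
    (hs : s < c.2) (ht : t < d.2) :
    c.1 + (s : ZMod (l + 1)) ≠ d.1 + (t : ZMod (l + 1)) := by
  intro h
  rcases le_total s t with hst | hst
  · exact hne (components_aux l hc hd hs ht hst h)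
  · exact hne (components_aux l hd hc ht hs hst h.symm).symm

theorem components_not_adj {C : Finset (ZMod (l + 1))} {c d : ZMod (l + 1) × ℕ}
    (hc : c ∈ components l C) (hd : d ∈ components l C) (hne : c ≠ d) {s t : ℕ}
    (hs : s < c.2) (ht : t < d.2) :
    d.1 + (t : ZMod (l + 1)) ≠ c.1 + (s : ZMod (l + 1)) + 1 := by
  intro h
  have h' : d.1 + (t : ZMod (l + 1)) = c.1 + ((s + 1 : ℕ) : ZMod (l + 1)) := by
    rw [h]; push_cast; ring
  rcases Nat.lt_or_ge (s + 1) c.2 with h1 | h1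
  · exact components_disjoint l hc hd hne h1 ht h'.symm
  · have h2 : s + 1 = c.2 := by omega
    rw [h2] at h'
    have hc3 := (Finset.mem_filter.1 hc).2.2.2
    have hd2 := (Finset.mem_filter.1 hd).2.2.1 t ht
    rw [h'] at hd2
    exact hc3 hd2

theorem fRun_commute (C : Finset (ZMod (l + 1))) :
    (components l C : Set (ZMod (l + 1) × ℕ)).Pairwise
      (Function.onFun Commute fun c => fRun l c.1 c.2) := by
  intro c hc d hd hne
  refine Commute.list_prod_left _ _ fun x hx => Commute.list_prod_right _ _ fun y hy => ?_
  obtain ⟨s, hs, rfl⟩ := List.mem_map.1 hx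
  obtain ⟨t, ht, rfl⟩ := List.mem_map.1 hy
  rw [List.mem_range] at hs ht
  exact f_commute l (components_not_adj l hc hd hne hs ht)
    (components_not_adj l hd hc hne.symm ht hs)

/-- `f_C` for a proper subset `C` of `ZMod (l + 1)`: the product of the ordered products
`f_i f_{i+1} ⋯ f_{i+m-1}` over the connected components of `C` (these commute with each other). -/
noncomputable def fSet (C : Finset (ZMod (l + 1))) : K l :=
  (components l C).noncommProd (fun c => fRun l c.1 c.2) (fRun_commute l C)

/-- The Hamiltonian `H₀` (for `l ≥ 2`). -/
noncomputable def H₀ : K l :=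
  if Even l then
    (if l = 2 then f l 0 * f l 1 * f l 2 + h l * f l 1 else ∑ C ∈ S l 3, fSet l C)
      + ∑ C ∈ S l 1, χ l Cᶜ * fSet l C
  else
    (if l = 3 then f l 0 * f l 1 * f l 2 * f l 3 + h l * f l 1 * f l 2 else ∑ C ∈ S l 4, fSet l C)
      + ∑ C ∈ S l 2, χ l Cᶜ * fSet l C
      + (∑ i ∈ Finset.Icc 1 l, (-1) ^ (i - 1) * varpi l (i : ZMod (l + 1))) ^ 2

/-- `k = α_0 + ⋯ + α_l`. -/
noncomputable def k : K l := ∑ i, α l i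

/-- `x₀ = f_0 + f_2 + ⋯ + f_{l-1}` (for odd `l`). -/
noncomputable def x₀ : K l := ∑ r ∈ Finset.range ((l + 1) / 2), f l ((2 * r : ℕ) : ZMod (l + 1))

/-- `D` is a `ℂ`-derivation of `𝒦_l` with the values on the generators prescribed by `H₀`. -/
structure IsHamiltonianDerivation (D : K l →ₗ[ℂ] K l) : Prop where
  leibniz : IsDerivation D
  map_f_even : Even l → ∀ i,
    D (f l i) = (h l)⁻¹ * (H₀ l * f l i - f l i * H₀ l) + if i = 0 then k l else 0
  map_f_odd : Odd l → ∀ i,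
    D (f l i) = (h l)⁻¹ * (H₀ l * f l i - f l i * H₀ l) - (-1) ^ i.val * (k l / 2) * f l i
      + if i = 0 then k l * x₀ l else 0
  map_α : ∀ i, D (α l i) = (h l)⁻¹ * (H₀ l * α l i - α l i * H₀ l)
  map_h : D (h l) = (h l)⁻¹ * (H₀ l * h l - h l * H₀ l)

/-- `s` is the `ℂ`-algebra automorphism `s_i` of `𝒦_l`. -/
structure IsS (i : ZMod (l + 1)) (s : K l ≃ₐ[ℂ] K l) : Prop where
  map_f : ∀ j, s (f l j) = f l j + α l i / f l i * (u l i j : K l)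
  map_α : ∀ j, s (α l j) = α l j - α l i * (cartan l i j : K l)
  map_h : s (h l) = h l

/-- `p` is the `ℂ`-algebra automorphism `π` of `𝒦_l`. -/
structure IsPi (p : K l ≃ₐ[ℂ] K l) : Prop where
  map_f : ∀ j, p (f l j) = f l (j + 1)
  map_α : ∀ j, p (α l j) = α l (j + 1)
  map_h : p (h l) = h l

end K

end QP

/-! ### Skew fields of fractions and their universal property -/

namespace QP

/-! Existence and uniqueness. Every element of the skew field is a left fraction over an algebra
given by generators and relations, so automorphisms and derivations are determined by their values
on the generators. Conversely, a homomorphism on the algebra extends as soon as it makes nonzero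
elements invertible. For a derivation the target is the ring of dual numbers, where invertibility is
visible on the first component. For `s_i` the target is the skew field itself, and injectivity on
the algebra has to be known beforehand: on generators `s_i` is an involution up to denominators that
are powers of `f_i`, these powers satisfy an Ore condition, and a homomorphism with both properties
has no kernel (`injective_of_involutive`).

Cyclic form of the derivation for `l ≥ 2`. By peeling factors off `f_C`, `[f_C, f_j] = h
(f_{C∖{j-1}} - f_{C∖{j+1}})`, where a term is zero if the removed element is not in `C`
(`fSet_commutator`). In the sum over `S_d` the terms with `j ∉ C` cancel, since moving `j-1` to
`j+1` changes two neighbouring gaps by two and so preserves even gaps. What remains is `h (f_j P_j -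
P_{j+1} f_j)`, with `P_j` the sum of the `f_{j+1+2r}` (`l = 2n`, `r < n`) or of the `f_{j+1+2r}
f_{j+2+2s}` (`l = 2n+1`, `r ≤ s < n`). For `l = 2` and `l = 3` the leading set is the whole circle,
which has no components; the corrected products in `H₀` have the same commutators, by direct
computation. The weights enter through their second difference `2ϖ_j - ϖ_{j+1} - ϖ_{j-1} = α_j -
δ_{j,0} k`, and the terms with `k` in the definition of `∂` remove exactly this defect at `0`. The
result is `∂ f_j = f_j P_j - P_{j+1} f_j + α_j x_j - A_j f_j`, with `x_j = 1`, `A_j = 0` for even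
`l`, and for odd `l` with the central elements `x_j = f_j + f_{j+2} + ⋯`, `A_j = (α_j + α_{j+2} + ⋯)
- k/2`.

Commutation. In this form the rotation `π` only shifts indices (`comm_rotation`). The reflection
`s_i` fixes every `x_j`, changes `A_j` by `-2 E_j` and `P_j` by `-E_j` with `E_j` central of
alternating sign, and moves `P_i` and `P_{i+1}` in addition by `± x_i α_i / f_i`. Together with `P_j
- P_{j+2} = x_j f_{j+1} - x_{j+1} f_j` this reduces the claim to four identities, according to the
position of `j` relative to `i` (`comm_reflection`). The automorphisms commuting with `∂` form a
group, so generators suffice.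

For `l = 1` the same programme is carried out by hand. There `s₀` fixes `f₁ + f₂²`, the quotient
`α₀/f₀` satisfies a Riccati equation under `∂`, and `s₁` is the conjugate of `s₀` by `π`. -/

/-- `F` is the skew field of left fractions of the `ℂ`-algebra `A`, with canonical map `ι`. -/
structure IsSkewFractionField {A F : Type} [Ring A] [Algebra ℂ A] [DivisionRing F] [Algebra ℂ F]
    (ι : A →ₐ[ℂ] F) : Prop where
  injective : Function.Injective ι
  exists_frac : ∀ x, ∃ s r : A, s ≠ 0 ∧ ι s * x = ι r
  -- The target is an arbitrary ring rather than a skew field: derivations are obtained from the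
  -- dual numbers over `F`.
  lift : ∀ {T : Type} [Ring T] [Algebra ℂ T] (φ : A →ₐ[ℂ] T), (∀ a ≠ 0, IsUnit (φ a)) →
    ∃ Φ : F →ₐ[ℂ] T, ∀ a, Φ (ι a) = φ a

section Ore

open nonZeroDivisors

variable {A : Type} [Ring A] [Algebra ℂ A] [Nontrivial A] [NoZeroDivisors A]
  [OreLocalization.OreSet A⁰]

/-- The canonical map to the Ore localization as a map of algebras. -/
noncomputable def oreNumerator : A →ₐ[ℂ] OreLocalization A⁰ A where
  toRingHom := OreLocalization.numeratorRingHom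
  commutes' _ := rfl

omit [Nontrivial A] [NoZeroDivisors A] in
theorem oreNumerator_eq (a : A) :
    oreNumerator a = OreLocalization.oreDiv a (1 : A⁰) := rfl

theorem isSkewFractionField_oreNumerator :
    IsSkewFractionField (oreNumerator : A →ₐ[ℂ] OreLocalization A⁰ A) where
  injective := OreLocalization.numeratorHom_inj (le_of_eq (by
    ext x; simp [mem_nonZeroDivisorsLeft_iff, mem_nonZeroDivisors_iff_ne_zero]
    constructor
    · intro h y hy; exact hy.resolve_left h
    · rintro h rfl; exact one_ne_zero (h 1 (Or.inl rfl))))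
  exists_frac x := by
    induction x using OreLocalization.ind with
    | _ r s =>
      refine ⟨s, r, nonZeroDivisors.ne_zero s.2, ?_⟩
      rw [oreNumerator_eq, oreNumerator_eq, OreLocalization.mul_cancel]
  lift {T} _ _ φ hφ := by
    classical
    have hu : ∀ s : A⁰, IsUnit (φ s) := fun s => hφ s (nonZeroDivisors.ne_zero s.2)
    let fS : A⁰ →* Tˣ := IsUnit.liftRight ((φ : A →* T).comp A⁰.subtype) hu
    have hf : ∀ s : A⁰, (φ : A →+* T) s = fS s := fun s => rfl
    let U := OreLocalization.universalHom (φ : A →+* T) fS hf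
    have hU : ∀ a, U (oreNumerator a) = φ a := fun a =>
      OreLocalization.universalHom_commutes (φ : A →+* T) fS hf
    refine ⟨{ U with commutes' := fun c => ?_ }, hU⟩
    have := hU (algebraMap ℂ A c)
    rw [AlgHom.commutes, AlgHom.commutes] at this
    exact this

end Ore

/-- The canonical map to `𝒦_l` as a map of algebras. -/
noncomputable def K.ι (l : ℕ) : Alg l →ₐ[ℂ] K l :=
  (oreNumerator : Alg l →ₐ[ℂ] OreLocalization (nonZeroDivisors (Alg l)) (Alg l))

theorem K.isSkewFractionField (l : ℕ) : IsSkewFractionField (K.ι l) :=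
  isSkewFractionField_oreNumerator

/-- The canonical map to `𝒦₁` as a map of algebras. -/
noncomputable def KOne.ι : AlgOne →ₐ[ℂ] KOne :=
  (oreNumerator : AlgOne →ₐ[ℂ] OreLocalization (nonZeroDivisors AlgOne) AlgOne)

theorem KOne.isSkewFractionField : IsSkewFractionField KOne.ι :=
  isSkewFractionField_oreNumerator

/-- Induction over the elements of an algebra generated by the range of `g`. -/
theorem generated_induction {A G : Type} [Ring A] [Algebra ℂ A] {g : G → A}
    (hg : Algebra.adjoin ℂ (Set.range g) = ⊤) {p : A → Prop} (gen : ∀ x, p (g x))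
    (alg : ∀ c, p (algebraMap ℂ A c)) (add : ∀ x y, p x → p y → p (x + y))
    (mul : ∀ x y, p x → p y → p (x * y)) (a : A) : p a := by
  have ha : a ∈ Algebra.adjoin ℂ (Set.range g) := hg ▸ Algebra.mem_top
  induction ha using Algebra.adjoin_induction with
  | mem x hx => obtain ⟨y, rfl⟩ := hx; exact gen y
  | algebraMap r => exact alg r
  | add x y _ _ hx hy => exact add x y hx hy
  | mul x y _ _ hx hy => exact mul x y hx hy

/-! ### Denominators that are powers of one element -/

/-- The Ore condition for the element `b` and the powers of `f`. -/
def PowOre {A : Type} [Ring A] (f b : A) : Prop := ∀ N : ℕ, ∃ M : ℕ, ∃ c : A, b * f ^ M = f ^ N * c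

namespace PowOre

variable {A : Type} [Ring A] {f a b : A}

theorem of_commute (h : Commute b f) : PowOre f b := fun N => ⟨N, b, (h.pow_right N).eq⟩

theorem algebraMap [Algebra ℂ A] (f : A) (c : ℂ) : PowOre f (algebraMap ℂ A c) :=
  of_commute (Algebra.commutes c f)

theorem mul (ha : PowOre f a) (hb : PowOre f b) : PowOre f (a * b) := fun N => by
  obtain ⟨M, c, hc⟩ := ha N
  obtain ⟨L, d, hd⟩ := hb M
  exact ⟨L, c * d, by rw [mul_assoc, hd, ← mul_assoc, hc, mul_assoc]⟩

theorem add (ha : PowOre f a) (hb : PowOre f b) : PowOre f (a + b) := fun N => by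
  obtain ⟨M, c, hc⟩ := ha N
  obtain ⟨L, d, hd⟩ := hb N
  refine ⟨M + L, c * f ^ L + d * f ^ M, ?_⟩
  rw [add_mul, pow_add, ← mul_assoc, hc, ← pow_add, add_comm M L, pow_add, ← mul_assoc, hd,
    mul_add, mul_assoc, mul_assoc]

theorem neg (ha : PowOre f a) : PowOre f (-a) := fun N => by
  obtain ⟨M, c, hc⟩ := ha N
  exact ⟨M, -c, by rw [neg_mul, hc, mul_neg]⟩

/-- With `d = b f - f b` commuting with `f`, induction gives `b f^m = f^m b + m f^(m-1) d`. The
witnesses are this formula for `m = N + 1`, with `f^N` pulled out on the left. -/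
theorem of_commutator (h : Commute (b * f - f * b) f) : PowOre f b := fun N => by
  refine ⟨N + 1, f * b + (N + 1) • (b * f - f * b), ?_⟩
  induction N with
  | zero => simp
  | succ N ih =>
    rw [pow_succ, ← mul_assoc, ih, pow_succ, mul_assoc, mul_assoc]
    congr 1
    rw [add_mul, smul_mul_assoc, h.eq, mul_assoc, mul_add, mul_smul_comm, succ_nsmul _ (N + 1),
      mul_sub]
    abel

end PowOre

/-! ### Extension of homomorphisms and derivations to the skew field -/

namespace IsDerivation

variable {F : Type} [DivisionRing F] [Algebra ℂ F] {D : F →ₗ[ℂ] F} (hD : IsDerivation D)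
include hD

theorem map_one : D 1 = 0 := by
  have := hD 1 1
  simpa using this

theorem map_algebraMap (c : ℂ) : D (algebraMap ℂ F c) = 0 := by
  rw [Algebra.algebraMap_eq_smul_one, map_smul, hD.map_one, smul_zero]

theorem map_intCast (n : ℤ) : D (n : F) = 0 := by
  have := hD.map_algebraMap n
  simpa using this

theorem map_inv (x : F) : D x⁻¹ = -(x⁻¹ * D x * x⁻¹) := by
  by_cases hx : x = 0
  · simp [hx]
  have h := hD x x⁻¹
  rw [mul_inv_cancel₀ hx, hD.map_one] at h
  have h2 : x * D x⁻¹ = -(D x * x⁻¹) := by rw [eq_neg_iff_add_eq_zero, add_comm, ← h]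
  calc D x⁻¹ = x⁻¹ * (x * D x⁻¹) := by rw [← mul_assoc, inv_mul_cancel₀ hx, one_mul]
    _ = _ := by rw [h2, mul_neg, mul_assoc]

end IsDerivation

namespace IsSkewFractionField

variable {A F : Type} [Ring A] [Algebra ℂ A] [DivisionRing F] [Algebra ℂ F] {ι : A →ₐ[ℂ] F}
  (hF : IsSkewFractionField ι) {G : Type} {g : G → A} (hg : Algebra.adjoin ℂ (Set.range g) = ⊤)
include hF

theorem ι_ne_zero {a : A} (ha : a ≠ 0) : ι a ≠ 0 := fun h =>
  ha (hF.injective (by rw [h, map_zero]))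

include hg

theorem induction {p : F → Prop} (gen : ∀ x, p (ι (g x)))
    (alg : ∀ c, p (algebraMap ℂ F c)) (add : ∀ x y, p x → p y → p (x + y))
    (mul : ∀ x y, p x → p y → p (x * y)) (inv : ∀ x, p x → p x⁻¹) (x : F) : p x := by
  have h : ∀ a, p (ι a) := generated_induction hg gen (fun c => by rw [AlgHom.commutes]; exact alg c)
    (fun a b ha hb => by rw [map_add]; exact add _ _ ha hb)
    (fun a b ha hb => by rw [map_mul]; exact mul _ _ ha hb)
  obtain ⟨s, r, hs, hx⟩ := hF.exists_frac x
  rw [show x = (ι s)⁻¹ * ι r by rw [← hx, inv_mul_cancel_left₀ (hF.ι_ne_zero hs)]]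
  exact mul _ _ (inv _ (h s)) (h r)

theorem algHom_ext {φ ψ : F →ₐ[ℂ] F} (h : ∀ x, φ (ι (g x)) = ψ (ι (g x))) : φ = ψ :=
  AlgHom.ext <| hF.induction hg h (fun c => by rw [AlgHom.commutes, AlgHom.commutes])
    (fun x y hx hy => by rw [map_add, map_add, hx, hy])
    (fun x y hx hy => by rw [map_mul, map_mul, hx, hy])
    (fun x hx => by rw [map_inv₀, map_inv₀, hx])

theorem algEquiv_ext {φ ψ : F ≃ₐ[ℂ] F} (h : ∀ x, φ (ι (g x)) = ψ (ι (g x))) : φ = ψ :=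
  AlgEquiv.coe_toAlgHom_injective (hF.algHom_ext hg h)

theorem derivation_ext {D E : F →ₗ[ℂ] F} (hD : IsDerivation D) (hE : IsDerivation E)
    (h : ∀ x, D (ι (g x)) = E (ι (g x))) : D = E :=
  LinearMap.ext <| hF.induction hg h (fun c => by rw [hD.map_algebraMap, hE.map_algebraMap])
    (fun x y hx hy => by rw [map_add, map_add, hx, hy])
    (fun x y hx hy => by rw [hD, hE, hx, hy])
    (fun x hx => by rw [hD.map_inv, hE.map_inv, hx])

theorem derivation_comm {D : F →ₗ[ℂ] F} (hD : IsDerivation D) {φ : F ≃ₐ[ℂ] F}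
    (h : ∀ x, D (φ (ι (g x))) = φ (D (ι (g x)))) (x : F) : D (φ x) = φ (D x) := by
  refine hF.induction hg (p := fun x => D (φ x) = φ (D x)) h (fun c => ?_) (fun x y hx hy => ?_) (fun x y hx hy => ?_)
    (fun x hx => ?_) x
  · rw [AlgEquiv.commutes, hD.map_algebraMap, map_zero]
  · rw [map_add, map_add, hx, hy, map_add, map_add]
  · rw [map_mul, hD, hx, hy, hD, map_add, map_mul, map_mul]
  · rw [map_inv₀, hD.map_inv, hx, hD.map_inv, map_neg, map_mul, map_mul, map_inv₀]

theorem central {z : F} (h : ∀ x, Commute z (ι (g x))) (x : F) : Commute z x :=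
  hF.induction hg h (fun c => (Algebra.commutes c z).symm) (fun _ _ => Commute.add_right)
    (fun _ _ => Commute.mul_right) (fun _ => Commute.inv_right₀) x

/-- In a skew field, injectivity of `φ` means that nonzero elements go to units, which is what the
extension requires. The inverse relations are assumed for every extension because `φ` of a generator
is in general a fraction, on which `ψ` itself is not defined. -/
theorem exists_algEquiv {φ ψ : A →ₐ[ℂ] F} (hφ : Function.Injective φ) (hψ : Function.Injective ψ)
    (h₁ : ∀ Ψ : F →ₐ[ℂ] F, (∀ a, Ψ (ι a) = ψ a) → ∀ x, Ψ (φ (g x)) = ι (g x))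
    (h₂ : ∀ Φ : F →ₐ[ℂ] F, (∀ a, Φ (ι a) = φ a) → ∀ x, Φ (ψ (g x)) = ι (g x)) :
    ∃ Φ : F ≃ₐ[ℂ] F, ∀ a, Φ (ι a) = φ a := by
  have hu : ∀ {χ : A →ₐ[ℂ] F}, Function.Injective χ → ∀ a ≠ 0, IsUnit (χ a) := fun hχ a ha =>
    isUnit_iff_ne_zero.2 fun h => ha (hχ (by rw [h, map_zero]))
  obtain ⟨Φ, hΦ⟩ := hF.lift φ (hu hφ)
  obtain ⟨Ψ, hΨ⟩ := hF.lift ψ (hu hψ)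
  refine ⟨AlgEquiv.ofAlgHom Φ Ψ ?_ ?_, hΦ⟩
  · exact hF.algHom_ext hg fun x => by
      rw [AlgHom.comp_apply, hΨ, h₂ Φ hΦ]; rfl
  · exact hF.algHom_ext hg fun x => by
      rw [AlgHom.comp_apply, hΦ, h₁ Ψ hΨ]; rfl

/-- A homomorphism `φ` which fixes `f` and which is an involution, up to denominators which are
powers of `f`, is injective. -/
theorem injective_of_involutive {f : A} (hf : f ≠ 0) {φ : A →ₐ[ℂ] F} (hφf : φ f = ι f)
    (ore : ∀ x, PowOre f (g x))
    (hgen : ∀ x, ∃ N b, φ (g x) * ι f ^ N = ι b ∧ φ b = ι (g x) * ι f ^ N) :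
    Function.Injective φ := by
  have hf' := hF.ι_ne_zero hf
  have hore : ∀ a, PowOre f a := generated_induction hg ore (PowOre.algebraMap f)
    (fun _ _ => PowOre.add) (fun _ _ => PowOre.mul)
  -- `b` is the numerator of `φ a` for the denominator `f^N`, and applying `φ` to it gives back `a
  -- f^N`. Hence `φ a = 0` forces `b = 0` and then `a = 0`.
  have key : ∀ a, ∃ N b, φ a * ι f ^ N = ι b ∧ φ b = ι a * ι f ^ N := by
    refine generated_induction hg hgen (fun c => ⟨0, algebraMap ℂ A c, by simp, by simp⟩) ?_ ?_
    · rintro x y ⟨M, b, h1, h2⟩ ⟨N, c, h3, h4⟩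
      refine ⟨M + N, b * f ^ N + c * f ^ M, ?_, ?_⟩
      · rw [map_add, map_add, map_mul, map_mul, ← h1, ← h3, add_mul, map_pow, map_pow, mul_assoc,
          mul_assoc, ← pow_add, ← pow_add, add_comm N M]
      · rw [map_add, map_add, map_mul, map_mul, h2, h4, add_mul, map_pow, map_pow, hφf, mul_assoc,
          mul_assoc, ← pow_add, ← pow_add, add_comm N M]
    · rintro x y ⟨M, b, h1, h2⟩ ⟨N, c, h3, h4⟩
      -- In `φ x * φ y * f^N = φ x * c` the denominator `f^M` of `φ x` is on the wrong side of `c`;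
      -- the relation `c f^L = f^M d` makes it cancel.
      obtain ⟨L, d, hd⟩ := hore c M
      have hd1 := congrArg ι hd
      have hd2 := congrArg φ hd
      simp only [map_mul, map_pow, hφf] at hd1 hd2
      refine ⟨N + L, b * d, ?_, ?_⟩
      · rw [map_mul, map_mul, ← h1, mul_assoc, mul_assoc, ← hd1, ← h3, pow_add]
        simp only [mul_assoc]
      · rw [map_mul, map_mul, h2, mul_assoc, ← hd2, h4, pow_add]
        simp only [mul_assoc]
  rw [injective_iff_map_eq_zero]
  intro a ha
  obtain ⟨N, b, h1, h2⟩ := key a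
  rw [ha, zero_mul] at h1
  have hb : b = 0 := hF.injective (by rw [← h1, map_zero])
  rw [hb, map_zero] at h2
  have h3 : ι a = 0 := (mul_eq_zero.1 h2.symm).resolve_right (pow_ne_zero N hf')
  exact hF.injective (by rw [h3, map_zero])

omit hg

/-- A derivation of `A` with values in `F`, given by a homomorphism to the dual numbers, extends
to `F`. -/
theorem exists_derivation (ψ : A →ₐ[ℂ] TrivSqZeroExt F F) (hψ : ∀ a, (ψ a).fst = ι a) :
    ∃ D : F →ₗ[ℂ] F, IsDerivation D ∧ ∀ a, D (ι a) = (ψ a).snd := by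
  -- A dual number is a unit exactly if its first component is one, so no condition on the
  -- derivation part is needed.
  obtain ⟨Ψ, hΨ⟩ := hF.lift ψ fun a ha => by
    rw [TrivSqZeroExt.isUnit_iff_isUnit_fst, hψ]
    exact isUnit_iff_ne_zero.2 (hF.ι_ne_zero ha)
  have hfst : ∀ x, (Ψ x).fst = x := by
    intro x
    obtain ⟨s, r, hs, hx⟩ := hF.exists_frac x
    have h := congrArg (fun y => (Ψ y).fst) hx
    simp only [map_mul, TrivSqZeroExt.fst_mul, hΨ, hψ] at h
    rw [← hx] at h
    exact mul_left_cancel₀ (hF.ι_ne_zero hs) h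
  refine ⟨(TrivSqZeroExt.sndHom F F).restrictScalars ℂ ∘ₗ Ψ.toLinearMap, fun x y => ?_, fun a => ?_⟩
  · simp [hfst, add_comm]
  · simp [hΨ]

end IsSkewFractionField

/-! ### The algebra for `l ≥ 2` and the relations in its skew field -/

theorem op_one {ι κ : Type} (c : ι → ι → ℤ) (x : Gen ι κ) : op c x 1 = MvPolynomial.X x := by
  rw [op_apply, Derivation.map_one_eq_zero, mul_one, add_zero]

/-- The operator by which a generator acts on polynomials sends `1` to the corresponding variable.
-/
theorem Alg.gen_ne_zero (l : ℕ) (x) : Alg.gen l x ≠ 0 := by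
  obtain ⟨ρ, hρ⟩ := Alg.exists_rep l
  intro h
  have h1 := congrArg (fun a => ρ a 1) h
  simp only [hρ, op_one, map_zero, LinearMap.zero_apply] at h1
  exact MvPolynomial.X_ne_zero x h1

theorem Alg.exists_lift (l : ℕ) {T : Type} [Ring T] [Algebra ℂ T] (F a : ZMod (l + 1) → T) (η : T)
    (hff : ∀ i j, F i * F j - F j * F i = (u l i j : T) * η) (hfα : ∀ i j, Commute (F i) (a j))
    (hαα : ∀ i j, Commute (a i) (a j)) (hhf : ∀ i, Commute η (F i))
    (hhα : ∀ i, Commute η (a i)) :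
    ∃ φ : Alg l →ₐ[ℂ] T, (∀ i, φ (Alg.gen l (.f i)) = F i) ∧ (∀ i, φ (Alg.gen l (.α i)) = a i) ∧
      φ (Alg.gen l .h) = η := by
  let v : Gen (ZMod (l + 1)) (ZMod (l + 1)) → T := fun x => match x with
    | .f i => F i
    | .α i => a i
    | .h => η
  have hv : ∀ x y, Rel l x y → FreeAlgebra.lift ℂ v x = FreeAlgebra.lift ℂ v y := by
    intro x y hxy
    cases hxy with
    | ff i j =>
      simp only [map_sub, map_mul, map_smul, FreeAlgebra.lift_ι_apply]
      rw [Int.cast_smul_eq_zsmul ℂ, zsmul_eq_mul]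
      exact hff i j
    | fα i j =>
      simp only [map_sub, map_mul, map_zero, FreeAlgebra.lift_ι_apply]
      exact sub_eq_zero.2 (hfα i j)
    | αα i j =>
      simp only [map_sub, map_mul, map_zero, FreeAlgebra.lift_ι_apply]
      exact sub_eq_zero.2 (hαα i j)
    | hf j =>
      simp only [map_sub, map_mul, map_zero, FreeAlgebra.lift_ι_apply]
      exact sub_eq_zero.2 (hhf j)
    | hα j =>
      simp only [map_sub, map_mul, map_zero, FreeAlgebra.lift_ι_apply]
      exact sub_eq_zero.2 (hhα j)
  have key : ∀ x, RingQuot.liftAlgHom ℂ ⟨FreeAlgebra.lift ℂ v, hv⟩ (Alg.gen l x) = v x := fun x => by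
    rw [Alg.gen, RingQuot.liftAlgHom_mkAlgHom_apply, FreeAlgebra.lift_ι_apply]
  exact ⟨_, fun i => key _, fun i => key _, key _⟩

theorem Alg.ff_intCast (l : ℕ) (i j : ZMod (l + 1)) :
    Alg.gen l (.f i) * Alg.gen l (.f j) - Alg.gen l (.f j) * Alg.gen l (.f i)
      = (u l i j : Alg l) * Alg.gen l .h :=
  (Alg.ff l i j).trans ((Algebra.smul_def ((u l i j : ℤ) : ℂ) _).trans (by rw [map_intCast]))

namespace K

variable (l : ℕ)

theorem ι_f (i) : ι l (Alg.gen l (.f i)) = f l i := rfl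
theorem ι_α (i) : ι l (Alg.gen l (.α i)) = α l i := rfl
theorem ι_h : ι l (Alg.gen l .h) = h l := rfl

theorem f_ne_zero (i) : f l i ≠ 0 := (isSkewFractionField l).ι_ne_zero (Alg.gen_ne_zero l _)

theorem h_ne_zero : h l ≠ 0 := (isSkewFractionField l).ι_ne_zero (Alg.gen_ne_zero l _)

theorem ff (i j : ZMod (l + 1)) : f l i * f l j - f l j * f l i = (u l i j : K l) * h l := by
  have := congrArg (ι l) (Alg.ff_intCast l i j)
  rw [map_sub, map_mul, map_mul, map_mul, map_intCast] at this
  exact this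

theorem α_comm (i : ZMod (l + 1)) (x : K l) : Commute (α l i) x := by
  refine (isSkewFractionField l).central (Alg.adjoin_gen l) (fun y => ?_) x
  rcases y with j | j | _
  · exact (Alg.fα l j i).symm.map (ι l)
  · exact (Alg.αα l i j).map (ι l)
  · exact (Alg.hα l i).symm.map (ι l)

theorem h_comm (x : K l) : Commute (h l) x := by
  refine (isSkewFractionField l).central (Alg.adjoin_gen l) (fun y => ?_) x
  rcases y with j | j | _
  · exact (Alg.hf l j).map (ι l)
  · exact (Alg.hα l j).map (ι l)
  · exact Commute.refl _

theorem k_comm (x : K l) : Commute (k l) x := Commute.sum_left _ _ _ fun i _ => α_comm l i x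

instance : CharZero (K l) :=
  charZero_of_injective_algebraMap (algebraMap ℂ (K l)).injective

/-- A property of the generators `f`, `α`, `h` holds for all generators. -/
theorem forall_gen {p : K l → Prop} (hf : ∀ i, p (f l i)) (hα : ∀ i, p (α l i)) (hh : p (h l)) (x) :
    p (ι l (Alg.gen l x)) := by
  rcases x with i | i | _
  exacts [hf i, hα i, hh]

theorem algEquiv_ext {s t : K l ≃ₐ[ℂ] K l} (hf : ∀ i, s (f l i) = t (f l i))
    (hα : ∀ i, s (α l i) = t (α l i)) (hh : s (h l) = t (h l)) : s = t :=
  (isSkewFractionField l).algEquiv_ext (Alg.adjoin_gen l)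
    (forall_gen l (p := fun x => s x = t x) hf hα hh)

theorem derivation_ext {D E : K l →ₗ[ℂ] K l} (hD : IsDerivation D) (hE : IsDerivation E)
    (hf : ∀ i, D (f l i) = E (f l i)) (hα : ∀ i, D (α l i) = E (α l i)) (hh : D (h l) = E (h l)) :
    D = E :=
  (isSkewFractionField l).derivation_ext (Alg.adjoin_gen l) hD hE
    (forall_gen l (p := fun x => D x = E x) hf hα hh)

theorem derivation_comm {D : K l →ₗ[ℂ] K l} (hD : IsDerivation D) {s : K l ≃ₐ[ℂ] K l}
    (hf : ∀ i, D (s (f l i)) = s (D (f l i))) (hα : ∀ i, D (s (α l i)) = s (D (α l i)))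
    (hh : D (s (h l)) = s (D (h l))) (x : K l) : D (s x) = s (D x) :=
  (isSkewFractionField l).derivation_comm (Alg.adjoin_gen l) hD
    (forall_gen l (p := fun x => D (s x) = s (D x)) hf hα hh) x

/-! ### The automorphism `π` -/

theorem u_add (i j c : ZMod (l + 1)) : u l (i + c) (j + c) = u l i j := by
  have h1 : j + c = i + c + 1 ↔ j = i + 1 := by rw [add_right_comm, add_left_inj]
  have h2 : j + c = i + c - 1 ↔ j = i - 1 := by rw [add_sub_right_comm, add_left_inj]
  simp only [u, h1, h2]

theorem exists_shift (c : ZMod (l + 1)) : ∃ φ : Alg l →ₐ[ℂ] Alg l,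
    (∀ i, φ (Alg.gen l (.f i)) = Alg.gen l (.f (i + c))) ∧
    (∀ i, φ (Alg.gen l (.α i)) = Alg.gen l (.α (i + c))) ∧
    φ (Alg.gen l .h) = Alg.gen l .h := by
  refine Alg.exists_lift l _ _ _ (fun i j => ?_) (fun i j => Alg.fα l _ _) (fun i j => Alg.αα l _ _)
    (fun i => Alg.hf l _) (fun i => Alg.hα l _)
  rw [Alg.ff_intCast, u_add]

theorem exists_isPi : ∃ p, IsPi l p := by
  obtain ⟨φ, hφf, hφα, hφh⟩ := exists_shift l 1
  obtain ⟨ψ, hψf, hψα, hψh⟩ := exists_shift l (-1)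
  have hψφ : ∀ a, ψ (φ a) = a := generated_induction (Alg.adjoin_gen l)
    (by rintro (i | i | _) <;> simp [hφf, hψf, hφα, hψα, hφh, hψh]) (by simp)
    (fun x y hx hy => by rw [map_add, map_add, hx, hy])
    (fun x y hx hy => by rw [map_mul, map_mul, hx, hy])
  have hφψ : ∀ a, φ (ψ a) = a := generated_induction (Alg.adjoin_gen l)
    (by rintro (i | i | _) <;> simp [hφf, hψf, hφα, hψα, hφh, hψh]) (by simp)
    (fun x y hx hy => by rw [map_add, map_add, hx, hy])
    (fun x y hx hy => by rw [map_mul, map_mul, hx, hy])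
  have hF := isSkewFractionField l
  obtain ⟨p, hp⟩ := hF.exists_algEquiv (Alg.adjoin_gen l) (φ := (ι l).comp φ) (ψ := (ι l).comp ψ)
    (hF.injective.comp (Function.LeftInverse.injective hψφ))
    (hF.injective.comp (Function.LeftInverse.injective hφψ))
    (fun Ψ hΨ x => by rw [AlgHom.comp_apply, hΨ, AlgHom.comp_apply, hψφ])
    (fun Φ hΦ x => by rw [AlgHom.comp_apply, hΦ, AlgHom.comp_apply, hφψ])
  refine ⟨p, ⟨fun i => ?_, fun i => ?_, ?_⟩⟩
  · rw [← ι_f, hp, AlgHom.comp_apply, hφf, ι_f]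
  · rw [← ι_α, hp, AlgHom.comp_apply, hφα, ι_α]
  · rw [← ι_h, hp, AlgHom.comp_apply, hφh]

theorem existsUnique_isPi : ∃! p, IsPi l p := by
  obtain ⟨p, hp⟩ := exists_isPi l
  exact ⟨p, hp, fun q hq => algEquiv_ext l (fun i => by rw [hp.map_f, hq.map_f])
    (fun i => by rw [hp.map_α, hq.map_α]) (by rw [hp.map_h, hq.map_h])⟩

/-! ### The automorphisms `s_i` -/

theorem u_self (i : ZMod (l + 1)) : u l i i = 0 := by
  have := u_antisymm l i i
  omega

theorem cartan_self (i : ZMod (l + 1)) : cartan l i i = 2 := by simp [cartan]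

/-- The commutator of `f_j` with `α_i / f_i`. -/
theorem f_comm_div (i j : ZMod (l + 1)) :
    f l j * (α l i / f l i) - α l i / f l i * f l j =
      (u l i j : K l) * (h l * α l i * (f l i)⁻¹ * (f l i)⁻¹) := by
  have hf := f_ne_zero l i
  have h1 : f l j * (f l i)⁻¹ - (f l i)⁻¹ * f l j =
      (f l i)⁻¹ * ((u l i j : K l) * h l) * (f l i)⁻¹ := by
    rw [← ff, mul_sub, sub_mul, ← mul_assoc, inv_mul_cancel₀ hf, one_mul, mul_assoc, mul_assoc,
      mul_inv_cancel₀ hf, mul_one]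
  rw [div_eq_mul_inv, ← mul_assoc, ← (α_comm l i (f l j)).eq, mul_assoc, mul_assoc, ← mul_sub, h1,
    (Int.cast_commute (u l i j) (h l)).eq, ← mul_assoc, ← mul_assoc, ← mul_assoc,
    ← (h_comm l (α l i * (f l i)⁻¹)).eq, (Int.cast_commute (u l i j) _).eq]
  simp only [mul_assoc]
  rw [(Int.cast_commute (u l i j) _).eq]

theorem exists_isS (i : ZMod (l + 1)) : ∃ s, IsS l i s := by
  -- Write `g = α_i / f_i` and `[f_j, g] = u_{ij} c`. The cross terms are `u_{ib} [f_a, g] + u_{ia}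
  -- [g, f_b] = (u_{ib} u_{ia} - u_{ia} u_{ib}) c = 0`.
  have hrel : ∀ a b, (f l a + α l i / f l i * (u l i a : K l)) *
      (f l b + α l i / f l i * (u l i b : K l)) - (f l b + α l i / f l i * (u l i b : K l)) *
      (f l a + α l i / f l i * (u l i a : K l)) = (u l a b : K l) * h l := by
    intro a b
    have e1 := sub_eq_iff_eq_add.1 (f_comm_div l i a)
    have e2 := sub_eq_iff_eq_add.1 (f_comm_div l i b)
    rw [← ff l a b]
    simp only [← zsmul_eq_mul, ← zsmul_eq_mul'] at e1 e2 ⊢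
    simp only [add_mul, mul_add, smul_mul_assoc, mul_smul_comm, e1, e2, smul_add]
    module
  obtain ⟨φ, hf, hα, hh⟩ := Alg.exists_lift l
    (fun j => f l j + α l i / f l i * (u l i j : K l))
    (fun j => α l j - α l i * (cartan l i j : K l)) (h l) hrel
    (fun j m => ((α_comm l m _).sub_left ((α_comm l i _).mul_left (Int.cast_commute _ _))).symm)
    (fun j m => (α_comm l j _).sub_left ((α_comm l i _).mul_left (Int.cast_commute _ _)))
    (fun j => h_comm l _) (fun j => h_comm l _)
  have hφf : φ (Alg.gen l (.f i)) = f l i := by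
    rw [hf, u_self, Int.cast_zero, mul_zero, add_zero]
  have hφα : φ (Alg.gen l (.α i)) = -α l i := by
    rw [hα, cartan_self, Int.cast_ofNat, mul_two]
    abel
  have hF := isSkewFractionField l
  -- No inverse on the skew field is available yet, so injectivity comes from the involution
  -- property with denominators `f_i^N`; only the generators `f_j` need one, with `N = 1`.
  have hinj : Function.Injective φ := by
    refine hF.injective_of_involutive (Alg.adjoin_gen l) (Alg.gen_ne_zero l (.f i)) hφf ?_ ?_
    · rintro (j | j | _)
      · apply PowOre.of_commutator
        rw [Alg.ff_intCast]
        exact (Int.cast_commute _ _).mul_left (Alg.hf l i)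
      · exact PowOre.of_commute (Alg.fα l i j).symm
      · exact PowOre.of_commute (Alg.hf l i)
    · rintro (j | j | _)
      · have e : α l i / f l i * (u l i j : K l) * f l i = α l i * (u l i j : K l) := by
          rw [(Int.cast_commute (u l i j) (α l i / f l i)).symm.eq, mul_assoc,
            div_mul_cancel₀ _ (f_ne_zero l i), (Int.cast_commute (u l i j) (α l i)).eq]
        refine ⟨1, Alg.gen l (.f j) * Alg.gen l (.f i) + Alg.gen l (.α i) * (u l i j : Alg l), ?_, ?_⟩
        · rw [hf, pow_one, map_add, map_mul, map_mul, map_intCast, add_mul, ι_f, ι_f, ι_α, e]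
        · rw [pow_one, map_add, map_mul, map_mul, map_intCast, hφf, hφα, hf, add_mul, ι_f, ι_f, e,
            neg_mul, add_neg_cancel_right]
      · refine ⟨0, Alg.gen l (.α j) - Alg.gen l (.α i) * (cartan l i j : Alg l), ?_, ?_⟩
        · rw [hα, pow_zero, mul_one, map_sub, map_mul, map_intCast, ι_α, ι_α]
        · rw [pow_zero, mul_one, map_sub, map_mul, map_intCast, hφα, hα, neg_mul, sub_neg_eq_add,
            sub_add_cancel, ι_α]
      · exact ⟨0, Alg.gen l .h, by rw [hh]; simp [ι_h], by rw [hh]; simp [ι_h]⟩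
  have hinv : ∀ Φ : K l →ₐ[ℂ] K l, (∀ a, Φ (ι l a) = φ a) →
      ∀ x, Φ (φ (Alg.gen l x)) = ι l (Alg.gen l x) := by
    intro Φ hΦ x
    have h1 : Φ (α l i) = -α l i := by rw [← ι_α, hΦ, hφα, ι_α]
    have h2 : Φ (f l i) = f l i := by rw [← ι_f, hΦ, hφf, ι_f]
    rcases x with j | j | _
    · have h3 : Φ (f l j) = f l j + α l i / f l i * (u l i j : K l) := by rw [← ι_f, hΦ, hf, ι_f]
      rw [hf, map_add, map_mul, map_div₀, map_intCast, h1, h2, h3, neg_div, neg_mul,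
        add_neg_cancel_right, ι_f]
    · have h3 : Φ (α l j) = α l j - α l i * (cartan l i j : K l) := by rw [← ι_α, hΦ, hα, ι_α]
      rw [hα, map_sub, map_mul, map_intCast, h1, h3, neg_mul, sub_neg_eq_add, sub_add_cancel, ι_α]
    · rw [hh, ← ι_h, hΦ, hh, ι_h]
  obtain ⟨s, hs⟩ := hF.exists_algEquiv (Alg.adjoin_gen l) hinj hinj hinv hinv
  exact ⟨s, fun j => by rw [← ι_f, hs, hf, ι_f], fun j => by rw [← ι_α, hs, hα, ι_α], by
    rw [← ι_h, hs, hh, ι_h]⟩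

theorem existsUnique_isS (i : ZMod (l + 1)) : ∃! s, IsS l i s := by
  obtain ⟨p, hp⟩ := exists_isS l i
  exact ⟨p, hp, fun q hq => algEquiv_ext l (fun i => by rw [hp.map_f, hq.map_f])
    (fun i => by rw [hp.map_α, hq.map_α]) (by rw [hp.map_h, hq.map_h])⟩

/-! ### Derivations -/

/-- The hypothesis is the relation `[f_i, f_j] = u_{ij} h` differentiated with `h` constant. The
remaining relations impose nothing, because the `α_j` and `h` are central in the skew field and are
given derivative zero. -/
theorem exists_derivation (e : ZMod (l + 1) → K l)
    (he : ∀ i j, e i * f l j - f l j * e i + (f l i * e j - e j * f l i) = 0) :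
    ∃ E : K l →ₗ[ℂ] K l, IsDerivation E ∧ (∀ i, E (f l i) = e i) ∧ (∀ i, E (α l i) = 0) ∧
      E (h l) = 0 := by
  have hcomm : ∀ z x y : K l, Commute z x → Commute z y → Commute (TrivSqZeroExt.inl z)
      (TrivSqZeroExt.inl x + TrivSqZeroExt.inr y : TrivSqZeroExt (K l) (K l)) := by
    intro z x y hx hy
    ext
    · simp [hx.eq]
    · simp [hy.eq]
  have hrel : ∀ i j, (TrivSqZeroExt.inl (f l i) + TrivSqZeroExt.inr (e i)) *
      (TrivSqZeroExt.inl (f l j) + TrivSqZeroExt.inr (e j)) -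
      (TrivSqZeroExt.inl (f l j) + TrivSqZeroExt.inr (e j)) *
      (TrivSqZeroExt.inl (f l i) + TrivSqZeroExt.inr (e i)) =
      ((u l i j : ℤ) : TrivSqZeroExt (K l) (K l)) * TrivSqZeroExt.inl (h l) := by
    intro i j
    ext
    · simpa using ff l i j
    · have := he i j
      simp
      rw [← this]
      abel
  obtain ⟨ψ, hf, hα, hh⟩ := Alg.exists_lift l (T := TrivSqZeroExt (K l) (K l))
    (fun i => TrivSqZeroExt.inl (f l i) + TrivSqZeroExt.inr (e i))
    (fun i => TrivSqZeroExt.inl (α l i)) (TrivSqZeroExt.inl (h l)) hrel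
    (fun i j => (hcomm _ _ _ (α_comm l _ _) (α_comm l _ _)).symm)
    (fun i j => by simpa using hcomm _ _ 0 (α_comm l i (α l j)) (Commute.zero_right _))
    (fun i => hcomm _ _ _ (h_comm l _) (h_comm l _))
    (fun i => by simpa using hcomm _ _ 0 (h_comm l (α l i)) (Commute.zero_right _))
  obtain ⟨E, hE, hEψ⟩ := (isSkewFractionField l).exists_derivation ψ
    (generated_induction (Alg.adjoin_gen l)
      (by rintro (i | i | _)
          · rw [hf]; simp [ι_f]
          · rw [hα]; simp [ι_α]
          · rw [hh]; simp [ι_h])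
      (fun c => by rw [AlgHom.commutes, AlgHom.commutes]; rfl)
      (fun a b ha hb => by rw [map_add, map_add, TrivSqZeroExt.fst_add, ha, hb])
      (fun a b ha hb => by rw [map_mul, map_mul, TrivSqZeroExt.fst_mul, ha, hb]))
  exact ⟨E, hE, fun i => by rw [← ι_f, hEψ, hf]; simp, fun i => by rw [← ι_α, hEψ, hα]; simp,
    by rw [← ι_h, hEψ, hh]; simp⟩

end K

/-! ### Identities behind the commutation with a reflection -/

section Identities

variable {C R : Type} [CommRing C] [Ring R] [Algebra C R] {F F' : R} (h1 : F * F' = 1)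
  (h2 : F' * F = 1) (a b x y A e : C) (Y P₀ P₁ P₂ : R)

include h1 h2

/-- Here `F`, `F'` play the roles of `f_i` and its inverse, `a` of `α_i`, `e` of `E_i`, and `P₀`,
`P₁`, `P₂` of coefficients `P_m`. The two terms `x a F'` contribute `2 a x`, which turns the
reflected `-a x` back into `a x`. Central coefficients are kept as scalars of a commutative ring, so
that after cancelling `F F'` only linear algebra is left. -/
theorem reflection_ident_self :
    F * (P₀ - e • 1 + x • (a • F')) - (P₁ + e • 1 - x • (a • F')) * F + (-a) • (x • 1)
      - (A - 2 * e) • F = F * P₀ - P₁ * F + a • (x • 1) - A • F := by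
  simp only [mul_add, add_mul, mul_sub, sub_mul, mul_smul_comm, smul_mul_assoc, h1, h2, mul_one,
    one_mul]
  module

/-- This is the case of the neighbour `Y = f_{i+1}`. The last term on the right is the derivative of
`a F'`, namely `-a F' (D F) F'`. The relation `hP` is needed because `F' P₀` comes from that
derivative whereas `P₂ F'` comes from the reflected formula; the difference of `P₀` and `P₂` has to
be made explicit. -/
theorem reflection_ident_right (hP : P₀ - P₂ = x • Y - y • F) :
    (Y + a • F') * (P₁ + e • 1 - x • (a • F')) - (P₂ - e • 1) * (Y + a • F') + (b + a) • (y • 1)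
      - (-A + 2 * e) • (Y + a • F') =
    (Y * P₁ - P₂ * Y + b • (y • 1) - (-A) • Y)
      - a • (F' * (F * P₀ - P₁ * F + a • (x • 1) - A • F) * F') := by
  obtain rfl := eq_add_of_sub_eq' hP
  simp only [mul_add, add_mul, mul_sub, sub_mul, mul_smul_comm, smul_mul_assoc, mul_assoc, h1, h2,
    mul_one, one_mul, ← mul_assoc F' F]
  module

theorem reflection_ident_left (hP : P₂ - P₁ = y • F - x • Y) :
    (Y - a • F') * (P₂ + e • 1) - (P₀ - e • 1 + x • (a • F')) * (Y - a • F') + (b + a) • (y • 1)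
      - (-A + 2 * e) • (Y - a • F') =
    (Y * P₂ - P₀ * Y + b • (y • 1) - (-A) • Y)
      + a • (F' * (F * P₀ - P₁ * F + a • (x • 1) - A • F) * F') := by
  obtain rfl := eq_add_of_sub_eq' hP
  simp only [mul_add, add_mul, mul_sub, sub_mul, mul_smul_comm, smul_mul_assoc, mul_assoc, h1, h2,
    mul_one, one_mul, ← mul_assoc F' F]
  module

omit h1 h2

theorem reflection_ident_other :
    Y * (P₁ - e • 1) - (P₂ + e • 1) * Y + b • (y • 1) - (A - 2 * e) • Y
      = Y * P₁ - P₂ * Y + b • (y • 1) - A • Y := by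
  simp only [add_mul, mul_sub, mul_smul_comm, smul_mul_assoc, mul_one, one_mul]
  module

end Identities

/-! ### Neighbouring indices and commutation with `s_i` -/

namespace K

variable (l : ℕ)

theorem self_ne_add_one (hl : 2 ≤ l) (i : ZMod (l + 1)) : i ≠ i + 1 := by
  have : Fact (1 < l + 1) := ⟨by omega⟩
  simp

theorem add_one_ne_sub_one (hl : 2 ≤ l) (i : ZMod (l + 1)) : i + 1 ≠ i - 1 := by
  intro h
  have h2 : ((2 : ℕ) : ZMod (l + 1)) = 0 := by
    push_cast
    linear_combination h
  rw [ZMod.natCast_eq_zero_iff] at h2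
  exact absurd (Nat.le_of_dvd (by norm_num) h2) (by omega)

theorem u_add_one (hl : 2 ≤ l) (i : ZMod (l + 1)) : u l i (i + 1) = 1 := by
  rw [u, if_pos rfl, if_neg (add_one_ne_sub_one l hl i), sub_zero]

theorem u_sub_one (hl : 2 ≤ l) (i : ZMod (l + 1)) : u l i (i - 1) = -1 := by
  rw [u, if_pos rfl, if_neg (add_one_ne_sub_one l hl i).symm, zero_sub]

theorem u_eq_zero {i j : ZMod (l + 1)} (h1 : j ≠ i + 1) (h2 : j ≠ i - 1) : u l i j = 0 := by
  rw [u, if_neg h1, if_neg h2, sub_self]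

theorem cartan_add_one (hl : 2 ≤ l) (i : ZMod (l + 1)) : cartan l i (i + 1) = -1 := by
  rw [cartan, if_neg (self_ne_add_one l hl i).symm, if_pos (Or.inl rfl)]

theorem cartan_sub_one (hl : 2 ≤ l) (i : ZMod (l + 1)) : cartan l i (i - 1) = -1 := by
  have := self_ne_add_one l hl (i - 1)
  rw [sub_add_cancel] at this
  rw [cartan, if_neg this, if_pos (Or.inr rfl)]

theorem cartan_eq_zero {i j : ZMod (l + 1)} (h0 : j ≠ i) (h1 : j ≠ i + 1) (h2 : j ≠ i - 1) :
    cartan l i j = 0 := by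
  rw [cartan, if_neg h0, if_neg (by tauto)]

/-- The derivation `D` commutes with `s_i` if it has the form
`D f_j = f_j P_j - P_{j+1} f_j + α_j x_j - A_j f_j`, with a suitable action of `s_i` on the
coefficients. -/
theorem comm_reflection (hl : 2 ≤ l) {D : K l →ₗ[ℂ] K l} (hD : IsDerivation D) {i : ZMod (l + 1)}
    {s : K l ≃ₐ[ℂ] K l} (hs : IsS l i s) (P : ZMod (l + 1) → K l)
    (a x A E : ZMod (l + 1) → Subring.center (K l)) (ha : ∀ j, (a j : K l) = α l j)
    (hDf : ∀ j, D (f l j) = f l j * P j - P (j + 1) * f l j + a j • (x j • 1) - A j • f l j)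
    (hDα : ∀ j, D (α l j) = 0) (hDh : D (h l) = 0) (hA : ∀ j, A (j + 1) = -A j)
    (hE : ∀ j, E (j + 1) = -E j)
    (hP : ∀ j, P j - P (j + 2) = x j • f l (j + 1) - x (j + 1) • f l j)
    (hsx : ∀ j, s (x j) = x j) (hsA : ∀ j, s (A j) = (A j - 2 * E j : Subring.center (K l)))
    (hsP : ∀ j, s (P j) = P j - E j • 1 + (if j = i then x i • (a i • (f l i)⁻¹) else 0)
      - (if j = i + 1 then x i • (a i • (f l i)⁻¹) else 0)) (y : K l) :
    D (s y) = s (D y) := by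
  have hsmul : ∀ (c d : Subring.center (K l)) (y : K l), s c = d → s (c • y) = d • s y := by
    intro c d y hc
    rw [Subring.smul_def, Subring.smul_def, smul_eq_mul, smul_eq_mul, map_mul, hc]
  have h1 := mul_inv_cancel₀ (f_ne_zero l i)
  have h2 := inv_mul_cancel₀ (f_ne_zero l i)
  have hdiv : α l i / f l i = a i • (f l i)⁻¹ := by
    rw [Subring.smul_def, smul_eq_mul, ha, div_eq_mul_inv]
  have hsf := hs.map_f
  have hne := self_ne_add_one l hl
  have hne2 := add_one_ne_sub_one l hl
  rw [hdiv] at hsf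
  -- The derivative of the correction `α_i / f_i`; it enters with opposite signs for the two
  -- neighbours `j = i ± 1`.
  have hDg : D (a i • (f l i)⁻¹) = -(a i • ((f l i)⁻¹ * D (f l i) * (f l i)⁻¹)) := by
    rw [Subring.smul_def, Subring.smul_def, smul_eq_mul, smul_eq_mul, hD, ha, hDα, zero_mul,
      zero_add, hD.map_inv, mul_neg]
  have hE' : ∀ j, E (j - 1) = -E j := fun j => by
    have := hE (j - 1); rw [sub_add_cancel] at this; rw [this, neg_neg]
  have hA' : ∀ j, A (j - 1) = -A j := fun j => by
    have := hA (j - 1); rw [sub_add_cancel] at this; rw [this, neg_neg]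
  have hsα : ∀ j c, α l j - α l i * (cartan l i j : K l) = (c : Subring.center (K l)) →
      s (a j) = c := fun j c hc => by rw [ha, hs.map_α, hc]
  refine derivation_comm l hD (fun j => ?_) (fun j => ?_) (by rw [hs.map_h, hDh, map_zero]) y
  · by_cases hj : j = i
    · subst hj
      have e1 : s (a j) = (-a j : Subring.center (K l)) := hsα _ _ (by
        rw [cartan_self]; push_cast; rw [ha]; rw [mul_two]; abel)
      rw [hsf, u_self, Int.cast_zero, mul_zero, add_zero, hDf, map_sub, map_add, map_sub, map_mul,
        map_mul, hsmul _ _ _ (hsA j), hsmul _ _ _ e1, hsmul _ _ _ (hsx j), map_one, hsP, hsP,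
        hsf, u_self, Int.cast_zero, mul_zero, add_zero, if_pos rfl, if_pos rfl, if_neg (hne _),
        if_neg (hne _).symm, hE, sub_zero, add_zero, neg_smul, sub_neg_eq_add]
      exact (reflection_ident_self h1 h2 (a j) (x j) (A j) (E j) (P j) (P (j + 1))).symm
    by_cases hj1 : j = i + 1
    · subst hj1
      have e1 : s (a (i + 1)) = (a (i + 1) + a i : Subring.center (K l)) := hsα _ _ (by
        rw [cartan_add_one l hl]; push_cast; rw [ha, ha]; rw [mul_neg_one, sub_neg_eq_add])
      have e2 : i + 1 + 1 ≠ i := fun h => hne2 i (by linear_combination h)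
      have := reflection_ident_right h1 h2 (a i) (a (i + 1)) (x i) (x (i + 1)) (A i) (E i)
        (f l (i + 1)) (P i) (P (i + 1)) (P (i + 1 + 1)) (by
          rw [← hP, show i + 1 + 1 = i + 2 by ring])
      rw [hsf, u_add_one l hl, Int.cast_one, mul_one, map_add, hDg, hDf, hDf, map_sub, map_add,
        map_sub, map_mul,
        map_mul, hsmul _ _ _ (hsA _), hsmul _ _ _ e1, hsmul _ _ _ (hsx _), map_one, hsP, hsP,
        hsf, u_add_one l hl, Int.cast_one, mul_one, if_pos rfl, if_neg (hne _).symm, if_neg e2,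
        if_neg (hne _).symm, hE (i + 1), hE i, hA, sub_zero, add_zero, add_zero, neg_neg, neg_smul (E i),
        sub_neg_eq_add, mul_neg, sub_neg_eq_add, ← sub_eq_add_neg]
      exact this.symm
    by_cases hj2 : j = i - 1
    · subst hj2
      have e1 : s (a (i - 1)) = (a (i - 1) + a i : Subring.center (K l)) := hsα _ _ (by
        rw [cartan_sub_one l hl]; push_cast; rw [ha, ha]; rw [mul_neg_one, sub_neg_eq_add])
      have := reflection_ident_left h1 h2 (a i) (a (i - 1)) (x i) (x (i - 1)) (A i) (E i)
        (f l (i - 1)) (P i) (P (i + 1)) (P (i - 1)) (by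
          have := hP (i - 1)
          rw [show i - 1 + 2 = i + 1 by ring, sub_add_cancel] at this
          exact this)
      rw [hsf, u_sub_one l hl, Int.cast_neg, Int.cast_one, mul_neg_one, map_add, map_neg, hDg, hDf,
        hDf, map_sub,
        map_add, map_sub, map_mul,
        map_mul, hsmul _ _ _ (hsA _), hsmul _ _ _ e1, hsmul _ _ _ (hsx _), map_one, hsP, hsP,
        hsf, u_sub_one l hl, Int.cast_neg, Int.cast_one, mul_neg_one, if_neg hj, if_neg hj1,
        sub_add_cancel, if_pos rfl, if_neg (hne _), hE', hA', sub_zero, add_zero, sub_zero,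
        neg_smul (E i), mul_neg, sub_neg_eq_add, sub_neg_eq_add, neg_neg, ← sub_eq_add_neg]
      exact this.symm
    · have e1 : s (a j) = (a j : Subring.center (K l)) := hsα _ _ (by
        rw [cartan_eq_zero l hj hj1 hj2, Int.cast_zero, mul_zero, sub_zero, ha])
      have e2 : j + 1 ≠ i := fun h => hj2 (by rw [← h, add_sub_cancel_right])
      have e3 : j + 1 ≠ i + 1 := fun h => hj (add_right_cancel h)
      rw [hsf, u_eq_zero l hj1 hj2, Int.cast_zero, mul_zero, add_zero, hDf, map_sub, map_add,
        map_sub, map_mul,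
        map_mul, hsmul _ _ _ (hsA _), hsmul _ _ _ e1, hsmul _ _ _ (hsx _), map_one, hsP, hsP,
        hsf, u_eq_zero l hj1 hj2, Int.cast_zero, mul_zero, add_zero, if_neg hj, if_neg hj1,
        if_neg e2, if_neg e3, hE, sub_zero, add_zero, neg_smul, sub_neg_eq_add, sub_zero, add_zero]
      exact (reflection_ident_other (a j) (x j) (A j) (E j) (f l j) (P j) (P (j + 1))).symm
  · rw [hDα, map_zero, hs.map_α, map_sub, hD, hDα, hDα, hD.map_intCast]
    simp

end K

/-! ### Sums over every second index, and commutation with `π` -/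

namespace K

variable (l : ℕ)

/-- The sum `f_j + f_{j+2} + ⋯ + f_{j+2(M-1)}`. -/
noncomputable def fSum (j : ZMod (l + 1)) (M : ℕ) : K l :=
  ∑ r ∈ Finset.range M, f l (j + 2 * (r : ZMod (l + 1)))

theorem fSum_succ (j : ZMod (l + 1)) (M : ℕ) :
    fSum l j (M + 1) = fSum l j M + f l (j + 2 * (M : ZMod (l + 1))) :=
  Finset.sum_range_succ _ _

theorem fSum_succ' (j : ZMod (l + 1)) (M : ℕ) :
    fSum l j (M + 1) = f l j + fSum l (j + 2) M := by
  rw [fSum, Finset.sum_range_succ', add_comm, Nat.cast_zero, mul_zero, add_zero, fSum]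
  congr 1
  refine Finset.sum_congr rfl fun r _ => ?_
  congr 1
  push_cast
  ring

/-- Since `x = m - 1` is the same as `x + 2 = m + 1`, each `u_{m,x}` is a difference of one
indicator function at `x` and `x + 2`, and the sum in steps of two telescopes. -/
theorem sum_u (m j : ZMod (l + 1)) (M : ℕ) :
    ∑ r ∈ Finset.range M, u l m (j + 2 * (r : ZMod (l + 1))) =
      (if j = m + 1 then 1 else 0) - (if j + 2 * (M : ZMod (l + 1)) = m + 1 then 1 else 0) := by
  have h : ∀ r : ℕ, u l m (j + 2 * (r : ZMod (l + 1))) =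
      (if j + 2 * (r : ZMod (l + 1)) = m + 1 then 1 else 0) -
      (if j + 2 * ((r + 1 : ℕ) : ZMod (l + 1)) = m + 1 then 1 else 0) := by
    intro r
    have : j + 2 * ((r + 1 : ℕ) : ZMod (l + 1)) = m + 1 ↔ j + 2 * (r : ZMod (l + 1)) = m - 1 := by
      push_cast
      constructor <;> intro h <;> linear_combination h
    simp only [u, this]
  simp only [h]
  rw [Finset.sum_range_sub' (fun r : ℕ =>
    (if j + 2 * (r : ZMod (l + 1)) = m + 1 then 1 else 0 : ℤ))]
  simp

theorem map_f_smul {i : ZMod (l + 1)} {s : K l ≃ₐ[ℂ] K l} (hs : IsS l i s) (j : ZMod (l + 1)) :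
    s (f l j) = f l j + u l i j • (α l i / f l i) := by
  rw [hs.map_f, zsmul_eq_mul']

theorem map_fSum {i : ZMod (l + 1)} {s : K l ≃ₐ[ℂ] K l} (hs : IsS l i s) (j : ZMod (l + 1))
    (M : ℕ) : s (fSum l j M) = fSum l j M + ((if j = i + 1 then 1 else 0) -
      (if j + 2 * (M : ZMod (l + 1)) = i + 1 then 1 else 0) : ℤ) • (α l i / f l i) := by
  rw [fSum, map_sum, ← sum_u, Finset.sum_smul, ← Finset.sum_add_distrib]
  exact Finset.sum_congr rfl fun r _ => map_f_smul l hs _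

theorem pi_fSum {p : K l ≃ₐ[ℂ] K l} (hp : IsPi l p) (j : ZMod (l + 1)) (M : ℕ) :
    p (fSum l j M) = fSum l (j + 1) M := by
  rw [fSum, map_sum, fSum]
  refine Finset.sum_congr rfl fun r _ => ?_
  rw [hp.map_f, add_right_comm]

theorem comm_rotation {D : K l →ₗ[ℂ] K l} (hD : IsDerivation D)
    {p : K l ≃ₐ[ℂ] K l} (hp : IsPi l p) (P : ZMod (l + 1) → K l)
    (a x A : ZMod (l + 1) → Subring.center (K l)) (ha : ∀ j, (a j : K l) = α l j)
    (hDf : ∀ j, D (f l j) = f l j * P j - P (j + 1) * f l j + a j • (x j • 1) - A j • f l j)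
    (hDα : ∀ j, D (α l j) = 0) (hDh : D (h l) = 0) (hpP : ∀ j, p (P j) = P (j + 1))
    (hpx : ∀ j, p (x j) = x (j + 1)) (hpA : ∀ j, p (A j) = A (j + 1)) (y : K l) :
    D (p y) = p (D y) := by
  have hsmul : ∀ (c d : Subring.center (K l)) (y : K l), p c = d → p (c • y) = d • p y := by
    intro c d y hc
    rw [Subring.smul_def, Subring.smul_def, smul_eq_mul, smul_eq_mul, map_mul, hc]
  refine derivation_comm l hD (fun j => ?_) (fun j => ?_) (by rw [hp.map_h, hDh, map_zero]) y
  · rw [hp.map_f, hDf, hDf, map_sub, map_add, map_sub, map_mul, map_mul, hpP, hpP, hp.map_f,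
      hsmul _ _ _ (hpA j), hsmul (a j) (a (j + 1)) _ (by rw [ha, ha, hp.map_α]),
      hsmul _ _ _ (hpx j), map_one, hp.map_f]
  · rw [hp.map_α, hDα, hDα, map_zero]

/-- `α_j` as an element of the center. -/
noncomputable def αCenter (j : ZMod (l + 1)) : Subring.center (K l) :=
  ⟨α l j, Subring.mem_center_iff.2 fun y => ((α_comm l j y).eq).symm⟩

/-! ### Even `l` -/

/-- The general criteria apply with `x_j = 1`, `A_j = E_j = 0` and `P_j = f_{j+1} + f_{j+3} + ⋯`.
Because `2n = -1` modulo `2n + 1`, the telescoped boundary terms sit at `j = i` and `j = i + 1`, and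
`P_j - P_{j+2} = f_{j+1} - f_j`. -/
theorem comm_reflection_even {n : ℕ} (hn : 1 ≤ n) (hl : l = 2 * n) {D : K l →ₗ[ℂ] K l}
    (hD : IsDerivation D)
    (hDf : ∀ j, D (f l j) = f l j * fSum l (j + 1) n - fSum l (j + 2) n * f l j + α l j)
    (hDα : ∀ j, D (α l j) = 0) (hDh : D (h l) = 0) :
    (∀ i s, IsS l i s → ∀ y, D (s y) = s (D y)) ∧ ∀ p, IsPi l p → ∀ y, D (p y) = p (D y) := by
  have hcast : (2 : ZMod (l + 1)) * (n : ZMod (l + 1)) = -1 := by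
    have : ((l + 1 : ℕ) : ZMod (l + 1)) = 0 := ZMod.natCast_self _
    rw [hl] at this ⊢
    push_cast at this
    linear_combination this
  have hDf' : ∀ j, D (f l j) = f l j * fSum l (j + 1) n - fSum l (j + 1 + 1) n * f l j +
      αCenter l j • ((1 : Subring.center (K l)) • 1) - (0 : Subring.center (K l)) • f l j := by
    intro j
    rw [hDf, show j + 1 + 1 = j + 2 by ring, one_smul, zero_smul, sub_zero, Subring.smul_def,
      smul_eq_mul, mul_one, αCenter]
  refine ⟨fun i s hs => ?_, fun p hp => ?_⟩
  · refine comm_reflection l (by omega) hD hs (fun j => fSum l (j + 1) n) (αCenter l)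
      (fun _ => 1) (fun _ => 0) (fun _ => 0) (fun _ => rfl) hDf' hDα hDh (by simp) (by simp)
      (fun j => ?_) (by simp) (by simp) (fun j => ?_)
    · have h1 := fSum_succ l (j + 1) n
      have h2 := fSum_succ' l (j + 1) n
      rw [h1, add_assoc j, hcast] at h2
      rw [one_smul, one_smul, show j + 2 + 1 = j + 1 + 2 by ring, sub_eq_sub_iff_add_eq_add, ← h2]
      simp
    · have e : j + 1 + 2 * (n : ZMod (l + 1)) = j := by rw [hcast]; ring
      have e' : α l i / f l i = αCenter l i • (f l i)⁻¹ := by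
        rw [Subring.smul_def, smul_eq_mul, αCenter, div_eq_mul_inv]
      rw [map_fSum l hs, e, e', sub_smul, ite_smul, ite_smul]
      simp only [add_left_inj, one_smul, zero_smul, sub_zero, add_sub_assoc]
  · exact comm_rotation l hD hp (fun j => fSum l (j + 1) n) (αCenter l)
      (fun _ => 1) (fun _ => 0) (fun _ => rfl) hDf' hDα hDh (fun j => pi_fSum l hp _ _)
      (by simp) (by simp)

end K

/-! ### Odd `l`: central sums, parity classes and quadratic coefficients -/

namespace K

variable (l : ℕ)

theorem commutator_fSum (m j : ZMod (l + 1)) (M : ℕ) :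
    f l m * fSum l j M - fSum l j M * f l m = ((if j = m + 1 then 1 else 0) -
      (if j + 2 * (M : ZMod (l + 1)) = m + 1 then 1 else 0) : ℤ) • h l := by
  rw [fSum, Finset.mul_sum, Finset.sum_mul, ← Finset.sum_sub_distrib, ← sum_u, Finset.sum_smul]
  refine Finset.sum_congr rfl fun r _ => ?_
  rw [ff, zsmul_eq_mul]

theorem sum_periodic {M : Type*} [AddCommMonoid M] {N : ℕ} (hN : (2 * N : ZMod (l + 1)) = 0)
    (φ : ZMod (l + 1) → M) (j : ZMod (l + 1)) :
    ∑ s ∈ Finset.range N, φ (j + 2 + 2 * (s : ZMod (l + 1))) =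
      ∑ s ∈ Finset.range N, φ (j + 2 * (s : ZMod (l + 1))) := by
  cases N with
  | zero => simp
  | succ N =>
    rw [Finset.sum_range_succ, Finset.sum_range_succ']
    push_cast at hN
    congr 1
    · refine Finset.sum_congr rfl fun s _ => ?_
      congr 1
      push_cast
      ring
    · congr 1
      push_cast
      linear_combination hN

theorem sum_univ_eq_range {M : Type*} [AddCommMonoid M] (φ : ZMod (l + 1) → M)
    (j : ZMod (l + 1)) : ∑ i, φ i = ∑ r ∈ Finset.range (l + 1), φ (j + (r : ZMod (l + 1))) := by
  rw [← Equiv.sum_comp (Equiv.addLeft j) φ, Finset.sum_range]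
  refine Finset.sum_congr rfl fun r _ => ?_
  rw [Equiv.coe_addLeft]
  congr 2
  exact (ZMod.natCast_zmod_val r).symm

theorem sum_range_two_mul {M : Type*} [AddCommMonoid M] (ψ : ℕ → M) (N : ℕ) :
    ∑ r ∈ Finset.range (2 * N), ψ r =
      ∑ s ∈ Finset.range N, ψ (2 * s) + ∑ s ∈ Finset.range N, ψ (2 * s + 1) := by
  induction N with
  | zero => simp
  | succ N ih =>
    rw [show 2 * (N + 1) = 2 * N + 1 + 1 by ring, Finset.sum_range_succ, Finset.sum_range_succ, ih,
      Finset.sum_range_succ, Finset.sum_range_succ]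
    abel

/-- The sum `α_j + α_{j+2} + ⋯ + α_{j+2(M-1)}`. -/
noncomputable def αSum (j : ZMod (l + 1)) (M : ℕ) : K l :=
  ∑ r ∈ Finset.range M, α l (j + 2 * (r : ZMod (l + 1)))

theorem k_eq_αSum {n : ℕ} (hl : l = 2 * n + 1) (j : ZMod (l + 1)) :
    k l = αSum l j (n + 1) + αSum l (j + 1) (n + 1) := by
  rw [k, sum_univ_eq_range l _ j, show Finset.range (l + 1) = Finset.range (2 * (n + 1)) by congr 1; omega,
    sum_range_two_mul, αSum, αSum]
  congr 1 <;> refine Finset.sum_congr rfl fun s _ => ?_ <;> congr 1 <;> push_cast <;> ring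

/-- The number of `s < M` with `j + 2 s = i`. -/
def hits (i j : ZMod (l + 1)) (M : ℕ) : ℤ :=
  ∑ s ∈ Finset.range M, if j + 2 * (s : ZMod (l + 1)) = i then 1 else 0

variable {l}

section Odd

variable {n : ℕ} (hl : l = 2 * n + 1)
include hl

theorem two_mul_cast_eq_zero : (2 * (n + 1 : ℕ) : ZMod (l + 1)) = 0 := by
  have : ((l + 1 : ℕ) : ZMod (l + 1)) = 0 := ZMod.natCast_self _
  rw [hl] at this ⊢
  push_cast at this ⊢
  linear_combination this

theorem add_two_mul_cast (j : ZMod (l + 1)) : j + 2 * (n : ZMod (l + 1)) = j - 2 := by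
  have := two_mul_cast_eq_zero hl
  push_cast at this
  linear_combination this

/-- After `n + 1` steps of two the index is back at its start, so the two boundary terms of the
telescoping commutator cancel. -/
theorem fSum_comm (j : ZMod (l + 1)) (y : K l) : Commute (fSum l j (n + 1)) y := by
  refine (isSkewFractionField l).central (Alg.adjoin_gen l) (fun x => ?_) y
  rcases x with m | m | _
  · have := commutator_fSum l m j (n + 1)
    rw [two_mul_cast_eq_zero hl, add_zero, sub_self, zero_smul, sub_eq_zero] at this
    exact this.symm
  · exact (α_comm l m _).symm
  · exact (h_comm l _).symm

theorem fSum_add_two (j : ZMod (l + 1)) : fSum l (j + 2) (n + 1) = fSum l j (n + 1) :=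
  sum_periodic l (two_mul_cast_eq_zero hl) _ _

theorem hits_add_two (i j : ZMod (l + 1)) : hits l i (j + 2) (n + 1) = hits l i j (n + 1) :=
  sum_periodic l (two_mul_cast_eq_zero hl) (fun m => if m = i then 1 else 0) j

/-- As `l + 1` is even, parity is well defined on the indices, and steps of two preserve it. -/
theorem not_both_parities {i j : ZMod (l + 1)} (r s : ℕ) (h1 : j + 2 * (r : ZMod (l + 1)) = i)
    (h2 : j + 1 + 2 * (s : ZMod (l + 1)) = i) : False := by
  have h3 : ((2 * r : ℕ) : ZMod (l + 1)) = ((2 * s + 1 : ℕ) : ZMod (l + 1)) := by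
    push_cast
    linear_combination h1 - h2
  rw [ZMod.natCast_eq_natCast_iff'] at h3
  have h4 : 2 * r % (l + 1) % 2 = (2 * s + 1) % (l + 1) % 2 := by rw [h3]
  rw [Nat.mod_mod_of_dvd _ ⟨n + 1, by omega⟩, Nat.mod_mod_of_dvd _ ⟨n + 1, by omega⟩] at h4
  omega

/-- The row of the Cartan matrix is `2 [m = i] - [m + 1 = i] - [m - 1 = i]`. Summed over a parity
class, the first term counts `i` in the class of `j`, and each of the other two counts `i` in the
opposite class. -/
theorem sum_cartan (h2 : 2 ≤ l) (i j : ZMod (l + 1)) :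
    ∑ s ∈ Finset.range (n + 1), cartan l i (j + 2 * (s : ZMod (l + 1))) =
      2 * (hits l i j (n + 1) - hits l i (j + 1) (n + 1)) := by
  have e1 : ∀ m, cartan l i m = 2 * (if m = i then 1 else 0) - (if m + 1 = i then 1 else 0)
      - (if m - 1 = i then 1 else 0) := by
    intro m
    have a1 := self_ne_add_one l h2 i
    have a2 := add_one_ne_sub_one l h2 i
    have a3 : m + 1 = i ↔ m = i - 1 := eq_sub_iff_add_eq.symm
    have a4 : m - 1 = i ↔ m = i + 1 := sub_eq_iff_eq_add
    simp only [a3, a4]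
    by_cases b0 : m = i
    · subst b0
      have a5 := self_ne_add_one l h2 (m - 1)
      rw [sub_add_cancel] at a5
      simp [cartan_self, a1, a5.symm]
    by_cases b1 : m = i + 1
    · subst b1
      simp [cartan_add_one l h2, a2, a1.symm]
    by_cases b2 : m = i - 1
    · subst b2
      simp [cartan_sub_one l h2, b0, a2.symm]
    simp [cartan_eq_zero l b0 b1 b2, b0, b1, b2]
  have e2 : hits l i (j + 1) (n + 1) =
      ∑ s ∈ Finset.range (n + 1), if j + 2 * (s : ZMod (l + 1)) - 1 = i then 1 else 0 := by
    have := hits_add_two hl i (j - 1)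
    rw [show j - 1 + 2 = j + 1 by ring] at this
    rw [this, hits]
    refine Finset.sum_congr rfl fun s _ => ?_
    rw [sub_add_eq_add_sub]
  have e3 : hits l i (j + 1) (n + 1) =
      ∑ s ∈ Finset.range (n + 1), if j + 2 * (s : ZMod (l + 1)) + 1 = i then 1 else 0 := by
    rw [hits]
    refine Finset.sum_congr rfl fun s _ => ?_
    rw [add_right_comm]
  have e4 : ∑ s ∈ Finset.range (n + 1), cartan l i (j + 2 * (s : ZMod (l + 1))) =
      2 * hits l i j (n + 1) - hits l i (j + 1) (n + 1) - hits l i (j + 1) (n + 1) := by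
    nth_rw 1 [e3]
    rw [e2, hits, Finset.mul_sum, ← Finset.sum_sub_distrib, ← Finset.sum_sub_distrib]
    exact Finset.sum_congr rfl fun s _ => e1 _
  rw [e4]
  ring

theorem map_αSum (h2 : 2 ≤ l) {i : ZMod (l + 1)} {s : K l ≃ₐ[ℂ] K l} (hs : IsS l i s)
    (j : ZMod (l + 1)) : s (αSum l j (n + 1)) = αSum l j (n + 1) -
      (2 * (hits l i j (n + 1) - hits l i (j + 1) (n + 1))) • α l i := by
  rw [αSum, map_sum, ← sum_cartan hl h2, Finset.sum_smul, ← Finset.sum_sub_distrib]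
  refine Finset.sum_congr rfl fun r _ => ?_
  rw [hs.map_α, zsmul_eq_mul']

theorem map_k (h2 : 2 ≤ l) {i : ZMod (l + 1)} {s : K l ≃ₐ[ℂ] K l} (hs : IsS l i s) :
    s (k l) = k l := by
  rw [k_eq_αSum l hl 0, map_add, map_αSum hl h2 hs, map_αSum hl h2 hs,
    show (0 : ZMod (l + 1)) + 1 + 1 = 0 + 2 by ring, hits_add_two hl]
  module

variable (l) in
/-- The sum of the products `f_{j+1+2r} f_{j+2+2s}` with `0 ≤ r ≤ s < n`. -/
noncomputable def fSumTwo (j : ZMod (l + 1)) (n : ℕ) : K l :=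
  ∑ s ∈ Finset.range n, fSum l (j + 1) (s + 1) * f l (j + 2 + 2 * (s : ZMod (l + 1)))

omit hl in
theorem pi_fSumTwo {p : K l ≃ₐ[ℂ] K l} (hp : IsPi l p) (j : ZMod (l + 1)) :
    p (fSumTwo l j n) = fSumTwo l (j + 1) n := by
  rw [fSumTwo, map_sum, fSumTwo]
  refine Finset.sum_congr rfl fun r _ => ?_
  rw [map_mul, pi_fSum l hp, hp.map_f]
  congr 2
  ring

/-- In the sum for `j + 2` the first index runs through the same values as for `j`, with `f_{j+1}`
omitted, and the second index goes one step further, to `j + 2 + 2n = j`. The difference therefore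
consists of all products with first factor `f_{j+1}`, minus those with last factor `f_j`. -/
theorem fSumTwo_sub (j : ZMod (l + 1)) : fSumTwo l j n - fSumTwo l (j + 2) n =
    f l (j + 1) * fSum l j (n + 1) - fSum l (j + 1) (n + 1) * f l j := by
  -- The range is extended by a term `s = 0` which vanishes; this aligns the indices with those of
  -- the sum for `j`.
  have h1 : fSumTwo l (j + 2) n = ∑ s ∈ Finset.range (n + 1),
      (fSum l (j + 1) (s + 1) - f l (j + 1)) * f l (j + 2 + 2 * (s : ZMod (l + 1))) := by
    rw [Finset.sum_range_succ', fSumTwo]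
    simp only [zero_add, Nat.cast_zero, mul_zero, add_zero]
    rw [show fSum l (j + 1) 1 - f l (j + 1) = 0 by simp [fSum], zero_mul, add_zero]
    refine Finset.sum_congr rfl fun s _ => ?_
    rw [fSum_succ' l (j + 1) (s + 1), add_sub_cancel_left]
    congr 2
    · ring
    · push_cast
      ring
  rw [h1]
  simp only [sub_mul]
  rw [Finset.sum_sub_distrib, ← Finset.mul_sum, Finset.sum_range_succ]
  have h3 := fSum_add_two hl j
  rw [fSum] at h3
  rw [h3, fSumTwo, add_two_mul_cast hl, add_sub_cancel_right]
  abel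

omit hl in
-- Summation by parts: consecutive partial sums differ by `f_{j+2s}`, and the indicator `j + 2s = i`
-- turns this factor times `g` into `a`.
theorem sum_tail_mul {i : ZMod (l + 1)} (g a : K l) (hg : f l i * g = a) (j : ZMod (l + 1)) (M : ℕ) :
    ∑ s ∈ Finset.range M, ((if j + 2 * (s : ZMod (l + 1)) = i then 1 else 0) -
      (if j + 2 * ((s + 1 : ℕ) : ZMod (l + 1)) = i then 1 else 0) : ℤ) • (fSum l j (s + 1) * g) =
    hits l i j M • a -
      (if j + 2 * (M : ZMod (l + 1)) = i then 1 else 0 : ℤ) • (fSum l j M * g) := by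
  induction M with
  | zero => simp [hits, fSum]
  | succ M ih =>
    have e : (if j + 2 * (M : ZMod (l + 1)) = i then 1 else 0 : ℤ) •
        (f l (j + 2 * (M : ZMod (l + 1))) * g) =
        (if j + 2 * (M : ZMod (l + 1)) = i then 1 else 0 : ℤ) • a := by
      split_ifs with h
      · rw [h, hg]
      · simp
    rw [Finset.sum_range_succ, ih, hits, hits, Finset.sum_range_succ, add_smul, ← e, fSum_succ,
      add_mul]
    module

omit hl in
-- The missing summand with index `j` contributes `[j = i] a` both to the full sum and to the count
-- of hits, so it may be added on both sides.
theorem sum_head_mul {i : ZMod (l + 1)} (g a : K l) (hg : g * f l i = a) (j : ZMod (l + 1)) :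
    ∑ s ∈ Finset.range n, ((if j = i then 1 else 0) -
      (if j + 2 * ((s + 1 : ℕ) : ZMod (l + 1)) = i then 1 else 0) : ℤ) •
        (g * f l (j + 2 * ((s + 1 : ℕ) : ZMod (l + 1)))) =
    (if j = i then 1 else 0 : ℤ) • (g * fSum l j (n + 1)) - hits l i j (n + 1) • a := by
  have e : ∀ m : ZMod (l + 1), (if m = i then 1 else 0 : ℤ) • (g * f l m) =
      (if m = i then 1 else 0 : ℤ) • a := by
    intro m
    split_ifs with h
    · rw [h, hg]
    · simp
  simp only [sub_smul, e]
  rw [Finset.sum_sub_distrib, ← Finset.smul_sum, ← Finset.mul_sum, hits, fSum,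
    Finset.sum_range_succ', Finset.sum_range_succ', add_smul, Finset.sum_smul, mul_add, smul_add]
  simp only [Nat.cast_zero, mul_zero, add_zero]
  rw [e j]
  abel

theorem map_fSumTwo {i : ZMod (l + 1)} {s : K l ≃ₐ[ℂ] K l} (hs : IsS l i s) (j : ZMod (l + 1)) :
    s (fSumTwo l j n) = fSumTwo l j n - (hits l i j (n + 1) - hits l i (j + 1) (n + 1)) • α l i
      + (if j = i then α l i / f l i * fSum l i (n + 1) else 0)
      - (if j = i + 1 then α l i / f l i * fSum l i (n + 1) else 0) := by
  have hg1 : α l i / f l i * f l i = α l i := div_mul_cancel₀ _ (f_ne_zero l i)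
  have hg2 : f l i * (α l i / f l i) = α l i := by
    rw [div_eq_mul_inv, ← mul_assoc, ← (α_comm l i (f l i)).eq, mul_assoc,
      mul_inv_cancel₀ (f_ne_zero l i), mul_one]
  have hf := map_f_smul l hs
  have hS := map_fSum l hs
  generalize α l i / f l i = g at *
  have e1 : ∀ r : ℕ, s (fSum l (j + 1) (r + 1) * f l (j + 2 + 2 * (r : ZMod (l + 1)))) =
      fSum l (j + 1) (r + 1) * f l (j + 2 + 2 * (r : ZMod (l + 1))) +
      ((if j = i then 1 else 0) -
      (if j + 2 * ((r + 1 : ℕ) : ZMod (l + 1)) = i then 1 else 0) : ℤ) •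
        (g * f l (j + 2 * ((r + 1 : ℕ) : ZMod (l + 1)))) +
      ((if j + 1 + 2 * (r : ZMod (l + 1)) = i then 1 else 0) -
      (if j + 1 + 2 * ((r + 1 : ℕ) : ZMod (l + 1)) = i then 1 else 0) : ℤ) •
        (fSum l (j + 1) (r + 1) * g) := by
    intro r
    have a1 : j + 2 + 2 * (r : ZMod (l + 1)) = j + 2 * ((r + 1 : ℕ) : ZMod (l + 1)) := by
      push_cast; ring
    have a2 : j + 1 + 2 * ((r + 1 : ℕ) : ZMod (l + 1)) = i + 1 ↔
        j + 2 * ((r + 1 : ℕ) : ZMod (l + 1)) = i := by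
      rw [add_right_comm, add_left_inj]
    have a3 : u l i (j + 2 * ((r + 1 : ℕ) : ZMod (l + 1))) =
        (if j + 1 + 2 * (r : ZMod (l + 1)) = i then 1 else 0) -
        (if j + 1 + 2 * ((r + 1 : ℕ) : ZMod (l + 1)) = i then 1 else 0) := by
      have b1 : j + 2 * ((r + 1 : ℕ) : ZMod (l + 1)) = i + 1 ↔
          j + 1 + 2 * (r : ZMod (l + 1)) = i := by
        push_cast
        constructor <;> intro h <;> linear_combination h
      have b2 : j + 2 * ((r + 1 : ℕ) : ZMod (l + 1)) = i - 1 ↔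
          j + 1 + 2 * ((r + 1 : ℕ) : ZMod (l + 1)) = i := by
        push_cast
        constructor <;> intro h <;> linear_combination h
      simp only [u, b1, b2]
    -- The term quadratic in `g` vanishes: the left factor can change only if `i` has the parity of
    -- `j`, the right factor only if `i` has the parity of `j + 1`.
    have a4 : ((if j = i then 1 else 0) -
        (if j + 2 * ((r + 1 : ℕ) : ZMod (l + 1)) = i then 1 else 0) : ℤ) *
        ((if j + 1 + 2 * (r : ZMod (l + 1)) = i then 1 else 0) -
        (if j + 1 + 2 * ((r + 1 : ℕ) : ZMod (l + 1)) = i then 1 else 0)) = 0 := by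
      have c : ∀ a b : ℕ, (if j + 2 * (a : ZMod (l + 1)) = i then 1 else 0 : ℤ) *
          (if j + 1 + 2 * (b : ZMod (l + 1)) = i then 1 else 0) = 0 := by
        intro a b
        split_ifs with h1 h2
        · exact (not_both_parities hl a b h1 h2).elim
        all_goals simp
      have c0 := c 0
      rw [Nat.cast_zero, mul_zero, add_zero] at c0
      rw [mul_sub, sub_mul, sub_mul, c, c, c0, c0]
      simp
    rw [map_mul, hS, hf, a1, a3]
    simp only [add_left_inj, a2]
    rw [add_mul, mul_add, mul_add, mul_smul_comm, smul_mul_assoc, smul_mul_smul_comm, a4, zero_smul,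
      add_zero]
    abel
  -- The upper end of the sum is `j + 1 + 2n = j - 1`. This is the origin of the special case `j = i
  -- + 1`.
  have e2 : j + 1 + 2 * (n : ZMod (l + 1)) = i ↔ j = i + 1 := by
    rw [add_two_mul_cast hl]
    constructor <;> intro h <;> linear_combination h
  -- The partial sum is completed to the full one, which is central; the added summand becomes a
  -- multiple of `α_i` and corrects the number of hits.
  have e3 : fSum l (j + 1) n * g = fSum l (j + 1) (n + 1) * g -
      f l (j + 1 + 2 * (n : ZMod (l + 1))) * g := by
    rw [fSum_succ, add_mul, add_sub_cancel_right]
  rw [fSumTwo, map_sum]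
  simp only [e1]
  rw [Finset.sum_add_distrib, Finset.sum_add_distrib, sum_head_mul g _ hg1,
    sum_tail_mul g _ hg2, e3, show hits l i (j + 1) (n + 1) = hits l i (j + 1) n + _ from
    Finset.sum_range_succ _ _]
  have e4 : (if j = i then 1 else 0 : ℤ) • (g * fSum l j (n + 1)) =
      if j = i then g * fSum l i (n + 1) else 0 := by
    split_ifs with h
    · rw [h, one_smul]
    · rw [zero_smul]
  have e5 : (if j + 1 + 2 * (n : ZMod (l + 1)) = i then 1 else 0 : ℤ) •
      (fSum l (j + 1) (n + 1) * g - f l (j + 1 + 2 * (n : ZMod (l + 1))) * g) =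
      (if j = i + 1 then g * fSum l i (n + 1) else 0) -
        (if j + 1 + 2 * (n : ZMod (l + 1)) = i then 1 else 0 : ℤ) • α l i := by
    by_cases h : j + 1 + 2 * (n : ZMod (l + 1)) = i
    · have h' := e2.1 h
      rw [if_pos h, if_pos h', h, hg2, h', show i + 1 + 1 = i + 2 by ring, fSum_add_two hl,
        (fSum_comm hl i g).eq, one_smul, one_smul]
    · rw [if_neg h, if_neg (mt e2.2 h), zero_smul, zero_smul, sub_zero]
  rw [e4, e5]
  module

/-- The two parity classes of the `α_m` add up to `k`, so subtracting `k/2` makes `A_j` change sign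
with `j`. The shift is `E_j = ± α_i`, positive when `i` and `j` have the same parity; this is half
of what `s_i` subtracts from the `α`-sum, as `A_j - 2 E_j` requires. -/
theorem comm_odd (hn : 1 ≤ n) {D : K l →ₗ[ℂ] K l} (hD : IsDerivation D)
    (hDf : ∀ j, D (f l j) = f l j * fSumTwo l j n - fSumTwo l (j + 1) n * f l j
      + α l j * fSum l j (n + 1) - (αSum l j (n + 1) - k l / 2) * f l j)
    (hDα : ∀ j, D (α l j) = 0) (hDh : D (h l) = 0) :
    (∀ i s, IsS l i s → ∀ y, D (s y) = s (D y)) ∧ ∀ p, IsPi l p → ∀ y, D (p y) = p (D y) := by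
  let x : ZMod (l + 1) → Subring.center (K l) := fun j =>
    ⟨fSum l j (n + 1), Subring.mem_center_iff.2 fun y => ((fSum_comm hl j y).eq).symm⟩
  let A : ZMod (l + 1) → Subring.center (K l) := fun j =>
    ⟨αSum l j (n + 1) - k l / 2, sub_mem
      (sum_mem fun r _ => (αCenter l _).2) (Subring.mem_center_iff.2 fun y =>
        (((k_comm l y).div_left (Commute.ofNat_left 2 y)).eq).symm)⟩
  have hDf' : ∀ j, D (f l j) = f l j * fSumTwo l j n - fSumTwo l (j + 1) n * f l j +
      αCenter l j • (x j • 1) - A j • f l j := by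
    intro j
    rw [hDf, Subring.smul_def, Subring.smul_def, Subring.smul_def, smul_eq_mul, smul_eq_mul,
      smul_eq_mul, mul_one]
    rfl
  have hk : k l / 2 + k l / 2 = k l := add_halves _
  refine ⟨fun i s hs => ?_, fun p hp => ?_⟩
  · refine comm_reflection l (by omega) hD hs (fun j => fSumTwo l j n) (αCenter l) x A
      (fun j => (hits l i j (n + 1) - hits l i (j + 1) (n + 1)) • αCenter l i) (fun _ => rfl)
      hDf' hDα hDh (fun j => ?_) (fun j => ?_) (fun j => ?_) (fun j => ?_) (fun j => ?_) (fun j => ?_)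
    · ext
      have := k_eq_αSum l hl j
      simp only [A, Subring.coe_neg]
      rw [eq_neg_iff_add_eq_zero, sub_add_sub_comm, hk, this]
      abel
    · rw [show j + 1 + 1 = j + 2 by ring, hits_add_two hl]
      module
    · rw [fSumTwo_sub hl, (fSum_comm hl j _).symm.eq]; rfl
    · simp only [x]
      rw [map_fSum l hs, two_mul_cast_eq_zero hl, add_zero, sub_self, zero_smul, add_zero]
    · simp only [A]
      rw [map_sub, map_αSum hl (by omega) hs, map_div₀, map_k hl (by omega) hs, map_ofNat]
      rw [mul_smul, two_smul, two_mul]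
      simp only [αCenter, zsmul_eq_mul]
      push_cast
      abel
    · rw [map_fSumTwo hl hs]
      have e' : α l i / f l i * fSum l i (n + 1) = x i • αCenter l i • (f l i)⁻¹ := by
        rw [Subring.smul_def, smul_eq_mul, Subring.smul_def, smul_eq_mul, αCenter, ← div_eq_mul_inv,
          (fSum_comm hl i _).eq]
      rw [e']
      congr 3
      rw [Subring.smul_def, smul_eq_mul, mul_one]
      rfl
  · refine comm_rotation l hD hp (fun j => fSumTwo l j n) (αCenter l)
      x A (fun _ => rfl) hDf' hDα hDh (fun j => pi_fSumTwo hp _)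
      (fun j => pi_fSum l hp _ _) (fun j => ?_)
    have hpk : p (k l) = k l := by
      rw [k, map_sum, ← Equiv.sum_comp (Equiv.addRight (1 : ZMod (l + 1))) (α l)]
      exact Finset.sum_congr rfl fun r _ => hp.map_α r
    simp only [A]
    rw [map_sub, map_div₀, hpk, map_ofNat, αSum, map_sum, αSum]
    congr 1
    refine Finset.sum_congr rfl fun r _ => ?_
    rw [hp.map_α, add_right_comm]

end Odd

end K

/-! ### Connected components and the products `f_C` -/

namespace K

variable (l : ℕ)

theorem add_natCast_inj {a : ZMod (l + 1)} {p q : ℕ} (hp : p ≤ l) (hq : q ≤ l) :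
    a + (p : ZMod (l + 1)) = a + (q : ZMod (l + 1)) ↔ p = q := by
  rw [add_right_inj, ZMod.natCast_eq_natCast_iff', Nat.mod_eq_of_lt (by omega),
    Nat.mod_eq_of_lt (by omega)]

theorem natCast_self_add_one : (l : ZMod (l + 1)) + 1 = 0 := by
  have : ((l + 1 : ℕ) : ZMod (l + 1)) = 0 := ZMod.natCast_self _
  push_cast at this
  exact this

theorem exists_offset (a b : ZMod (l + 1)) : ∃ p : ℕ, p ≤ l ∧ b = a + (p : ZMod (l + 1)) :=
  ⟨(b - a).val, Nat.lt_succ_iff.1 (ZMod.val_lt _), by rw [ZMod.natCast_zmod_val]; ring⟩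

theorem mem_components {C : Finset (ZMod (l + 1))} {i : ZMod (l + 1)} {m : ℕ} :
    (i, m) ∈ components l C ↔ (1 ≤ m ∧ m ≤ l) ∧ i - 1 ∉ C ∧
      (∀ t < m, i + (t : ZMod (l + 1)) ∈ C) ∧ i + (m : ZMod (l + 1)) ∉ C := by
  simp [components]

variable {l}

section Peel

variable {C : Finset (ZMod (l + 1))} {a : ZMod (l + 1)}

theorem exists_run (ha : a ∈ C) (ha1 : a - 1 ∉ C) : ∃ m, (a, m) ∈ components l C := by
  classical
  have hex : ∃ m : ℕ, a + (m : ZMod (l + 1)) ∉ C :=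
    ⟨l, by rwa [show a + (l : ZMod (l + 1)) = a - 1 by linear_combination natCast_self_add_one l]⟩
  refine ⟨Nat.find hex, (mem_components l).2 ⟨⟨?_, ?_⟩, ha1, fun t ht => ?_, Nat.find_spec hex⟩⟩
  · rw [Nat.one_le_iff_ne_zero]
    intro h
    have := Nat.find_spec hex
    rw [h] at this
    simp [ha] at this
  · exact Nat.find_min' hex (by
      rwa [show a + (l : ZMod (l + 1)) = a - 1 by linear_combination natCast_self_add_one l])
  · simpa using Nat.find_min hex ht

theorem run_unique {m m' : ℕ} (h : (a, m) ∈ components l C) (h' : (a, m') ∈ components l C) :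
    m = m' := by
  rw [mem_components] at h h'
  rcases lt_trichotomy m m' with hm | hm | hm
  · exact absurd (h'.2.2.1 m hm) h.2.2.2
  · exact hm
  · exact absurd (h.2.2.1 m' hm) h'.2.2.2

/-- Since `a` is the first element of its component, removing it cuts nothing in two: that component
loses its left end, disappearing if it had length one, and all others are untouched. -/
theorem mem_components_erase {m : ℕ} (ham : (a, m) ∈ components l C) (i : ZMod (l + 1)) (m' : ℕ) :
    (i, m') ∈ components l (C.erase a) ↔
      ((i, m') ∈ components l C ∧ i ≠ a) ∨ (i = a + 1 ∧ m' + 1 = m ∧ 1 ≤ m') := by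
  have ham' := (mem_components l).1 ham
  obtain ⟨⟨hm1, hml⟩, ha1, hat, hamC⟩ := ham'
  have ha : a ∈ C := by simpa using hat 0 hm1
  constructor
  · rw [mem_components]
    simp only [Finset.mem_erase, not_and]
    rintro ⟨⟨h1, h2⟩, h3, h4, h5⟩
    have h6 : i + (m' : ZMod (l + 1)) ∉ C := by
      intro h
      have h7 : i + (m' : ZMod (l + 1)) = a := by
        by_contra hne
        exact h5 hne h
      apply ha1
      have := (h4 (m' - 1) (by omega)).2
      rw [Nat.cast_sub h1, Nat.cast_one, ← add_sub_assoc, h7] at this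
      exact this
    by_cases h8 : i - 1 = a
    · right
      have h9 : i = a + 1 := by rw [← h8, sub_add_cancel]
      refine ⟨h9, run_unique (l := l) (C := C) (a := a) ?_ ham, h1⟩
      rw [mem_components]
      have h10 : a + ((m' + 1 : ℕ) : ZMod (l + 1)) = i + (m' : ZMod (l + 1)) := by
        rw [h9]; push_cast; ring
      refine ⟨⟨by omega, ?_⟩, ha1, fun t ht => ?_, by rwa [h10]⟩
      · by_contra hlt
        have : m' = l := by omega
        subst this
        rw [h9, add_assoc, add_comm 1, natCast_self_add_one, add_zero] at h6
        exact h6 ha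
      · rcases t with _ | t
        · simpa using ha
        · have := (h4 t (by omega)).2
          rw [h9, add_assoc, add_comm 1] at this
          exact_mod_cast this
    · left
      rw [mem_components]
      refine ⟨⟨⟨h1, h2⟩, fun h => h8 ?_, fun t ht => (h4 t ht).2, h6⟩, ?_⟩
      · by_contra hne
        exact h3 hne h
      · have := (h4 0 h1).1
        simpa using this
  · rintro (⟨h, hia⟩ | ⟨rfl, hm', h1⟩)
    · rw [mem_components] at h ⊢
      obtain ⟨h0, h1, h2, h3⟩ := h
      refine ⟨h0, fun h => h1 (Finset.mem_of_mem_erase h), fun t ht => ?_,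
        fun h => h3 (Finset.mem_of_mem_erase h)⟩
      refine Finset.mem_erase.2 ⟨fun h => ?_, h2 t ht⟩
      have ht0 : 1 ≤ t := by
        rw [Nat.one_le_iff_ne_zero]
        rintro rfl
        simp at h
        exact hia h
      apply ha1
      have := h2 (t - 1) (by omega)
      rw [Nat.cast_sub ht0, Nat.cast_one, ← add_sub_assoc, h] at this
      exact this
    · rw [mem_components]
      refine ⟨⟨h1, by omega⟩, by simp, fun t ht => Finset.mem_erase.2 ⟨fun h => ?_, ?_⟩, ?_⟩
      · have h2 : a + ((t + 1 : ℕ) : ZMod (l + 1)) = a + ((0 : ℕ) : ZMod (l + 1)) := by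
          push_cast
          linear_combination h
        rw [add_natCast_inj l (by omega) (by omega)] at h2
        omega
      · have := hat (t + 1) (by omega)
        push_cast at this
        rwa [add_assoc, add_comm 1]
      · rw [← hm'] at hamC
        push_cast at hamC
        rw [add_assoc, add_comm 1]
        exact fun h => hamC (Finset.mem_of_mem_erase h)

theorem fRun_succ (a : ZMod (l + 1)) (m : ℕ) : fRun l a (m + 1) = f l a * fRun l (a + 1) m := by
  rw [fRun, List.range_succ_eq_map, List.map_cons, List.prod_cons, Nat.cast_zero, add_zero, fRun,
    List.map_map]
  congr 3
  funext t
  simp only [Function.comp_apply]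
  congr 1
  push_cast
  ring

/-- The starting point of a component can be split off on the left. -/
theorem fSet_eq_mul_erase (ha : a ∈ C) (ha1 : a - 1 ∉ C) :
    fSet l C = f l a * fSet l (C.erase a) := by
  obtain ⟨m, hm⟩ := exists_run ha ha1
  have hmem := mem_components_erase hm
  have hm0 := ((mem_components l).1 hm).1.1
  have e1 : fSet l C = fRun l a m * ((components l C).erase (a, m)).noncommProd
      (fun c => fRun l c.1 c.2) ((fRun_commute l C).mono (Finset.coe_subset.2 (Finset.erase_subset _ _))) :=
    (Finset.mul_noncommProd_erase _ hm _ _ _).symm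
  obtain ⟨m, rfl⟩ : ∃ m', m = m' + 1 := ⟨m - 1, by omega⟩
  have e3 : ∀ c : ZMod (l + 1) × ℕ, c ∈ (components l C).erase (a, m + 1) ↔
      c ∈ components l C ∧ c.1 ≠ a := by
    rintro ⟨i, m'⟩
    rw [Finset.mem_erase]
    constructor
    · rintro ⟨h1, h2⟩
      refine ⟨h2, fun h => h1 ?_⟩
      simp only at h
      subst h
      rw [run_unique h2 hm]
    · rintro ⟨h1, h2⟩
      exact ⟨fun h => h2 (congrArg Prod.fst h), h1⟩
  rw [e1, fRun_succ, mul_assoc]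
  congr 1
  rcases Nat.eq_zero_or_pos m with rfl | hm1
  · have e2 : components l (C.erase a) = (components l C).erase (a, 0 + 1) := by
      ext ⟨i, m'⟩
      rw [hmem, e3]
      constructor
      · rintro (h | h)
        · exact h
        · omega
      · exact Or.inl
    rw [fSet]
    simp only [e2]
    simp [fRun]
  · have e2 : components l (C.erase a) = insert (a + 1, m) ((components l C).erase (a, m + 1)) := by
      ext ⟨i, m'⟩
      rw [hmem, Finset.mem_insert, e3, Prod.mk.injEq, or_comm]
      constructor
      · rintro (⟨h1, h2, h3⟩ | h)
        · exact Or.inl ⟨h1, by omega⟩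
        · exact Or.inr h
      · rintro (⟨h1, h2⟩ | h)
        · exact Or.inl ⟨h1, by omega, by omega⟩
        · exact Or.inr h
    have e4 : (a + 1, m) ∉ (components l C).erase (a, m + 1) := by
      rw [e3]
      rintro ⟨h, -⟩
      have h2 := ((mem_components l).1 h).2.1
      rw [add_sub_cancel_right] at h2
      exact h2 ha
    rw [fSet]
    simp only [e2]
    exact (Finset.noncommProd_insert_of_notMem _ _ _ _ e4).symm

theorem fSet_empty : fSet l ∅ = 1 := by
  have : components l ∅ = ∅ := by
    ext ⟨i, m⟩
    rw [mem_components]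
    simp only [Finset.notMem_empty, iff_false]
    rintro ⟨h1, -, h2, -⟩
    exact h2 0 h1.1
  rw [fSet]
  simp only [this]
  rfl

theorem exists_start (h0 : C.Nonempty) (h1 : C ≠ Finset.univ) : ∃ a ∈ C, a - 1 ∉ C := by
  by_contra! h
  obtain ⟨a, ha⟩ := h0
  refine h1 (Finset.eq_univ_iff_forall.2 fun b => ?_)
  obtain ⟨p, -, hp⟩ := exists_offset l b a
  have : ∀ p : ℕ, a - (p : ZMod (l + 1)) ∈ C := by
    intro p
    induction p with
    | zero => simpa using ha
    | succ p ih =>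
      have := h _ ih
      push_cast
      rwa [← sub_sub]
  have := this p
  rwa [hp, add_sub_cancel_right] at this

theorem erase_ne_univ (C : Finset (ZMod (l + 1))) (a : ZMod (l + 1)) : C.erase a ≠ Finset.univ :=
  fun h => Finset.notMem_erase a C (h ▸ Finset.mem_univ a)

/-- The end point of a component can be split off on the right. -/
theorem fSet_eq_erase_mul (hl : 1 ≤ l) {b : ZMod (l + 1)} (hb : b ∈ C) (hb1 : b + 1 ∉ C) :
    fSet l C = fSet l (C.erase b) * f l b := by
  induction hn : C.card generalizing C with
  | zero => rw [Finset.card_eq_zero] at hn; simp [hn] at hb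
  | succ n ih =>
    have : Fact (1 < l + 1) := ⟨by omega⟩
    rcases (C.erase b).eq_empty_or_nonempty with he | he
    · have hb2 : b - 1 ∉ C := fun h => by
        have h2 : b - 1 ∈ C.erase b := Finset.mem_erase.2 ⟨by simp, h⟩
        rw [he] at h2
        simp at h2
      rw [fSet_eq_mul_erase hb hb2, he, fSet_empty, one_mul, mul_one]
    -- A starting point of `C ∖ {b}` is one of `C` as well, because `b + 1 ∉ C` rules out `a = b +
    -- 1`. It is split off on the left of both sides.
    · obtain ⟨a, ha, ha1⟩ := exists_start he (erase_ne_univ C b)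
      obtain ⟨hab, haC⟩ := Finset.mem_erase.1 ha
      have ha2 : a - 1 ∉ C := fun h => ha1 (Finset.mem_erase.2 ⟨fun h' => hb1 (by
        rwa [← h', sub_add_cancel]), h⟩)
      rw [fSet_eq_mul_erase haC ha2, fSet_eq_mul_erase ha ha1, mul_assoc]
      congr 1
      rw [ih (C := C.erase a) (Finset.mem_erase.2 ⟨hab.symm, hb⟩)
        (fun h => hb1 (Finset.mem_of_mem_erase h)) (by rw [Finset.card_erase_of_mem haC, hn]; rfl),
        Finset.erase_right_comm]

/-- The product `f_C` with the factor `f_b` removed; zero if there is no such factor. -/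
noncomputable def fRemove (C : Finset (ZMod (l + 1))) (b : ZMod (l + 1)) : K l :=
  if b ∈ C then fSet l (C.erase b) else 0

theorem fRemove_eq (ha : a ∈ C) (ha1 : a - 1 ∉ C) (b : ZMod (l + 1)) :
    fRemove C b = (if a = b then fSet l (C.erase a) else 0) + f l a * fRemove (C.erase a) b := by
  rw [fRemove, fRemove]
  by_cases hab : a = b
  · subst hab
    rw [if_pos ha, if_pos rfl, if_neg (Finset.notMem_erase _ _), mul_zero, add_zero]
  · rw [if_neg hab, zero_add]
    by_cases hb : b ∈ C
    · rw [if_pos hb, if_pos (Finset.mem_erase.2 ⟨Ne.symm hab, hb⟩),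
        fSet_eq_mul_erase (Finset.mem_erase.2 ⟨hab, ha⟩) (fun h => ha1 (Finset.mem_of_mem_erase h)),
        Finset.erase_right_comm]
    · rw [if_neg hb, if_neg (fun h => hb (Finset.mem_of_mem_erase h)), mul_zero]

/-- The commutator of `f_C` with `f_j`. -/
theorem fSet_commutator (hC : C ≠ Finset.univ) (j : ZMod (l + 1)) :
    fSet l C * f l j - f l j * fSet l C = h l * (fRemove C (j - 1) - fRemove C (j + 1)) := by
  -- The Leibniz rule for `f_C = f_a f_{C∖{a}}`. The whole circle is excluded because it has no
  -- components: its product takes the default value `1`, while removing a point leaves a genuine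
  -- product.
  induction hn : C.card generalizing C with
  | zero =>
    rw [Finset.card_eq_zero] at hn
    simp [hn, fSet_empty, fRemove]
  | succ n ih =>
    obtain ⟨a, ha, ha1⟩ := exists_start (Finset.card_pos.1 (by omega)) hC
    have ih' := ih (C := C.erase a) (erase_ne_univ C a)
      (by rw [Finset.card_erase_of_mem ha, hn]; rfl)
    have hu : (u l a j : K l) * fSet l (C.erase a) = (if a = j - 1 then fSet l (C.erase a) else 0) -
        (if a = j + 1 then fSet l (C.erase a) else 0) := by
      have h1 : j = a + 1 ↔ a = j - 1 := by rw [eq_sub_iff_add_eq, eq_comm]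
      have h2 : j = a - 1 ↔ a = j + 1 := by rw [eq_sub_iff_add_eq, eq_comm]
      simp only [u, h1, h2]
      push_cast
      rw [sub_mul, ite_mul, ite_mul, one_mul, zero_mul]
    rw [fRemove_eq ha ha1, fRemove_eq ha ha1, fSet_eq_mul_erase ha ha1]
    calc f l a * fSet l (C.erase a) * f l j - f l j * (f l a * fSet l (C.erase a))
        = f l a * (fSet l (C.erase a) * f l j - f l j * fSet l (C.erase a)) +
          (f l a * f l j - f l j * f l a) * fSet l (C.erase a) := by noncomm_ring
      _ = h l * (f l a * (fRemove (C.erase a) (j - 1) - fRemove (C.erase a) (j + 1))) +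
          h l * ((u l a j : K l) * fSet l (C.erase a)) := by
        rw [ih', ff, ← mul_assoc, ← (h_comm l (f l a)).eq, mul_assoc,
          (Int.cast_commute (u l a j) (h l)).eq, mul_assoc]
      _ = _ := by rw [hu]; noncomm_ring

theorem fSet_singleton (hl : 1 ≤ l) (a : ZMod (l + 1)) : fSet l {a} = f l a := by
  have : Fact (1 < l + 1) := ⟨by omega⟩
  rw [fSet_eq_mul_erase (Finset.mem_singleton_self a) (by simp)]
  simp [fSet_empty]

end Peel

end K

/-! ### Subsets with even gaps and the cancellation by sliding -/

namespace K

variable {l : ℕ} {C : Finset (ZMod (l + 1))} {a : ZMod (l + 1)}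

/-- The complement consists of the gaps between cyclically consecutive elements of `C`. Unrolling
the circle from a base point in `C` turns them into intervals between offsets `p < q`, where `q = l
+ 1` is the return to the base point. -/
theorem mem_components_compl (ha : a ∈ C) (c : ZMod (l + 1) × ℕ) :
    c ∈ components l Cᶜ ↔ ∃ p q : ℕ, p + 1 < q ∧ q ≤ l + 1 ∧ a + (p : ZMod (l + 1)) ∈ C ∧
      a + (q : ZMod (l + 1)) ∈ C ∧ (∀ r : ℕ, p < r → r < q → a + (r : ZMod (l + 1)) ∉ C) ∧
      c = (a + (p : ZMod (l + 1)) + 1, q - p - 1) := by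
  obtain ⟨i, m⟩ := c
  rw [mem_components]
  simp only [Finset.mem_compl, not_not]
  constructor
  · rintro ⟨⟨h1, h2⟩, h3, h4, h5⟩
    obtain ⟨p, hp, hip⟩ := exists_offset l a (i - 1)
    have hi : i = a + (p : ZMod (l + 1)) + 1 := by rw [← hip, sub_add_cancel]
    have hle : p + 1 + m ≤ l + 1 := by
      by_contra hlt
      refine h4 (l - p) (by omega) ?_
      rw [hi, Nat.cast_sub hp,
        show a + (p : ZMod (l + 1)) + 1 + ((l : ZMod (l + 1)) - p) = a by
          linear_combination natCast_self_add_one l]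
      exact ha
    refine ⟨p, p + 1 + m, by omega, hle, by rwa [← hip], ?_, fun r hr1 hr2 => ?_, ?_⟩
    · push_cast
      rwa [← add_assoc, ← add_assoc, ← hi]
    · have := h4 (r - (p + 1)) (by omega)
      rwa [Nat.cast_sub (by omega), hi, Nat.cast_add, Nat.cast_one,
        show a + (p : ZMod (l + 1)) + 1 + ((r : ZMod (l + 1)) - (p + 1)) = a + r by ring] at this
    · rw [hi]
      congr 1
      omega
  · rintro ⟨p, q, h1, h2, h3, h4, h5, h6⟩
    rw [Prod.mk.injEq] at h6
    obtain ⟨rfl, rfl⟩ := h6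
    refine ⟨⟨by omega, by omega⟩, by rwa [add_sub_cancel_right], fun t ht => ?_, ?_⟩
    · have := h5 (p + 1 + t) (by omega) (by omega)
      push_cast at this
      rwa [← add_assoc, ← add_assoc] at this
    · rwa [Nat.cast_sub (by omega), Nat.cast_sub (by omega), Nat.cast_one,
        show a + (p : ZMod (l + 1)) + 1 + ((q : ZMod (l + 1)) - p - 1) = a + q by ring]

theorem mem_S {d : ℕ} : C ∈ S l d ↔ C.card = d ∧ ∀ c ∈ components l Cᶜ, Even c.2 := by
  simp [S, Finset.mem_powersetCard]

/-- Length zero is allowed, although it is not a component, so that a gap may shrink to nothing in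
the sliding argument. -/
theorem even_of_gap {d : ℕ} (h : C ∈ S l d) {i : ZMod (l + 1)} {m : ℕ} (h1 : i - 1 ∈ C)
    (h2 : ∀ t < m, i + (t : ZMod (l + 1)) ∉ C) (h3 : i + (m : ZMod (l + 1)) ∈ C) (hm : m ≤ l) :
    Even m := by
  rcases Nat.eq_zero_or_pos m with rfl | hm0
  · simp
  · refine (mem_S.1 h).2 (i, m) ((mem_components l).2 ⟨⟨hm0, hm⟩, ?_, ?_, ?_⟩)
    · simpa using h1
    · simpa using h2
    · simpa using h3

/-- Moving an element of `C` two steps to the right, over an element not in `C`. -/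
theorem slide_right {d : ℕ} (h : C ∈ S l d) {j : ZMod (l + 1)} (h1 : j - 1 ∈ C) (h2 : j ∉ C)
    (hl : 2 ≤ l) : j + 1 ∉ C ∧ insert (j + 1) (C.erase (j - 1)) ∈ S l d := by
  have h3 : j + 1 ∉ C := fun h3 => by
    have := even_of_gap h (i := j) (m := 1) h1 (fun t ht => by
      rw [Nat.lt_one_iff.1 ht]; simpa using h2) (by simpa using h3) (by omega)
    simp at this
  have hne := add_one_ne_sub_one l hl j
  refine ⟨h3, mem_S.2 ⟨?_, ?_⟩⟩
  · rw [Finset.card_insert_of_notMem (by simp [h3]), Finset.card_erase_of_mem h1, (mem_S.1 h).1,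
      ← (mem_S.1 h).1]
    have := Finset.card_pos.2 ⟨_, h1⟩
    omega
  rintro ⟨i, m⟩ hc
  rw [mem_components] at hc
  simp only [Finset.mem_compl, not_not] at hc
  have hm : ∀ x, x ∈ insert (j + 1) (C.erase (j - 1)) ↔ x = j + 1 ∨ (x ≠ j - 1 ∧ x ∈ C) := by simp
  simp only [hm] at hc
  obtain ⟨⟨m1, ml⟩, c1, c2, c3⟩ := hc
  replace c2 : ∀ t < m, i + (t : ZMod (l + 1)) ≠ j + 1 ∧
      (i + (t : ZMod (l + 1)) ≠ j - 1 → i + (t : ZMod (l + 1)) ∉ C) :=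
    fun t ht => by simpa only [not_or, not_and] using c2 t ht
  -- The gap to the right of the moved element shrinks by two, the one to its left grows by two, all
  -- others persist. In each case the parity is read off from the corresponding gap of `C`.
  rcases c1 with c1 | ⟨c1, c1'⟩
  · -- the component starts at `j + 2`
    have hi : i = j + ((2 : ℕ) : ZMod (l + 1)) := by push_cast; linear_combination c1
    subst hi
    have ek : ∀ k : ℕ, j + ((2 : ℕ) : ZMod (l + 1)) + (k : ZMod (l + 1)) =
        j + ((k + 2 : ℕ) : ZMod (l + 1)) := by intro k; push_cast; ring
    have eJ : j - 1 = j + ((l : ℕ) : ZMod (l + 1)) := by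
      linear_combination - natCast_self_add_one l
    have hbefore : ∀ t < m + 2, t < l → j + (t : ZMod (l + 1)) ∉ C := by
      intro t ht htl
      rcases t with _ | _ | t
      · simpa using h2
      · simpa using h3
      · have := (c2 t (by omega)).2
        rw [ek] at this
        refine this ?_
        rw [eJ, Ne, add_natCast_inj l (by omega) le_rfl]
        show ¬ t + 2 = l
        omega
    by_cases hml : m + 2 ≤ l
    · have c4 : j + ((m + 2 : ℕ) : ZMod (l + 1)) ∈ C := by
        rw [ek] at c3
        rcases c3 with c3 | c3
        · exfalso
          rw [show j + 1 = j + ((1 : ℕ) : ZMod (l + 1)) by simp,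
            add_natCast_inj l (by omega) (by omega)] at c3
          omega
        · exact c3.2
      have := even_of_gap h (i := j) (m := m + 2) h1 (fun t ht => hbefore t ht (by omega)) c4 hml
      simpa [Nat.even_add] using this
    -- The gap goes round the circle. Either `C` has the single element `j - 1`, whose gap also has
    -- length `l`, or the gap would end at `j`, which does not belong to the new set.
    · have hm : m = l ∨ m + 1 = l := by omega
      rcases hm with rfl | rfl
      · refine even_of_gap h (i := j) (m := m) h1 (fun t ht => hbefore t (by omega) ht) ?_ le_rfl
        rwa [← eJ]
      · exfalso
        rw [ek, show j + ((m + 2 : ℕ) : ZMod (m + 1 + 1)) = j by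
          have := natCast_self_add_one (m + 1)
          push_cast at this ⊢
          linear_combination this] at c3
        rcases c3 with c3 | c3
        · exact self_ne_add_one _ hl j c3
        · exact h2 c3.2
  · by_cases c4 : i + (m : ZMod (l + 1)) = j + 1
    · have c5 : m ≠ 1 := by
        rintro rfl
        rw [Nat.cast_one, add_left_inj] at c4
        rw [c4] at c1
        exact c1 rfl
      obtain ⟨m, rfl⟩ : ∃ m', m = m' + 2 := ⟨m - 2, by omega⟩
      have eJ : j - 1 = i + (m : ZMod (l + 1)) := by
        push_cast at c4
        linear_combination - c4
      have := even_of_gap h (i := i) (m := m) c1' (fun t ht => ?_) (by rwa [← eJ]) (by omega)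
      · simpa [Nat.even_add] using this
      · refine (c2 t (by omega)).2 ?_
        rw [eJ, Ne, add_natCast_inj l (by omega) (by omega)]
        omega
    · have c5 := (c3.resolve_left c4).2
      refine even_of_gap h (i := i) (m := m) c1' (fun t ht hmem => ?_) c5 ml
      have c6 : i + (t : ZMod (l + 1)) = j - 1 := by
        by_contra hne'
        exact (c2 t ht).2 hne' hmem
      rcases Nat.lt_or_ge (t + 1) m with h5 | h5
      · rcases Nat.lt_or_ge (t + 2) m with h6 | h6
        · refine (c2 (t + 2) h6).1 ?_
          push_cast
          linear_combination c6
        · refine c4 ?_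
          rw [show m = t + 2 by omega]
          push_cast
          linear_combination c6
      · refine h2 ?_
        rw [show m = t + 1 by omega] at c5
        push_cast at c5
        rwa [← add_assoc, c6, sub_add_cancel] at c5

/-- The reflection `i ↦ -i` preserves the sets `S_d`. -/
theorem neg_mem_S {d : ℕ} (h : C ∈ S l d) : C.map (Equiv.neg _).toEmbedding ∈ S l d := by
  rw [mem_S, Finset.card_map]
  refine ⟨(mem_S.1 h).1, ?_⟩
  have hmem : ∀ x, x ∈ C.map (Equiv.neg (ZMod (l + 1))).toEmbedding ↔ -x ∈ C := by
    intro x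
    rw [Finset.mem_map_equiv]
    simp
  rintro ⟨i, m⟩ hc
  rw [mem_components] at hc
  simp only [Finset.mem_compl, not_not, hmem] at hc
  obtain ⟨⟨m1, ml⟩, c1, c2, c3⟩ := hc
  refine even_of_gap h (i := 1 - i - (m : ZMod (l + 1))) (m := m) ?_ (fun t ht => ?_) ?_ ml
  · rwa [show 1 - i - (m : ZMod (l + 1)) - 1 = -(i + m) by ring]
  · have := c2 (m - 1 - t) (by omega)
    rwa [Nat.cast_sub (by omega), Nat.cast_sub m1, Nat.cast_one,
      show -(i + ((m : ZMod (l + 1)) - 1 - t)) = 1 - i - m + t by ring] at this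
  · rwa [show 1 - i - (m : ZMod (l + 1)) + m = -(i - 1) by ring]

theorem slide_left {d : ℕ} (h : C ∈ S l d) {j : ZMod (l + 1)} (h1 : j + 1 ∈ C) (h2 : j ∉ C)
    (hl : 2 ≤ l) : j - 1 ∉ C ∧ insert (j - 1) (C.erase (j + 1)) ∈ S l d := by
  have hmem : ∀ (C : Finset (ZMod (l + 1))) x,
      x ∈ C.map (Equiv.neg (ZMod (l + 1))).toEmbedding ↔ -x ∈ C := by
    intro C x
    rw [Finset.mem_map_equiv]
    simp
  obtain ⟨h3, h4⟩ := slide_right (neg_mem_S h) (j := -j)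
    (by rw [hmem]; rwa [show -(-j - 1) = j + 1 by ring]) (by rw [hmem]; rwa [neg_neg]) hl
  rw [hmem, show -(-j + 1) = j - 1 by ring] at h3
  refine ⟨h3, ?_⟩
  convert neg_mem_S h4 using 1
  ext x
  rw [hmem]
  simp only [Finset.mem_insert, Finset.mem_erase, hmem, neg_neg]
  rw [show -x = -j + 1 ↔ x = j - 1 by constructor <;> intro h <;> linear_combination -h,
    show -x ≠ -j - 1 ↔ x ≠ j + 1 by
      rw [not_iff_not]; constructor <;> intro h <;> linear_combination -h]

/-- The part of the commutator of `∑ f_C` with `f_j` which does not cancel. -/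
noncomputable def fPairs (l d : ℕ) (j : ZMod (l + 1)) : K l :=
  ∑ C ∈ (S l d).filter fun C => j - 1 ∈ C ∧ j ∈ C, fSet l ((C.erase (j - 1)).erase j)

/-- If `j ∉ C`, moving `j - 1` to `j + 1` gives a bijection between the sets containing `j - 1` and
those containing `j + 1`, and removing the moved point leaves the same set; these terms cancel. If
`j ∈ C`, then `j` is the first element of a component of `C ∖ {j-1}` and the last of one of `C ∖
{j+1}`, so `f_j` splits off on the left or on the right. -/
theorem sum_fRemove_sub {d : ℕ} (hl : 2 ≤ l) (j : ZMod (l + 1)) :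
    ∑ C ∈ S l d, (fRemove C (j - 1) - fRemove C (j + 1)) =
      f l j * fPairs l d j - fPairs l d (j + 1) * f l j := by
  have hne1 := self_ne_add_one l hl j
  have hne3 := self_ne_add_one l hl (j - 1)
  rw [sub_add_cancel] at hne3
  have hne2 := add_one_ne_sub_one l hl j
  have split : ∀ b, ∑ C ∈ S l d, fRemove C b =
      ∑ C ∈ (S l d).filter (fun C => b ∈ C ∧ j ∈ C), fSet l (C.erase b) +
      ∑ C ∈ (S l d).filter (fun C => b ∈ C ∧ j ∉ C), fSet l (C.erase b) := by
    intro b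
    simp only [fRemove]
    rw [← Finset.sum_filter, ← Finset.sum_filter_add_sum_filter_not _ (fun C => j ∈ C),
      Finset.filter_filter, Finset.filter_filter]
  rw [Finset.sum_sub_distrib, split, split]
  have e1 : ∑ C ∈ (S l d).filter (fun C => j - 1 ∈ C ∧ j ∉ C), fSet l (C.erase (j - 1)) =
      ∑ C ∈ (S l d).filter (fun C => j + 1 ∈ C ∧ j ∉ C), fSet l (C.erase (j + 1)) := by
    refine Finset.sum_nbij' (fun C => insert (j + 1) (C.erase (j - 1)))
      (fun C => insert (j - 1) (C.erase (j + 1))) ?_ ?_ ?_ ?_ ?_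
    · intro C hC
      obtain ⟨hC, h1, h2⟩ := Finset.mem_filter.1 hC
      exact Finset.mem_filter.2 ⟨(slide_right hC h1 h2 hl).2, by simp [hne1, h2]⟩
    · intro C hC
      obtain ⟨hC, h1, h2⟩ := Finset.mem_filter.1 hC
      exact Finset.mem_filter.2 ⟨(slide_left hC h1 h2 hl).2, by simp [hne3.symm, h2]⟩
    · intro C hC
      obtain ⟨hC, h1, h2⟩ := Finset.mem_filter.1 hC
      have := (slide_right hC h1 h2 hl).1
      rw [Finset.erase_insert (by simp [this]), Finset.insert_erase h1]
    · intro C hC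
      obtain ⟨hC, h1, h2⟩ := Finset.mem_filter.1 hC
      have := (slide_left hC h1 h2 hl).1
      rw [Finset.erase_insert (by simp [this]), Finset.insert_erase h1]
    · intro C hC
      obtain ⟨hC, h1, h2⟩ := Finset.mem_filter.1 hC
      have := (slide_right hC h1 h2 hl).1
      rw [Finset.erase_insert (by simp [this])]
  rw [e1, add_sub_add_right_eq_sub, fPairs, fPairs, Finset.mul_sum, Finset.sum_mul]
  congr 1
  · refine Finset.sum_congr rfl fun C hC => ?_
    obtain ⟨hC, h1, h2⟩ := Finset.mem_filter.1 hC
    exact fSet_eq_mul_erase (Finset.mem_erase.2 ⟨hne3.symm, h2⟩) (Finset.notMem_erase _ _)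
  · rw [add_sub_cancel_right]
    refine Finset.sum_congr (Finset.filter_congr fun C _ => and_comm) fun C hC => ?_
    obtain ⟨hC, h1, h2⟩ := Finset.mem_filter.1 hC
    rw [fSet_eq_erase_mul (by omega) (Finset.mem_erase.2 ⟨hne1, h1⟩) (Finset.notMem_erase _ _),
      Finset.erase_right_comm]

/-- The condition on `d` excludes the whole circle, for which the commutator formula fails. This is
why the cubic part for `l = 2` and the quartic part for `l = 3` are treated separately. -/
theorem sum_fSet_commutator {d : ℕ} (hl : 2 ≤ l) (hd : d ≠ l + 1) (j : ZMod (l + 1)) :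
    (∑ C ∈ S l d, fSet l C) * f l j - f l j * ∑ C ∈ S l d, fSet l C =
      h l * (f l j * fPairs l d j - fPairs l d (j + 1) * f l j) := by
  rw [Finset.sum_mul, Finset.mul_sum, ← Finset.sum_sub_distrib, ← sum_fRemove_sub hl,
    Finset.mul_sum]
  refine Finset.sum_congr rfl fun C hC => fSet_commutator ?_ j
  rintro rfl
  have := (mem_S.1 hC).1
  rw [Finset.card_univ, ZMod.card] at this
  exact hd this.symm

end K

/-! ### Explicit description of `S_1`, `S_2` and of the pairs in `S_3`, `S_4` -/

namespace K

variable (l : ℕ)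

/-- The set of the `j + t` with `t ∈ T`. -/
def offsets (j : ZMod (l + 1)) (T : Finset ℕ) : Finset (ZMod (l + 1)) :=
  T.image fun t : ℕ => j + (t : ZMod (l + 1))

variable {l} {T : Finset ℕ} {j : ZMod (l + 1)}

theorem mem_offsets (hT : ∀ t ∈ T, t ≤ l) {t : ℕ} (ht : t ≤ l) :
    j + (t : ZMod (l + 1)) ∈ offsets l j T ↔ t ∈ T := by
  rw [offsets, Finset.mem_image]
  constructor
  · rintro ⟨s, hs, h⟩
    rwa [← (add_natCast_inj l (hT s hs) ht).1 h]
  · exact fun h => ⟨t, h, rfl⟩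

theorem self_mem_offsets (hT : ∀ t ∈ T, t ≤ l) : j ∈ offsets l j T ↔ 0 ∈ T := by
  rw [← mem_offsets hT (j := j) (Nat.zero_le l), Nat.cast_zero, add_zero]

theorem sub_one_eq_add_cast (j : ZMod (l + 1)) : j - 1 = j + (l : ZMod (l + 1)) := by
  linear_combination - natCast_self_add_one l

theorem add_cast_succ_self (j : ZMod (l + 1)) : j + ((l + 1 : ℕ) : ZMod (l + 1)) = j := by
  rw [ZMod.natCast_self, add_zero]

theorem sub_one_mem_offsets (hT : ∀ t ∈ T, t ≤ l) : j - 1 ∈ offsets l j T ↔ l ∈ T := by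
  rw [← mem_offsets hT (j := j) le_rfl, sub_one_eq_add_cast]

theorem card_offsets (hT : ∀ t ∈ T, t ≤ l) : (offsets l j T).card = T.card :=
  Finset.card_image_of_injOn fun s hs t ht h => (add_natCast_inj l (hT s hs) (hT t ht)).1 h

theorem exists_offsets (C : Finset (ZMod (l + 1))) (j : ZMod (l + 1)) :
    ∃ T : Finset ℕ, (∀ t ∈ T, t ≤ l) ∧ C = offsets l j T := by
  refine ⟨(Finset.range (l + 1)).filter fun t => j + (t : ZMod (l + 1)) ∈ C, fun t ht => ?_, ?_⟩
  · have := Finset.mem_range.1 (Finset.mem_filter.1 ht).1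
    omega
  · ext x
    obtain ⟨p, hp, rfl⟩ := exists_offset l j x
    rw [mem_offsets (fun t ht => ?_) hp, Finset.mem_filter, Finset.mem_range]
    · simp only [Nat.lt_succ_of_le hp, true_and]
    · have := Finset.mem_range.1 (Finset.mem_filter.1 ht).1
      omega

theorem offsets_inj {T' : Finset ℕ} (hT : ∀ t ∈ T, t ≤ l) (hT' : ∀ t ∈ T', t ≤ l)
    (h : offsets l j T = offsets l j T') : T = T' := by
  ext t
  constructor
  · intro ht
    rw [← mem_offsets hT' (hT t ht) (j := j), ← h, mem_offsets hT (hT t ht)]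
    exact ht
  · intro ht
    rw [← mem_offsets hT (hT' t ht) (j := j), h, mem_offsets hT' (hT' t ht)]
    exact ht

theorem mem_components_offsets (hT : ∀ t ∈ T, t ≤ l) (h0 : 0 ∈ T) (c : ZMod (l + 1) × ℕ) :
    c ∈ components l (offsets l j T)ᶜ ↔ ∃ p ∈ T, ∃ q : ℕ, p + 1 < q ∧ (q ∈ T ∨ q = l + 1) ∧
      (∀ r : ℕ, p < r → r < q → r ∉ T) ∧ c = (j + (p : ZMod (l + 1)) + 1, q - p - 1) := by
  rw [mem_components_compl ((self_mem_offsets hT).2 h0)]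
  constructor
  · rintro ⟨p, q, h1, h2, h3, h4, h5, h6⟩
    refine ⟨p, (mem_offsets hT (by omega)).1 h3, q, h1, ?_, fun r hr1 hr2 hr => ?_, h6⟩
    · rcases Nat.lt_or_ge l q with h | h
      · right; omega
      · exact Or.inl ((mem_offsets hT h).1 h4)
    · exact h5 r hr1 hr2 ((mem_offsets hT (by omega)).2 hr)
  · rintro ⟨p, h3, q, h1, h4, h5, h6⟩
    have hq : q ≤ l + 1 := by
      rcases h4 with h4 | h4
      · have := hT q h4
        omega
      · omega
    refine ⟨p, q, h1, hq, (mem_offsets hT (by omega)).2 h3, ?_, fun r hr1 hr2 hr => ?_, h6⟩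
    · rcases h4 with h4 | rfl
      · exact (mem_offsets hT (hT q h4)).2 h4
      · rw [add_cast_succ_self]
        exact (self_mem_offsets hT).2 h0
    · exact h5 r hr1 hr2 ((mem_offsets hT (by omega)).1 hr)

/-- An even gap is an odd difference between consecutive offsets. This formulation also covers
adjacent elements (difference one), and the last difference is taken to `l + 1`. -/
theorem offsets_mem_S {d : ℕ} (hT : ∀ t ∈ T, t ≤ l) (h0 : 0 ∈ T) :
    offsets l j T ∈ S l d ↔ T.card = d ∧ ∀ p ∈ T, ∀ q : ℕ, p < q → (q ∈ T ∨ q = l + 1) →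
      (∀ r : ℕ, p < r → r < q → r ∉ T) → Odd (q - p) := by
  rw [mem_S, card_offsets hT]
  refine and_congr_right fun _ => ⟨fun h p hp q hpq hq hr => ?_, fun h c hc => ?_⟩
  · rcases Nat.lt_or_ge (p + 1) q with h1 | h1
    · have := h _ ((mem_components_offsets hT h0 _).2 ⟨p, hp, q, h1, hq, hr, rfl⟩)
      rw [show q - p = q - p - 1 + 1 by omega]
      exact this.add_one
    · rw [show q - p = 1 by omega]
      exact odd_one
  · obtain ⟨p, hp, q, hpq, hq, hr, rfl⟩ := (mem_components_offsets hT h0 _).1 hc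
    have := h p hp q (by omega) hq hr
    rw [Nat.odd_iff] at this
    rw [Nat.even_iff]
    show (q - p - 1) % 2 = 0
    omega

theorem S_one (hl : Even l) : S l 1 = Finset.univ.image fun a : ZMod (l + 1) => {a} := by
  ext C
  rw [Finset.mem_image]
  constructor
  · intro hC
    obtain ⟨a, rfl⟩ := Finset.card_eq_one.1 (mem_S.1 hC).1
    exact ⟨a, Finset.mem_univ _, rfl⟩
  · rintro ⟨a, -, rfl⟩
    have e : offsets l a {0} = {a} := by simp [offsets]
    rw [← e, offsets_mem_S (by simp) (by simp)]
    refine ⟨rfl, fun p hp q hpq hq _ => ?_⟩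
    simp only [Finset.mem_singleton] at hp hq
    subst hp
    rw [Nat.even_iff] at hl
    rw [Nat.odd_iff]
    omega

theorem exists_offsets_of_mem_S {d : ℕ} {C : Finset (ZMod (l + 1))} (hC : C ∈ S l d) (hj : j ∈ C) :
    ∃ T : Finset ℕ, (∀ t ∈ T, t ≤ l) ∧ C = offsets l j T ∧ 0 ∈ T ∧ T.card = d ∧
      ∀ p ∈ T, ∀ q : ℕ, p < q → (q ∈ T ∨ q = l + 1) →
        (∀ r : ℕ, p < r → r < q → r ∉ T) → Odd (q - p) := by
  obtain ⟨T, hT, rfl⟩ := exists_offsets C j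
  have h0 := (self_mem_offsets hT).1 hj
  have := (offsets_mem_S hT h0).1 hC
  exact ⟨T, hT, rfl, h0, this.1, this.2⟩

theorem sum_S_two {n : ℕ} (hl : l = 2 * n + 1) {M : Type*} [AddCommMonoid M] (j : ZMod (l + 1))
    (F : Finset (ZMod (l + 1)) → M) :
    ∑ C ∈ (S l 2).filter (fun C => j ∈ C), F C =
      ∑ r ∈ Finset.range (n + 1), F (offsets l j {0, 2 * r + 1}) := by
  symm
  have hle : ∀ r ∈ Finset.range (n + 1), ∀ t ∈ ({0, 2 * r + 1} : Finset ℕ), t ≤ l := by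
    intro r hr t ht
    simp only [Finset.mem_range, Finset.mem_insert, Finset.mem_singleton] at hr ht
    omega
  refine Finset.sum_nbij (fun r => offsets l j {0, 2 * r + 1}) (fun r hr => ?_) (fun r hr s hs h => ?_)
    (fun C hC => ?_) fun _ _ => rfl
  · rw [Finset.mem_filter, self_mem_offsets (hle r hr), offsets_mem_S (hle r hr) (by simp)]
    refine ⟨⟨by simp, fun p hp q hpq hq hr' => ?_⟩, by simp⟩
    have h1 : ¬ (p < 2 * r + 1 ∧ 2 * r + 1 < q) := fun h => hr' _ h.1 h.2 (by simp)
    simp only [Finset.mem_range, Finset.mem_insert, Finset.mem_singleton] at hr hp hq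
    rw [Nat.odd_iff]
    omega
  · have := offsets_inj (hle r hr) (hle s hs) h
    have h2 : 2 * r + 1 ∈ ({0, 2 * s + 1} : Finset ℕ) := by rw [← this]; simp
    simp only [Finset.mem_insert, Finset.mem_singleton] at h2
    omega
  · obtain ⟨hC, hj⟩ := Finset.mem_filter.1 (Finset.mem_coe.1 hC)
    obtain ⟨T, hT, rfl, h0, hcard, hodd⟩ := exists_offsets_of_mem_S hC hj
    have h1 : (T.erase 0).card = 1 := by rw [Finset.card_erase_of_mem h0, hcard]
    obtain ⟨t, ht⟩ := Finset.card_eq_one.1 h1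
    obtain rfl : T = {0, t} := by rw [← ht, Finset.insert_erase h0]
    have ht0 : t ≠ 0 := by
      rintro rfl
      simp at hcard
    have h2 := hodd 0 (by simp) t (by omega) (by simp) fun r h1 h2 => by
      simp only [Finset.mem_insert, Finset.mem_singleton]
      omega
    obtain ⟨r, hr⟩ := h2
    have := hT t (by simp)
    refine ⟨r, ?_, ?_⟩
    · rw [Finset.mem_coe, Finset.mem_range]
      omega
    · show offsets l j {0, 2 * r + 1} = _
      rw [← hr, Nat.sub_zero]

/-- A three-element set containing `j` and `j - 1 = j + l` is fixed by one more offset `t`. Odd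
differences force `t = 2r + 1`, and `l - t` is then odd because `l` is even. -/
theorem fPairs_three {n : ℕ} (hl : l = 2 * n) (hn : 2 ≤ n) (j : ZMod (l + 1)) :
    fPairs l 3 j = fSum l (j + 1) n := by
  symm
  have hle : ∀ r ∈ Finset.range n, ∀ t ∈ ({0, 2 * r + 1, l} : Finset ℕ), t ≤ l := by
    intro r hr t ht
    simp only [Finset.mem_range, Finset.mem_insert, Finset.mem_singleton] at hr ht
    omega
  refine Finset.sum_nbij (fun r => offsets l j {0, 2 * r + 1, l}) (fun r hr => ?_)
    (fun r hr s hs h => ?_) (fun C hC => ?_) fun r hr => ?_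
  · rw [Finset.mem_filter, self_mem_offsets (hle r hr), sub_one_mem_offsets (hle r hr),
      offsets_mem_S (hle r hr) (by simp)]
    rw [Finset.mem_range] at hr
    refine ⟨⟨?_, fun p hp q hpq hq hr' => ?_⟩, by simp, by simp⟩
    · rw [Finset.card_eq_three]
      exact ⟨_, _, _, by omega, by omega, by omega, rfl⟩
    have h1 : ¬ (p < 2 * r + 1 ∧ 2 * r + 1 < q) := fun h => hr' _ h.1 h.2 (by simp)
    have h2 : ¬ (p < l ∧ l < q) := fun h => hr' _ h.1 h.2 (by simp)
    simp only [Finset.mem_insert, Finset.mem_singleton] at hp hq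
    rw [Nat.odd_iff]
    omega
  · have := offsets_inj (hle r hr) (hle s hs) h
    have h2 : 2 * r + 1 ∈ ({0, 2 * s + 1, l} : Finset ℕ) := by rw [← this]; simp
    simp only [Finset.mem_insert, Finset.mem_singleton] at h2
    omega
  · obtain ⟨hC, hj1, hj⟩ := Finset.mem_filter.1 (Finset.mem_coe.1 hC)
    obtain ⟨T, hT, rfl, h0, hcard, hodd⟩ := exists_offsets_of_mem_S hC hj
    rw [sub_one_mem_offsets hT] at hj1
    have hl0 : l ∈ T.erase 0 := Finset.mem_erase.2 ⟨by omega, hj1⟩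
    have h1 : ((T.erase 0).erase l).card = 1 := by
      rw [Finset.card_erase_of_mem hl0, Finset.card_erase_of_mem h0, hcard]
    obtain ⟨t, ht⟩ := Finset.card_eq_one.1 h1
    have htm : t ∈ (T.erase 0).erase l := by rw [ht]; simp
    simp only [Finset.mem_erase] at htm
    have hTe : T = {0, t, l} := by
      rw [Finset.pair_comm t l, ← ht, Finset.insert_erase hl0, Finset.insert_erase h0]
    have h2 := hodd 0 h0 t (by omega) (Or.inl htm.2.2) fun r h1 h2 => by
      rw [hTe]
      simp only [Finset.mem_insert, Finset.mem_singleton]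
      have := hT t htm.2.2
      omega
    obtain ⟨r, hr⟩ := h2
    have := hT t htm.2.2
    refine ⟨r, ?_, ?_⟩
    · rw [Finset.mem_coe, Finset.mem_range]
      omega
    · show offsets l j {0, 2 * r + 1, l} = _
      rw [← hr, Nat.sub_zero, hTe]
  · have hr' := Finset.mem_range.1 hr
    have e : ((offsets l j {0, 2 * r + 1, l}).erase (j - 1)).erase j =
        {j + ((2 * r + 1 : ℕ) : ZMod (l + 1))} := by
      ext x
      obtain ⟨p, hp, rfl⟩ := exists_offset l j x
      have e0 : j + (p : ZMod (l + 1)) = j ↔ p = 0 := by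
        have := add_natCast_inj l hp (Nat.zero_le l) (a := j)
        rwa [Nat.cast_zero, add_zero] at this
      rw [Finset.mem_erase, Finset.mem_erase, mem_offsets (hle r hr) hp, sub_one_eq_add_cast,
        Finset.mem_singleton, Ne, Ne, e0, add_natCast_inj l hp le_rfl,
        add_natCast_inj l hp (by omega)]
      simp only [Finset.mem_insert, Finset.mem_singleton]
      omega
    rw [e, fSet_singleton (by omega)]
    congr 1
    push_cast
    ring

/-- The excluded case is `p = 0`, `q = l`: there `j + q` precedes `j + p` on the circle, and the
ordered product has its factors the other way round. -/
theorem fSet_pair (hl : 2 ≤ l) {p q : ℕ} (hpq : p < q) (hq : q ≤ l) (h : q ≠ p + l) :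
    fSet l {j + (p : ZMod (l + 1)), j + (q : ZMod (l + 1))} =
      f l (j + (p : ZMod (l + 1))) * f l (j + (q : ZMod (l + 1))) := by
  have hne : j + (p : ZMod (l + 1)) ≠ j + (q : ZMod (l + 1)) := by
    rw [Ne, add_natCast_inj l (by omega) hq]
    omega
  rw [fSet_eq_mul_erase (a := j + (p : ZMod (l + 1))) (by simp) ?_,
    Finset.erase_insert (by simpa using hne), fSet_singleton (by omega)]
  intro hmem
  rw [Finset.mem_insert, Finset.mem_singleton] at hmem
  rcases hmem with hmem | hmem
  · exact self_ne_add_one l hl (j + (p : ZMod (l + 1)) - 1) (by rw [sub_add_cancel]; exact hmem)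
  · have h2 : j + (p : ZMod (l + 1)) = j + ((q + 1 : ℕ) : ZMod (l + 1)) := by
      push_cast
      linear_combination hmem
    rcases Nat.lt_or_ge q l with h3 | h3
    · rw [add_natCast_inj l (by omega) (by omega)] at h2
      omega
    · obtain rfl : q = l := by omega
      rw [add_cast_succ_self] at h2
      have h4 := (add_natCast_inj q (a := j) (p := p) (q := 0) (by omega) (by omega)).1 (by simpa using h2)
      omega

/-- Beside `0` and `l` there are two offsets `t < t'`. Odd differences make `t = 2r + 1` odd and `t'
= 2s + 2` even, and `t < t'` amounts to `r ≤ s`. -/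
theorem fPairs_four {n : ℕ} (hl : l = 2 * n + 1) (hn : 2 ≤ n) (j : ZMod (l + 1)) :
    fPairs l 4 j = fSumTwo l j n := by
  symm
  have hle : ∀ x ∈ (Finset.range n).sigma fun s => Finset.range (s + 1),
      ∀ t ∈ ({0, 2 * x.2 + 1, 2 * x.1 + 2, l} : Finset ℕ), t ≤ l := by
    intro x hx t ht
    simp only [Finset.mem_sigma, Finset.mem_range, Finset.mem_insert, Finset.mem_singleton] at hx ht
    omega
  simp only [fSumTwo, fSum, Finset.sum_mul]
  rw [Finset.sum_sigma']
  refine Finset.sum_nbij (fun x => offsets l j {0, 2 * x.2 + 1, 2 * x.1 + 2, l}) (fun x hx => ?_)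
    (fun x hx y hy h => ?_) (fun C hC => ?_) fun x hx => ?_
  · rw [Finset.mem_filter, self_mem_offsets (hle x hx), sub_one_mem_offsets (hle x hx),
      offsets_mem_S (hle x hx) (by simp)]
    simp only [Finset.mem_sigma, Finset.mem_range] at hx
    refine ⟨⟨?_, fun p hp q hpq hq hr' => ?_⟩, by simp, by simp⟩
    · rw [Finset.card_insert_of_notMem, Finset.card_eq_three.2 ⟨_, _, _, by omega, by omega, by omega, rfl⟩]
      simp only [Finset.mem_insert, Finset.mem_singleton]
      omega
    have h1 : ¬ (p < 2 * x.2 + 1 ∧ 2 * x.2 + 1 < q) := fun h => hr' _ h.1 h.2 (by simp)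
    have h2 : ¬ (p < 2 * x.1 + 2 ∧ 2 * x.1 + 2 < q) := fun h => hr' _ h.1 h.2 (by simp)
    have h3 : ¬ (p < l ∧ l < q) := fun h => hr' _ h.1 h.2 (by simp)
    simp only [Finset.mem_insert, Finset.mem_singleton] at hp hq
    rw [Nat.odd_iff]
    omega
  · have := offsets_inj (hle x hx) (hle y hy) h
    have h2 : 2 * x.2 + 1 ∈ ({0, 2 * y.2 + 1, 2 * y.1 + 2, l} : Finset ℕ) := by rw [← this]; simp
    have h3 : 2 * x.1 + 2 ∈ ({0, 2 * y.2 + 1, 2 * y.1 + 2, l} : Finset ℕ) := by rw [← this]; simp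
    simp only [Finset.mem_coe, Finset.mem_sigma, Finset.mem_range, Finset.mem_insert,
      Finset.mem_singleton] at h2 h3 hx hy
    obtain ⟨x1, x2⟩ := x
    obtain ⟨y1, y2⟩ := y
    simp only at h2 h3 hx hy
    obtain rfl : x1 = y1 := by omega
    obtain rfl : x2 = y2 := by omega
    rfl
  · obtain ⟨hC, hj1, hj⟩ := Finset.mem_filter.1 (Finset.mem_coe.1 hC)
    obtain ⟨T, hT, rfl, h0, hcard, hodd⟩ := exists_offsets_of_mem_S hC hj
    rw [sub_one_mem_offsets hT] at hj1
    have hl0 : l ∈ T.erase 0 := Finset.mem_erase.2 ⟨by omega, hj1⟩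
    have h1 : ((T.erase 0).erase l).card = 2 := by
      rw [Finset.card_erase_of_mem hl0, Finset.card_erase_of_mem h0, hcard]
    obtain ⟨t, t', htt, ht⟩ : ∃ t t', t < t' ∧ (T.erase 0).erase l = {t, t'} := by
      obtain ⟨t, t', hne, ht⟩ := Finset.card_eq_two.1 h1
      rcases lt_or_gt_of_ne hne with h | h
      · exact ⟨t, t', h, ht⟩
      · exact ⟨t', t, h, by rw [ht, Finset.pair_comm]⟩
    have htm : t ∈ (T.erase 0).erase l := by rw [ht]; simp
    have htm' : t' ∈ (T.erase 0).erase l := by rw [ht]; simp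
    simp only [Finset.mem_erase] at htm htm'
    have hTe : ∀ r, r ∈ T ↔ r = 0 ∨ r = t ∨ r = t' ∨ r = l := by
      intro r
      have : T = insert 0 (insert l {t, t'}) := by
        rw [← ht, Finset.insert_erase hl0, Finset.insert_erase h0]
      rw [this]
      simp only [Finset.mem_insert, Finset.mem_singleton]
      tauto
    have b1 := hT t htm.2.2
    have b2 := hT t' htm'.2.2
    have h2 := hodd 0 h0 t (by omega) (Or.inl htm.2.2) fun r h1 h2 => by
      rw [hTe]
      omega
    have h3 := hodd t htm.2.2 t' htt (Or.inl htm'.2.2) fun r h1 h2 => by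
      rw [hTe]
      omega
    rw [Nat.odd_iff] at h2 h3
    -- The solution of `t = 2r + 1`, `t' = 2s + 2`, listed as the pair of `s` and `r`.
    refine ⟨⟨t' / 2 - 1, t / 2⟩, ?_, ?_⟩
    · simp only [Finset.mem_coe, Finset.mem_sigma, Finset.mem_range]
      omega
    · show offsets l j {0, 2 * (t / 2) + 1, 2 * (t' / 2 - 1) + 2, l} = _
      congr 1
      ext r
      rw [hTe]
      simp only [Finset.mem_insert, Finset.mem_singleton]
      omega
  · have hx' := hx
    simp only [Finset.mem_sigma, Finset.mem_range] at hx'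
    have e : ((offsets l j {0, 2 * x.2 + 1, 2 * x.1 + 2, l}).erase (j - 1)).erase j =
        {j + ((2 * x.2 + 1 : ℕ) : ZMod (l + 1)), j + ((2 * x.1 + 2 : ℕ) : ZMod (l + 1))} := by
      ext y
      obtain ⟨p, hp, rfl⟩ := exists_offset l j y
      have e0 : j + (p : ZMod (l + 1)) = j ↔ p = 0 := by
        have := add_natCast_inj l hp (Nat.zero_le l) (a := j)
        rwa [Nat.cast_zero, add_zero] at this
      rw [Finset.mem_erase, Finset.mem_erase, mem_offsets (hle x hx) hp, sub_one_eq_add_cast,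
        Ne, Ne, e0, add_natCast_inj l hp le_rfl]
      simp only [Finset.mem_insert, Finset.mem_singleton]
      rw [add_natCast_inj l hp (by omega), add_natCast_inj l hp (by omega)]
      omega
    rw [e, fSet_pair (by omega) (by omega) (by omega) (by omega)]
    congr 2 <;> push_cast <;> ring

end K

/-! ### Fundamental weights and the part of `H₀` with the coefficients `χ` -/

namespace K

variable (l : ℕ)

/-- The formula for `ϖ_i` for a natural number `i`. -/
noncomputable def varpiNat (i : ℕ) : K l :=
  ∑ r ∈ Finset.Icc 1 l,
    (((min i r : ℕ) : ℂ) - (i : ℂ) * (r : ℂ) / ((l : ℂ) + 1)) • α l (r : ZMod (l + 1))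

/-- The range includes `l + 1`: there every coefficient is `r - r = 0`, in agreement with `ϖ_0 = 0`.
Second differences can thus be taken across the end of the range. -/
theorem varpi_natCast {i : ℕ} (hi : i ≤ l + 1) : varpi l (i : ZMod (l + 1)) = varpiNat l i := by
  rcases Nat.lt_or_ge l i with h | h
  · obtain rfl : i = l + 1 := by omega
    rw [varpi, varpiNat, ZMod.natCast_self, ZMod.val_zero]
    refine Finset.sum_congr rfl fun r hr => ?_
    have hr' := (Finset.mem_Icc.1 hr).2
    rw [Nat.zero_min, Nat.cast_zero, zero_mul, zero_div, sub_zero, Nat.min_eq_right (by omega),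
      Nat.cast_add, Nat.cast_one, mul_div_cancel_left₀ _ (Nat.cast_add_one_ne_zero l), sub_self]
  · rw [varpi, varpiNat, ZMod.val_natCast, Nat.mod_eq_of_lt (by omega)]

/-- The part linear in the index has no second difference, and `min i r`, as a function of `i`, has
a kink only at `i = r`. -/
theorem varpiNat_second_difference {v : ℕ} (hv : v + 1 ≤ l) :
    2 * varpiNat l (v + 1) - varpiNat l (v + 2) - varpiNat l v =
      α l ((v + 1 : ℕ) : ZMod (l + 1)) := by
  simp only [varpiNat]
  rw [two_mul, ← Finset.sum_add_distrib, ← Finset.sum_sub_distrib, ← Finset.sum_sub_distrib,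
    Finset.sum_eq_single (v + 1)]
  · rw [← add_smul, ← sub_smul, ← sub_smul]
    convert one_smul ℂ _ using 2
    rw [Nat.min_self, Nat.min_eq_right (by omega), Nat.min_eq_left (by omega)]
    push_cast
    ring
  · intro r _ hr
    rw [← add_smul, ← sub_smul, ← sub_smul]
    convert zero_smul ℂ _ using 2
    have h : ((min (v + 1) r : ℕ) : ℂ) + ((min (v + 1) r : ℕ) : ℂ) =
        ((min (v + 2) r : ℕ) : ℂ) + ((min v r : ℕ) : ℂ) := by
      norm_cast
      omega
    push_cast at h ⊢
    linear_combination h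
  · intro h
    exact absurd (Finset.mem_Icc.2 ⟨by omega, hv⟩) h

theorem k_eq_add : k l = α l 0 + ∑ r ∈ Finset.Icc 1 l, α l (r : ZMod (l + 1)) := by
  rw [k, sum_univ_eq_range l _ 0, Finset.sum_range_succ', Nat.cast_zero, add_zero, add_comm]
  congr 1
  rw [Finset.range_eq_Ico, Finset.sum_Ico_add' (fun r : ℕ => α l (0 + (r : ZMod (l + 1)))) 0 l 1]
  simp only [zero_add]
  rfl

/-- The second difference of the fundamental weights. -/
noncomputable def beta (j : ZMod (l + 1)) : K l := α l j - if j = 0 then k l else 0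

/-- Away from `0` this is the formula on natural numbers. At `0` it reads `-ϖ_1 - ϖ_l`, where the
coefficients of each `α_r` add up to `-1`; the sum is `α_0 - k`. -/
theorem varpi_second_difference (hl : 1 ≤ l) (j : ZMod (l + 1)) :
    2 * varpi l j - varpi l (j + 1) - varpi l (j - 1) = beta l j := by
  obtain ⟨v, hv, rfl⟩ := exists_offset l 0 j
  rw [zero_add]
  rcases v with _ | v
  · rw [Nat.cast_zero, show (0 : ZMod (l + 1)) - 1 = (l : ZMod (l + 1)) by
      linear_combination - natCast_self_add_one l, zero_add, beta, if_pos rfl, k_eq_add,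
      varpi_natCast l (by omega : l ≤ l + 1)]
    have h0 := varpi_natCast l (Nat.zero_le (l + 1))
    have h1 := varpi_natCast l (show 1 ≤ l + 1 by omega)
    rw [Nat.cast_zero] at h0
    rw [Nat.cast_one] at h1
    have h2 : varpiNat l 0 = 0 := Finset.sum_eq_zero fun r _ => by simp
    rw [h0, h1, h2, mul_zero, zero_sub, sub_add_cancel_left, ← neg_add', neg_inj, varpiNat, varpiNat,
      ← Finset.sum_add_distrib]
    refine Finset.sum_congr rfl fun r hr => ?_
    rw [Finset.mem_Icc] at hr
    rw [← add_smul]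
    convert one_smul ℂ _ using 2
    rw [Nat.min_eq_left hr.1, Nat.min_eq_right hr.2]
    have : (l : ℂ) + 1 ≠ 0 := Nat.cast_add_one_ne_zero l
    field_simp
    push_cast
    ring
  · have hne : ((v + 1 : ℕ) : ZMod (l + 1)) ≠ 0 := by
      intro h
      have := (add_natCast_inj l (a := 0) hv (Nat.zero_le l)).1 (by rw [h, Nat.cast_zero])
      omega
    rw [beta, if_neg hne, sub_zero, ← varpiNat_second_difference l hv,
      show ((v + 1 : ℕ) : ZMod (l + 1)) + 1 = ((v + 2 : ℕ) : ZMod (l + 1)) by push_cast; ring,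
      show ((v + 1 : ℕ) : ZMod (l + 1)) - 1 = (v : ZMod (l + 1)) by push_cast; ring,
      varpi_natCast l (by omega), varpi_natCast l (by omega), varpi_natCast l (by omega)]

theorem varpi_comm (i : ZMod (l + 1)) (x : K l) : Commute (varpi l i) x :=
  Commute.sum_left _ _ _ fun _ _ => (α_comm l _ x).smul_left _

theorem χ_comm (C : Finset (ZMod (l + 1))) (x : K l) : Commute (χ l C) x :=
  Commute.sum_left _ _ _ fun _ _ => Commute.sum_left _ _ _ fun t _ =>
    ((Commute.neg_one_left x).pow_left t).mul_left (varpi_comm l _ x)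

/-- The alternating sum of `2M` consecutive fundamental weights, starting with `ϖ_a`. -/
noncomputable def altSum (a : ZMod (l + 1)) (M : ℕ) : K l :=
  ∑ s ∈ Finset.range M, (varpi l (a + 2 * (s : ZMod (l + 1))) -
    varpi l (a + 1 + 2 * (s : ZMod (l + 1))))

theorem altSum_zero (a : ZMod (l + 1)) : altSum l a 0 = 0 := rfl

theorem altSum_succ (a : ZMod (l + 1)) (M : ℕ) :
    altSum l a (M + 1) = altSum l a M + (varpi l (a + 2 * (M : ZMod (l + 1))) -
      varpi l (a + 1 + 2 * (M : ZMod (l + 1)))) :=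
  Finset.sum_range_succ _ _

theorem altSum_succ' (a : ZMod (l + 1)) (M : ℕ) :
    altSum l a (M + 1) = varpi l a - varpi l (a + 1) + altSum l (a + 2) M := by
  rw [altSum, Finset.sum_range_succ', add_comm, Nat.cast_zero, mul_zero, add_zero, add_zero, altSum]
  congr 1
  refine Finset.sum_congr rfl fun s _ => ?_
  congr 2 <;> push_cast <;> ring

theorem sum_neg_one_pow_varpi (a : ZMod (l + 1)) (M : ℕ) :
    ∑ t ∈ Finset.range (2 * M), (-1) ^ t * varpi l (a + (t : ZMod (l + 1))) = altSum l a M := by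
  rw [sum_range_two_mul, ← Finset.sum_add_distrib, altSum]
  refine Finset.sum_congr rfl fun s _ => ?_
  rw [pow_succ, pow_mul, neg_one_sq, one_pow, one_mul, one_mul, neg_one_mul, ← sub_eq_add_neg]
  congr 2 <;> push_cast <;> ring

theorem altSum_sub_altSum (hl : 1 ≤ l) (a : ZMod (l + 1)) (M : ℕ) :
    altSum l (a + 1) M - altSum l a M =
      ∑ s ∈ Finset.range M, beta l (a + 1 + 2 * (s : ZMod (l + 1))) := by
  rw [altSum, altSum, ← Finset.sum_sub_distrib]
  refine Finset.sum_congr rfl fun s _ => ?_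
  rw [← varpi_second_difference l hl, show a + 1 + 2 * (s : ZMod (l + 1)) - 1 = a + 2 * s by ring,
    show a + 1 + 1 + 2 * (s : ZMod (l + 1)) = a + 1 + 2 * s + 1 by ring]
  noncomm_ring

variable {l}

theorem χ_compl_singleton {n : ℕ} (hn : 1 ≤ n) (hl : l = 2 * n) (a : ZMod (l + 1)) :
    χ l {a}ᶜ = altSum l (a + 1) n := by
  have e : components l {a}ᶜ = {(a + 1, l)} := by
    have e : offsets l a {0} = {a} := by simp [offsets]
    ext c
    rw [← e, mem_components_offsets (by simp) (by simp), Finset.mem_singleton]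
    constructor
    · rintro ⟨p, hp, q, hpq, hq, -, rfl⟩
      rw [Finset.mem_singleton] at hp hq
      subst hp
      obtain rfl : q = l + 1 := by omega
      simp
    · rintro rfl
      exact ⟨0, by simp, l + 1, by omega, by simp, fun r h1 _ => by simp; omega, by simp⟩
  rw [χ, e, Finset.sum_singleton, ← sum_neg_one_pow_varpi, ← hl]

theorem χ_compl_offsets {n r : ℕ} (hl : l = 2 * n + 1) (hr : r ≤ n) (a : ZMod (l + 1)) :
    χ l (offsets l a {0, 2 * r + 1})ᶜ =
      altSum l (a + 1) r + altSum l (a + 2 + 2 * (r : ZMod (l + 1))) (n - r) := by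
  have hT : ∀ t ∈ ({0, 2 * r + 1} : Finset ℕ), t ≤ l := by
    intro t ht
    rw [Finset.mem_insert, Finset.mem_singleton] at ht
    omega
  -- One of the two gaps is empty for `r = 0` or `r = n` and is then not a component. The filter
  -- discards it, harmlessly for the sum.
  have e : components l (offsets l a {0, 2 * r + 1})ᶜ =
      ({(a + 1, 2 * r), (a + 2 + 2 * (r : ZMod (l + 1)), 2 * (n - r))} :
        Finset (ZMod (l + 1) × ℕ)).filter fun c => c.2 ≠ 0 := by
    ext c
    rw [mem_components_offsets hT (by simp), Finset.mem_filter, Finset.mem_insert,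
      Finset.mem_singleton]
    constructor
    · rintro ⟨p, hp, q, hpq, hq, hpq', rfl⟩
      refine ⟨?_, by show q - p - 1 ≠ 0; omega⟩
      have h1 : ¬ (p < 2 * r + 1 ∧ 2 * r + 1 < q) := fun h => hpq' _ h.1 h.2 (by simp)
      rw [Finset.mem_insert, Finset.mem_singleton] at hp hq
      rcases hp with rfl | rfl
      · left
        rw [Nat.cast_zero, add_zero]
        congr 1
        omega
      · right
        obtain rfl : q = l + 1 := by omega
        congr 1
        · push_cast
          ring
        · omega
    · rintro ⟨rfl | rfl, hc⟩
      · replace hc : 2 * r ≠ 0 := hc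
        refine ⟨0, by simp, 2 * r + 1, by omega, by simp, fun t h1 h2 => ?_, by simp⟩
        rw [Finset.mem_insert, Finset.mem_singleton]
        omega
      · replace hc : 2 * (n - r) ≠ 0 := hc
        refine ⟨2 * r + 1, by simp, l + 1, by omega, by simp, fun t h1 h2 => ?_, ?_⟩
        · rw [Finset.mem_insert, Finset.mem_singleton]
          omega
        · congr 1
          · push_cast
            ring
          · omega
  rw [χ, e, Finset.sum_filter_of_ne, Finset.sum_pair, sum_neg_one_pow_varpi, sum_neg_one_pow_varpi]
  · intro h
    have h1 := congrArg Prod.fst h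
    have h2 : a + ((1 : ℕ) : ZMod (l + 1)) = a + ((2 * r + 2 : ℕ) : ZMod (l + 1)) := by
      push_cast
      linear_combination h1
    rcases Nat.lt_or_ge r n with h3 | h3
    · rw [add_natCast_inj l (by omega) (by omega)] at h2
      omega
    · rw [show 2 * r + 2 = l + 1 by omega, add_cast_succ_self] at h2
      have := (add_natCast_inj l (a := a) (p := 1) (q := 0) (by omega) (by omega)).1 (by simpa using h2)
      omega
  · rintro c - hc h0
    rw [h0, Finset.range_zero, Finset.sum_empty] at hc
    exact hc rfl

theorem sum_χ_fRemove_one {n : ℕ} (hn : 1 ≤ n) (hl : l = 2 * n) (b : ZMod (l + 1)) :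
    ∑ C ∈ S l 1, χ l Cᶜ * fRemove C b = altSum l (b + 1) n := by
  rw [S_one (by rw [hl]; exact even_two_mul n), Finset.sum_image fun a _ b _ => Finset.singleton_inj.1,
    Finset.sum_eq_single b]
  · rw [χ_compl_singleton hn hl, fRemove, if_pos (Finset.mem_singleton_self b), Finset.erase_singleton,
      fSet_empty, mul_one]
  · intro a _ ha
    rw [fRemove, if_neg (by simpa using ha.symm), mul_zero]
  · simp

theorem sum_χ_fRemove_two {n : ℕ} (hl : l = 2 * n + 1) (b : ZMod (l + 1)) :
    ∑ C ∈ S l 2, χ l Cᶜ * fRemove C b = ∑ r ∈ Finset.range (n + 1),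
      (altSum l (b + 1) r + altSum l (b + 2 + 2 * (r : ZMod (l + 1))) (n - r)) *
        f l (b + 1 + 2 * (r : ZMod (l + 1))) := by
  have e : ∀ C, χ l Cᶜ * fRemove C b = if b ∈ C then χ l Cᶜ * fSet l (C.erase b) else 0 := by
    intro C
    rw [fRemove, mul_ite, mul_zero]
  simp only [e]
  rw [← Finset.sum_filter, sum_S_two hl]
  refine Finset.sum_congr rfl fun r hr => ?_
  rw [Finset.mem_range] at hr
  rw [χ_compl_offsets hl (by omega)]
  congr 1
  have e2 : (offsets l b {0, 2 * r + 1}).erase b = {b + ((2 * r + 1 : ℕ) : ZMod (l + 1))} := by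
    rw [offsets, Finset.image_insert, Finset.image_singleton, Nat.cast_zero, add_zero,
      Finset.erase_insert]
    rw [Finset.mem_singleton]
    intro h
    have := (add_natCast_inj l (a := b) (p := 0) (q := 2 * r + 1) (by omega) (by omega)).1
      (by simpa using h)
    omega
  rw [e2, fSet_singleton (by omega)]
  congr 1
  push_cast
  ring

theorem sum_χ_commutator {d : ℕ} (hd : d ≠ l + 1) (j : ZMod (l + 1)) :
    (∑ C ∈ S l d, χ l Cᶜ * fSet l C) * f l j - f l j * ∑ C ∈ S l d, χ l Cᶜ * fSet l C =
      h l * (∑ C ∈ S l d, χ l Cᶜ * fRemove C (j - 1) - ∑ C ∈ S l d, χ l Cᶜ * fRemove C (j + 1)) := by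
  rw [Finset.sum_mul, Finset.mul_sum, ← Finset.sum_sub_distrib, ← Finset.sum_sub_distrib,
    Finset.mul_sum]
  refine Finset.sum_congr rfl fun C hC => ?_
  have hne : C ≠ Finset.univ := by
    rintro rfl
    have := (mem_S.1 hC).1
    rw [Finset.card_univ, ZMod.card] at this
    exact hd this.symm
  rw [← mul_sub, ← mul_assoc (f l j), ← (χ_comm l Cᶜ (f l j)).eq, mul_assoc, mul_assoc, ← mul_sub,
    fSet_commutator hne, ← mul_assoc, (χ_comm l Cᶜ (h l)).eq, mul_assoc]

/-- The alternating sums starting at `ϖ_j` and at `ϖ_{j+2}` share all but their outer terms; what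
remains is `ϖ_j - ϖ_{j+1}` minus `ϖ_{j-1} - ϖ_j`. -/
theorem sum_χ_fRemove_one_sub {n : ℕ} (hn : 1 ≤ n) (hl : l = 2 * n) (j : ZMod (l + 1)) :
    ∑ C ∈ S l 1, χ l Cᶜ * fRemove C (j - 1) - ∑ C ∈ S l 1, χ l Cᶜ * fRemove C (j + 1) =
      beta l j := by
  rw [sum_χ_fRemove_one hn hl, sum_χ_fRemove_one hn hl]
  obtain ⟨m, rfl⟩ : ∃ m, n = m + 1 := ⟨n - 1, by omega⟩
  have h0 := natCast_self_add_one l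
  have hl' : (l : ZMod (l + 1)) = 2 * (m : ZMod (l + 1)) + 2 := by
    have := congrArg (Nat.cast : ℕ → ZMod (l + 1)) hl
    push_cast at this
    linear_combination this
  rw [altSum_succ', altSum_succ, ← varpi_second_difference l (by omega),
    show j - 1 + 1 = j by ring, show j + 1 + 1 = j + 2 by ring,
    show j + 2 + 2 * (m : ZMod (l + 1)) = j - 1 by linear_combination h0 - hl',
    show j + 2 + 1 + 2 * (m : ZMod (l + 1)) = j by linear_combination h0 - hl']
  noncomm_ring

/-- Compare coefficients of the `f_{j+2r}`. For `1 ≤ r ≤ n` the same telescoping as for even `l`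
leaves `β_j`, the second difference at `j`. For `f_j` itself one gets two alternating sums of length
`2n` shifted by one, whose difference is `-(β_{j+2} + ⋯ + β_{j+2n})`; writing it as `β_j` minus the
sum over the full parity class gives the stated form. -/
theorem sum_χ_fRemove_two_sub {n : ℕ} (hl : l = 2 * n + 1) (j : ZMod (l + 1)) :
    ∑ C ∈ S l 2, χ l Cᶜ * fRemove C (j - 1) - ∑ C ∈ S l 2, χ l Cᶜ * fRemove C (j + 1) =
      beta l j * fSum l j (n + 1) -
        (∑ s ∈ Finset.range (n + 1), beta l (j + 2 * (s : ZMod (l + 1)))) * f l j := by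
  have h0 := two_mul_cast_eq_zero hl
  push_cast at h0
  rw [sum_χ_fRemove_two hl, sum_χ_fRemove_two hl, Finset.sum_range_succ', Finset.sum_range_succ _ n,
    altSum_zero, Nat.sub_self, altSum_zero, zero_add, add_zero, Nat.sub_zero, Nat.cast_zero, mul_zero,
    add_zero, add_zero, show j - 1 + 1 = j by ring, show j - 1 + 2 = j + 1 by ring,
    show j + 1 + 1 = j + 2 by ring, show j + 2 + 2 * (n : ZMod (l + 1)) = j by linear_combination h0,
    fSum_succ', mul_add, Finset.sum_range_succ' _ n, Nat.cast_zero, mul_zero, add_zero]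
  have e1 : ∑ r ∈ Finset.range n, (altSum l j (r + 1) +
        altSum l (j + 1 + 2 * ((r + 1 : ℕ) : ZMod (l + 1))) (n - (r + 1))) *
        f l (j + 2 * ((r + 1 : ℕ) : ZMod (l + 1))) =
      ∑ r ∈ Finset.range n, (altSum l (j + 2) r +
        altSum l (j + 1 + 2 + 2 * (r : ZMod (l + 1))) (n - r)) *
        f l (j + 2 + 2 * (r : ZMod (l + 1))) + beta l j * fSum l (j + 2) n := by
    rw [fSum, Finset.mul_sum, ← Finset.sum_add_distrib]
    refine Finset.sum_congr rfl fun r hr => ?_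
    rw [Finset.mem_range] at hr
    obtain ⟨m, rfl⟩ : ∃ m, n = r + 1 + m := ⟨n - (r + 1), by omega⟩
    push_cast at h0
    rw [show r + 1 + m - (r + 1) = m by omega, show r + 1 + m - r = m + 1 by omega, altSum_succ',
      altSum_succ, ← varpi_second_difference l (by omega),
      show j + 1 + 2 * ((r + 1 : ℕ) : ZMod (l + 1)) = j + 1 + 2 + 2 * (r : ZMod (l + 1)) by
        push_cast; ring,
      show j + 2 * ((r + 1 : ℕ) : ZMod (l + 1)) = j + 2 + 2 * (r : ZMod (l + 1)) by
        push_cast; ring,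
      show j + 1 + 2 + 2 * (r : ZMod (l + 1)) + 2 * (m : ZMod (l + 1)) = j - 1 by
        linear_combination h0,
      show j + 1 + 2 + 2 * (r : ZMod (l + 1)) + 1 + 2 * (m : ZMod (l + 1)) = j by
        linear_combination h0]
    noncomm_ring
  have e2 : altSum l (j + 2) n - altSum l (j + 1) n =
      ∑ s ∈ Finset.range n, beta l (j + 2 * ((s + 1 : ℕ) : ZMod (l + 1))) := by
    have := altSum_sub_altSum l (by omega) (j + 1) n
    rw [add_assoc, one_add_one_eq_two] at this
    rw [this]
    refine Finset.sum_congr rfl fun s _ => ?_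
    congr 1
    push_cast
    ring
  rw [e1, ← e2]
  noncomm_ring

/-! ### Commutators of the Hamiltonian with the generators -/

theorem commutator_three_of_rel {R : Type} [Ring R] {a b c h : R} (hba : b * a = a * b - h)
    (hcb : c * b = b * c - h) (hca : c * a = a * c + h) (ha : a * h = h * a) (hb : b * h = h * b)
    (hc : c * h = h * c) :
    ((a * b * c + h * b) * a - a * (a * b * c + h * b) = h * (a * b - c * a)) ∧
    ((a * b * c + h * b) * b - b * (a * b * c + h * b) = h * (b * c - a * b)) ∧
    ((a * b * c + h * b) * c - c * (a * b * c + h * b) = h * (c * a - b * c)) := by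
  have hba' : ∀ x, b * (a * x) = a * (b * x) - h * x := fun x => by
    rw [← mul_assoc, hba, sub_mul, mul_assoc]
  have hcb' : ∀ x, c * (b * x) = b * (c * x) - h * x := fun x => by
    rw [← mul_assoc, hcb, sub_mul, mul_assoc]
  have hca' : ∀ x, c * (a * x) = a * (c * x) + h * x := fun x => by
    rw [← mul_assoc, hca, add_mul, mul_assoc]
  have ha' : ∀ x, a * (h * x) = h * (a * x) := fun x => by rw [← mul_assoc, ha, mul_assoc]
  have hb' : ∀ x, b * (h * x) = h * (b * x) := fun x => by rw [← mul_assoc, hb, mul_assoc]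
  have hc' : ∀ x, c * (h * x) = h * (c * x) := fun x => by rw [← mul_assoc, hc, mul_assoc]
  refine ⟨?_, ?_, ?_⟩ <;>
  · simp only [mul_assoc, add_mul, mul_add, mul_sub, hba, hcb, hca, hb, hba', hcb', hca', ha', hb',
      hc']
    abel

/-- As for three generators, the correction term makes the element invariant under cyclic rotation:
`bcda = abcd - hcd + hbc`, so `abcd + hbc = bcda + hcd`. The identities are checked by bringing all
words into the order `a, b, c, d`. -/
theorem commutator_four_of_rel {R : Type} [Ring R] {a b c d h : R} (hba : b * a = a * b - h)
    (hcb : c * b = b * c - h) (hdc : d * c = c * d - h) (hda : d * a = a * d + h)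
    (hca : c * a = a * c) (hdb : d * b = b * d) (ha : a * h = h * a) (hb : b * h = h * b)
    (hc : c * h = h * c) (hd : d * h = h * d) :
    ((a * b * c * d + h * b * c) * a - a * (a * b * c * d + h * b * c) =
      h * (a * (b * c) - c * d * a)) ∧
    ((a * b * c * d + h * b * c) * b - b * (a * b * c * d + h * b * c) =
      h * (b * (c * d) - d * a * b)) ∧
    ((a * b * c * d + h * b * c) * c - c * (a * b * c * d + h * b * c) =
      h * (c * (d * a) - a * b * c)) ∧
    ((a * b * c * d + h * b * c) * d - d * (a * b * c * d + h * b * c) =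
      h * (d * (a * b) - b * c * d)) := by
  have hba' : ∀ x, b * (a * x) = a * (b * x) - h * x := fun x => by
    rw [← mul_assoc, hba, sub_mul, mul_assoc]
  have hcb' : ∀ x, c * (b * x) = b * (c * x) - h * x := fun x => by
    rw [← mul_assoc, hcb, sub_mul, mul_assoc]
  have hdc' : ∀ x, d * (c * x) = c * (d * x) - h * x := fun x => by
    rw [← mul_assoc, hdc, sub_mul, mul_assoc]
  have hda' : ∀ x, d * (a * x) = a * (d * x) + h * x := fun x => by
    rw [← mul_assoc, hda, add_mul, mul_assoc]
  have hca' : ∀ x, c * (a * x) = a * (c * x) := fun x => by rw [← mul_assoc, hca, mul_assoc]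
  have hdb' : ∀ x, d * (b * x) = b * (d * x) := fun x => by rw [← mul_assoc, hdb, mul_assoc]
  have ha' : ∀ x, a * (h * x) = h * (a * x) := fun x => by rw [← mul_assoc, ha, mul_assoc]
  have hb' : ∀ x, b * (h * x) = h * (b * x) := fun x => by rw [← mul_assoc, hb, mul_assoc]
  have hc' : ∀ x, c * (h * x) = h * (c * x) := fun x => by rw [← mul_assoc, hc, mul_assoc]
  have hd' : ∀ x, d * (h * x) = h * (d * x) := fun x => by rw [← mul_assoc, hd, mul_assoc]
  refine ⟨?_, ?_, ?_, ?_⟩ <;>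
  · simp only [mul_assoc, add_mul, mul_add, mul_sub, hcb, hdc, hda, hca, hdb, hb, hc, hba', hcb', hdc', hda', hca', hdb', ha', hb', hc', hd']
    abel

theorem f_succ_mul (hl : 2 ≤ l) (i : ZMod (l + 1)) :
    f l (i + 1) * f l i = f l i * f l (i + 1) - h l := by
  have := ff l i (i + 1)
  rw [u_add_one l hl, Int.cast_one, one_mul] at this
  rw [← this, sub_sub_cancel]

theorem commutator_three (hl : l = 2) (j : ZMod (l + 1)) :
    (f l 0 * f l 1 * f l 2 + h l * f l 1) * f l j - f l j * (f l 0 * f l 1 * f l 2 + h l * f l 1) =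
      h l * (f l j * f l (j + 1) - f l (j + 2) * f l j) := by
  subst hl
  have h1 := f_succ_mul (l := 2) le_rfl 0
  have h2 := f_succ_mul (l := 2) le_rfl 1
  have h3 := f_succ_mul (l := 2) le_rfl 2
  rw [show (0 : ZMod 3) + 1 = 1 by decide] at h1
  rw [show (1 : ZMod 3) + 1 = 2 by decide] at h2
  rw [show (2 : ZMod 3) + 1 = 0 by decide, eq_sub_iff_add_eq, eq_comm] at h3
  have key := commutator_three_of_rel h1 h2 h3 (h_comm 2 _).eq.symm (h_comm 2 _).eq.symm
    (h_comm 2 _).eq.symm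
  obtain rfl | rfl | rfl : j = 0 ∨ j = 1 ∨ j = 2 := by revert j; decide
  exacts [key.1, key.2.1, key.2.2]

theorem commutator_four (hl : l = 3) (j : ZMod (l + 1)) :
    (f l 0 * f l 1 * f l 2 * f l 3 + h l * f l 1 * f l 2) * f l j -
        f l j * (f l 0 * f l 1 * f l 2 * f l 3 + h l * f l 1 * f l 2) =
      h l * (f l j * (f l (j + 1) * f l (j + 2)) - f l (j + 2) * f l (j + 3) * f l j) := by
  subst hl
  have h1 := f_succ_mul (l := 3) (by omega) 0
  have h2 := f_succ_mul (l := 3) (by omega) 1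
  have h3 := f_succ_mul (l := 3) (by omega) 2
  have h4 := f_succ_mul (l := 3) (by omega) 3
  rw [show (0 : ZMod 4) + 1 = 1 by decide] at h1
  rw [show (1 : ZMod 4) + 1 = 2 by decide] at h2
  rw [show (2 : ZMod 4) + 1 = 3 by decide] at h3
  rw [show (3 : ZMod 4) + 1 = 0 by decide, eq_sub_iff_add_eq, eq_comm] at h4
  have key := commutator_four_of_rel h1 h2 h3 h4
    (f_commute 3 (show (0 : ZMod 4) ≠ 2 + 1 by decide) (show (2 : ZMod 4) ≠ 0 + 1 by decide)).eq
    (f_commute 3 (show (1 : ZMod 4) ≠ 3 + 1 by decide) (show (3 : ZMod 4) ≠ 1 + 1 by decide)).eq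
    (h_comm 3 _).eq.symm (h_comm 3 _).eq.symm (h_comm 3 _).eq.symm (h_comm 3 _).eq.symm
  obtain rfl | rfl | rfl | rfl : j = 0 ∨ j = 1 ∨ j = 2 ∨ j = 3 := by revert j; decide
  exacts [key.1, key.2.1, key.2.2.1, key.2.2.2]

theorem commutator_H₀_even {n : ℕ} (hn : 1 ≤ n) (hl : l = 2 * n) (j : ZMod (l + 1)) :
    H₀ l * f l j - f l j * H₀ l =
      h l * (f l j * fSum l (j + 1) n - fSum l (j + 2) n * f l j + beta l j) := by
  have key := sum_χ_commutator (l := l) (d := 1) (by omega) j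
  rw [sum_χ_fRemove_one_sub hn hl] at key
  rw [H₀, if_pos (by rw [hl]; exact even_two_mul n), mul_add (h l), ← key, add_mul, mul_add,
    add_sub_add_comm]
  congr 1
  split_ifs with h2
  · obtain rfl : n = 1 := by omega
    rw [commutator_three h2]
    simp [fSum]
  · rw [sum_fSet_commutator (by omega) (by omega), fPairs_three hl (by omega),
      fPairs_three hl (by omega), add_assoc, one_add_one_eq_two]

/-- The square of the alternating sum of weights is central and does not contribute. The quartic
part gives the `P`-terms, the part with `χ` the rest. -/
theorem commutator_H₀_odd {n : ℕ} (hn : 1 ≤ n) (hl : l = 2 * n + 1) (j : ZMod (l + 1)) :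
    H₀ l * f l j - f l j * H₀ l =
      h l * (f l j * fSumTwo l j n - fSumTwo l (j + 1) n * f l j + (beta l j * fSum l j (n + 1) -
        (∑ s ∈ Finset.range (n + 1), beta l (j + 2 * (s : ZMod (l + 1)))) * f l j)) := by
  have key := sum_χ_commutator (l := l) (d := 2) (by omega) j
  rw [sum_χ_fRemove_two_sub hl] at key
  have hsq : Commute ((∑ i ∈ Finset.Icc 1 l, (-1) ^ (i - 1) * varpi l (i : ZMod (l + 1))) ^ 2)
      (f l j) := (Commute.sum_left _ _ _ fun i _ =>
    ((Commute.neg_one_left _).pow_left _).mul_left (varpi_comm l _ _)).pow_left 2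
  rw [H₀, if_neg (by rw [hl]; exact Nat.not_even_two_mul_add_one n), mul_add (h l), ← key, add_mul,
    mul_add, add_sub_add_comm, hsq.eq, sub_self, add_zero, add_mul, mul_add, add_sub_add_comm]
  congr 1
  split_ifs with h3
  · obtain rfl : n = 1 := by omega
    rw [commutator_four h3]
    simp only [fSumTwo, fSum, Finset.sum_range_one, zero_add, Nat.cast_zero, mul_zero, add_zero]
    congr 5 <;> ring
  · rw [sum_fSet_commutator (by omega) (by omega), fPairs_four hl (by omega),
      fPairs_four hl (by omega)]

end K

/-! ### The Hamiltonian derivation: existence, cyclic form, commutation -/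

namespace K

variable {l : ℕ}

/-- An inner derivation may be divided by `h` because `h` is central, so only the extra terms `e`
have to respect the relations. -/
theorem exists_derivation_inner_add (H : K l) (e : ZMod (l + 1) → K l)
    (he : ∀ i j, e i * f l j - f l j * e i + (f l i * e j - e j * f l i) = 0) :
    ∃ D : K l →ₗ[ℂ] K l, IsDerivation D ∧
      (∀ i, D (f l i) = (h l)⁻¹ * (H * f l i - f l i * H) + e i) ∧
      (∀ i, D (α l i) = (h l)⁻¹ * (H * α l i - α l i * H)) ∧
      D (h l) = (h l)⁻¹ * (H * h l - h l * H) := by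
  obtain ⟨E, hE, hEf, hEα, hEh⟩ := exists_derivation l e he
  let D : K l →ₗ[ℂ] K l := LinearMap.mulLeft ℂ (h l)⁻¹ ∘ₗ
    (LinearMap.mulLeft ℂ H - LinearMap.mulRight ℂ H) + E
  have hD : ∀ x, D x = (h l)⁻¹ * (H * x - x * H) + E x := fun _ => rfl
  refine ⟨D, fun x y => ?_, fun i => by rw [hD, hEf], fun i => by rw [hD, hEα, add_zero],
    by rw [hD, hEh, add_zero]⟩
  have hh : x * (h l)⁻¹ = (h l)⁻¹ * x := ((h_comm l x).inv_left₀).eq.symm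
  rw [hD, hD, hD, hE, mul_add x, ← mul_assoc x, hh]
  noncomm_ring

/-- Reduction modulo `l + 1` does not affect the sign, as `l + 1` is even. -/
theorem neg_one_pow_val_add (hl : Odd l) (i : ZMod (l + 1)) (p : ℕ) :
    (-1 : ℤ) ^ (i + (p : ZMod (l + 1))).val = (-1) ^ i.val * (-1) ^ p := by
  have key : ∀ a : ℕ, (-1 : ℤ) ^ (a % (l + 1)) = (-1) ^ a := fun a => by
    conv_rhs => rw [← Nat.div_add_mod a (l + 1), pow_add, pow_mul, hl.add_one.neg_one_pow, one_pow,
      one_mul]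
  rw [ZMod.val_add, key, ZMod.val_natCast, pow_add, key]

theorem x₀_eq_fSum {n : ℕ} (hl : l = 2 * n + 1) : x₀ l = fSum l 0 (n + 1) := by
  rw [x₀, fSum, show (l + 1) / 2 = n + 1 by omega]
  refine Finset.sum_congr rfl fun r _ => ?_
  rw [Nat.cast_mul, zero_add, Nat.cast_ofNat]

/-- The classes of `j` and `j + 1` together visit every index once, so the hits of `0` add up to one
and `2 · hits - 1` changes sign from `j` to `j + 1`; it is `1` at `j = 0`. -/
theorem hits_zero {n : ℕ} (hl : l = 2 * n + 1) (j : ZMod (l + 1)) :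
    2 * hits l 0 j (n + 1) - 1 = (-1) ^ j.val := by
  have step : ∀ j, hits l 0 j (n + 1) + hits l 0 (j + 1) (n + 1) = 1 := by
    intro j
    have := sum_univ_eq_range l (fun m => if m = 0 then (1 : ℤ) else 0) j
    rw [Finset.sum_ite_eq' Finset.univ (0 : ZMod (l + 1)), if_pos (Finset.mem_univ _),
      show Finset.range (l + 1) = Finset.range (2 * (n + 1)) by congr 1; omega,
      sum_range_two_mul] at this
    rw [this, hits, hits]
    congr 1 <;> refine Finset.sum_congr rfl fun s _ => ?_
    · rw [Nat.cast_mul, Nat.cast_ofNat]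
    · rw [Nat.cast_add, Nat.cast_mul, Nat.cast_ofNat, Nat.cast_one, add_assoc, add_comm 1]
  have base : hits l 0 0 (n + 1) = 1 := by
    rw [hits, Finset.sum_eq_single 0]
    · simp
    · intro s hs hs0
      rw [Finset.mem_range] at hs
      refine if_neg fun h => hs0 ?_
      have := (add_natCast_inj l (a := 0) (p := 2 * s) (q := 0) (by omega) (by omega)).1
        (by simpa using h)
      omega
    · simp
  have main : ∀ p : ℕ, 2 * hits l 0 (p : ZMod (l + 1)) (n + 1) - 1 = (-1) ^ p := by
    intro p
    induction p with
    | zero => rw [Nat.cast_zero, base]; rfl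
    | succ p ih =>
      rw [pow_succ, ← ih, Nat.cast_succ]
      linear_combination 2 * step p
  have := main j.val
  rwa [ZMod.natCast_zmod_val] at this

theorem existsUnique_isHamiltonianDerivation : ∃! D, IsHamiltonianDerivation l D := by
  refine existsUnique_of_exists_of_unique ?_ fun D E hD hE => ?_
  · rcases Nat.even_or_odd l with hl | hl
    · obtain ⟨D, hD, hDf, hDα, hDh⟩ := exists_derivation_inner_add (H₀ l)
        (fun i => if i = 0 then k l else 0) fun i j => by
          have hc : ∀ i : ZMod (l + 1), ∀ x, Commute (if i = 0 then k l else 0) x := by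
            intro i x
            split_ifs
            exacts [k_comm l x, Commute.zero_left x]
          rw [(hc i _).eq, (hc j _).eq, sub_self, sub_self, add_zero]
      exact ⟨D, hD, fun _ => hDf, fun h => absurd hl (Nat.not_even_iff_odd.2 h), hDα, hDh⟩
    · obtain ⟨n, hn⟩ := id hl
      have hk2 : ∀ x, Commute (k l / 2) x := fun x => (k_comm l x).div_left (Commute.ofNat_left 2 x)
      have hx₀ : ∀ x, Commute (x₀ l) x := fun x => by
        rw [x₀_eq_fSum hn]
        exact fSum_comm hn 0 x
      obtain ⟨D, hD, hDf, hDα, hDh⟩ := exists_derivation_inner_add (H₀ l)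
        (fun i => -((-1) ^ i.val * (k l / 2) * f l i) + if i = 0 then k l * x₀ l else 0)
        fun i j => by
          have hc : ∀ i : ZMod (l + 1), ∀ x, Commute (if i = 0 then k l * x₀ l else 0) x := by
            intro i x
            split_ifs
            exacts [(k_comm l x).mul_left (hx₀ x), Commute.zero_left x]
          have hs : ∀ i : ZMod (l + 1), ∀ x, Commute ((-1) ^ i.val * (k l / 2)) x := fun i x =>
            ((Commute.neg_one_left x).pow_left _).mul_left (hk2 x)
          -- The relations are respected because `[f_i, f_j]` is nonzero only for neighbours, and
          -- neighbours carry opposite signs.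
          have hadd : ((-1) ^ i.val * (k l / 2) + (-1) ^ j.val * (k l / 2)) *
              (f l i * f l j - f l j * f l i) = 0 := by
            have hsucc : ∀ i : ZMod (l + 1), (-1 : K l) ^ (i + 1).val = -(-1) ^ i.val := fun i => by
              have := congrArg (Int.cast : ℤ → K l) (neg_one_pow_val_add hl i 1)
              simpa using this
            by_cases h1 : j = i + 1
            · rw [h1, hsucc, neg_mul, add_neg_cancel, zero_mul]
            by_cases h3 : i = j + 1
            · rw [h3, hsucc, neg_mul, neg_add_cancel, zero_mul]
            rw [(f_commute l h1 h3).eq, sub_self, mul_zero]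
          rw [add_mul, mul_add, mul_add, add_mul, (hc i _).eq, (hc j _).eq, neg_mul, mul_neg, mul_neg,
            neg_mul, ← mul_assoc (f l j), ← mul_assoc (f l i), ← (hs i (f l j)).eq,
            ← (hs j (f l i)).eq]
          rw [add_mul, mul_sub, mul_sub] at hadd
          rw [← neg_eq_zero, ← hadd]
          noncomm_ring
      refine ⟨D, hD, fun h => absurd h (Nat.not_even_iff_odd.2 hl), fun _ i => ?_, hDα, hDh⟩
      rw [hDf, ← add_assoc, ← sub_eq_add_neg]
  · refine derivation_ext l hD.leibniz hE.leibniz (fun i => ?_) (fun i => by rw [hD.map_α, hE.map_α])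
      (by rw [hD.map_h, hE.map_h])
    rcases Nat.even_or_odd l with hl | hl
    · rw [hD.map_f_even hl, hE.map_f_even hl]
    · rw [hD.map_f_odd hl, hE.map_f_odd hl]

/-- The extra terms of `∂` restore the cyclic symmetry that the weights break at `0`: `δ_{j,0} k`
completes the second difference to `α_j`. For odd `l`, the sum of second differences over a parity
class lacks `k` exactly if the class contains `0`, and the term with `± k/2` replaces this by `-k/2`
in all cases. -/
theorem IsHamiltonianDerivation.comm (h2 : 2 ≤ l) {D : K l →ₗ[ℂ] K l}
    (hD : IsHamiltonianDerivation l D) :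
    (∀ i s, IsS l i s → ∀ y, D (s y) = s (D y)) ∧ ∀ p, IsPi l p → ∀ y, D (p y) = p (D y) := by
  have hα : ∀ j, D (α l j) = 0 := fun j => by
    rw [hD.map_α, (α_comm l j _).eq, sub_self, mul_zero]
  have hh : D (h l) = 0 := by rw [hD.map_h, (h_comm l _).eq, sub_self, mul_zero]
  rcases Nat.even_or_odd l with hl | hl
  · obtain ⟨n, hn⟩ := id hl
    rw [← two_mul] at hn
    refine comm_reflection_even l (by omega) hn hD.leibniz (fun j => ?_) hα hh
    rw [hD.map_f_even hl, commutator_H₀_even (by omega) hn, inv_mul_cancel_left₀ (h_ne_zero l), beta]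
    abel
  · obtain ⟨n, hn⟩ := id hl
    refine comm_odd hn (by omega) hD.leibniz (fun j => ?_) hα hh
    have hx : (if j = 0 then k l * x₀ l else 0) = (if j = 0 then k l else 0) * fSum l j (n + 1) := by
      split_ifs with hj
      · rw [x₀_eq_fSum hn, hj]
      · rw [zero_mul]
    have hsum : ∑ s ∈ Finset.range (n + 1), beta l (j + 2 * (s : ZMod (l + 1))) =
        αSum l j (n + 1) - hits l 0 j (n + 1) • k l := by
      simp only [beta, Finset.sum_sub_distrib, αSum, hits, Finset.sum_smul, ite_smul, one_smul,
        zero_smul]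
    have hsign : ((-1) ^ j.val : K l) * (k l / 2) = hits l 0 j (n + 1) • k l - k l / 2 := by
      have := congrArg (Int.cast : ℤ → K l) (hits_zero hn j)
      push_cast at this
      rw [← this, sub_mul, one_mul, zsmul_eq_mul, mul_assoc 2, two_mul, ← mul_add, add_halves]
    rw [hD.map_f_odd hl, commutator_H₀_odd (by omega) hn, inv_mul_cancel_left₀ (h_ne_zero l), hx, hsum,
      hsign, beta]
    noncomm_ring

end K

/-- The automorphisms which commute with `D` form a group. -/
theorem comm_of_mem_closure {F : Type} [DivisionRing F] [Algebra ℂ F] {D : F →ₗ[ℂ] F}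
    {W : Set (F ≃ₐ[ℂ] F)} (hW : ∀ w ∈ W, ∀ x, D (w x) = w (D x)) {w : F ≃ₐ[ℂ] F}
    (hw : w ∈ Subgroup.closure W) : ∀ x, D (w x) = w (D x) := by
  induction hw using Subgroup.closure_induction with
  | mem w hw => exact hW w hw
  | one => exact fun _ => rfl
  | mul v w _ _ hv hw => exact fun x => by rw [AlgEquiv.mul_apply, hv, hw, AlgEquiv.mul_apply]
  | inv w _ hw =>
    intro x
    apply w.injective
    rw [← hw, ← AlgEquiv.mul_apply, ← AlgEquiv.mul_apply, mul_inv_cancel, AlgEquiv.one_apply,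
      AlgEquiv.one_apply]

/-! ### The case `l = 1`: the algebra and its relations -/

namespace AlgOne

theorem exists_lift {T : Type} [Ring T] [Algebra ℂ T] (F : Fin 3 → T) (a : Fin 2 → T) (η : T)
    (h10 : F 1 * F 0 - F 0 * F 1 = 2 * η * F 2) (h02 : F 0 * F 2 - F 2 * F 0 = η)
    (h21 : F 2 * F 1 - F 1 * F 2 = η) (hfα : ∀ i j, Commute (F i) (a j))
    (hαα : ∀ i j, Commute (a i) (a j)) (hhα : ∀ i, Commute η (a i)) (hfh : ∀ i, Commute (F i) η) :
    ∃ φ : AlgOne →ₐ[ℂ] T, (∀ i, φ (gen (.f i)) = F i) ∧ (∀ i, φ (gen (.α i)) = a i) ∧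
      φ (gen .h) = η := by
  let v : Gen (Fin 3) (Fin 2) → T := fun x => match x with
    | .f i => F i
    | .α i => a i
    | .h => η
  have hv : ∀ x y, RelOne x y → FreeAlgebra.lift ℂ v x = FreeAlgebra.lift ℂ v y := by
    intro x y hxy
    cases hxy with
    | f1f0 =>
      simp only [map_sub, map_mul, map_ofNat, FreeAlgebra.lift_ι_apply]
      exact h10
    | f0f2 =>
      simp only [map_sub, map_mul, FreeAlgebra.lift_ι_apply]
      exact h02
    | f2f1 =>
      simp only [map_sub, map_mul, FreeAlgebra.lift_ι_apply]
      exact h21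
    | fα i j =>
      simp only [map_sub, map_mul, map_zero, FreeAlgebra.lift_ι_apply]
      exact sub_eq_zero.2 (hfα i j)
    | αα i j =>
      simp only [map_sub, map_mul, map_zero, FreeAlgebra.lift_ι_apply]
      exact sub_eq_zero.2 (hαα i j)
    | hα j =>
      simp only [map_sub, map_mul, map_zero, FreeAlgebra.lift_ι_apply]
      exact sub_eq_zero.2 (hhα j)
    | fh j =>
      simp only [map_sub, map_mul, map_zero, FreeAlgebra.lift_ι_apply]
      exact sub_eq_zero.2 (hfh j)
  have key : ∀ x, RingQuot.liftAlgHom ℂ ⟨FreeAlgebra.lift ℂ v, hv⟩ (gen x) = v x := fun x => by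
    rw [gen, RingQuot.liftAlgHom_mkAlgHom_apply, FreeAlgebra.lift_ι_apply]
  exact ⟨_, fun i => key _, fun i => key _, key _⟩

theorem f1f0 : gen (.f 1) * gen (.f 0) - gen (.f 0) * gen (.f 1) = 2 * gen .h * gen (.f 2) := by
  have := rel .f1f0
  simp only [map_sub, map_mul, map_ofNat] at this
  exact this

theorem f0f2 : gen (.f 0) * gen (.f 2) - gen (.f 2) * gen (.f 0) = gen .h := by
  have := rel .f0f2
  simp only [map_sub, map_mul] at this
  exact this

theorem f2f1 : gen (.f 2) * gen (.f 1) - gen (.f 1) * gen (.f 2) = gen .h := by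
  have := rel .f2f1
  simp only [map_sub, map_mul] at this
  exact this

theorem fα (i j) : Commute (gen (.f i)) (gen (.α j)) := by
  have := rel (.fα i j)
  simp only [map_sub, map_mul, map_zero] at this
  exact sub_eq_zero.1 this

theorem αα (i j) : Commute (gen (.α i)) (gen (.α j)) := by
  have := rel (.αα i j)
  simp only [map_sub, map_mul, map_zero] at this
  exact sub_eq_zero.1 this

theorem hα (j) : Commute (gen .h) (gen (.α j)) := by
  have := rel (.hα j)
  simp only [map_sub, map_mul, map_zero] at this
  exact sub_eq_zero.1 this

theorem fh (i) : Commute (gen (.f i)) (gen .h) := by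
  have := rel (.fh i)
  simp only [map_sub, map_mul, map_zero] at this
  exact sub_eq_zero.1 this

/-- The generator `f₀` is left out because it does not act by one of the standard operators: the
representation is built on the coordinate `f₀ + f₁ + f₂²`. -/
theorem gen_ne_zero (x) (hx : x ≠ .f 0) : gen x ≠ 0 := by
  obtain ⟨ρ, hρ⟩ := exists_rep
  intro h
  have h1 := congrArg (fun a => ρ a 1) h
  have h2 : opOne x = op cOne x := by
    rcases x with i | j | _
    · exact if_neg fun h => hx (by rw [h])
    · rfl
    · rfl
  simp only [hρ, h2, op_one, map_zero, LinearMap.zero_apply] at h1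
  exact MvPolynomial.X_ne_zero x h1

theorem f0_ne_zero : gen (.f 0) ≠ 0 := by
  intro h0
  have h := f0f2
  rw [h0, zero_mul, mul_zero, sub_self] at h
  exact gen_ne_zero .h (by simp) h.symm

end AlgOne

/-! ### The skew field for `l = 1` -/

namespace KOne

open AlgOne (gen)

theorem ι_f (i) : ι (gen (.f i)) = f i := rfl
theorem ι_α (i) : ι (gen (.α i)) = α i := rfl
theorem ι_h : ι (gen .h) = h := rfl

theorem f0_ne_zero : f 0 ≠ 0 := isSkewFractionField.ι_ne_zero AlgOne.f0_ne_zero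

theorem h_ne_zero : h ≠ 0 := isSkewFractionField.ι_ne_zero (AlgOne.gen_ne_zero _ (by simp))

theorem f1f0 : f 1 * f 0 - f 0 * f 1 = 2 * h * f 2 := by
  have := congrArg ι AlgOne.f1f0
  simp only [map_sub, map_mul, map_ofNat] at this
  exact this

theorem f0f2 : f 0 * f 2 - f 2 * f 0 = h := by
  have := congrArg ι AlgOne.f0f2
  simp only [map_sub, map_mul] at this
  exact this

theorem f2f1 : f 2 * f 1 - f 1 * f 2 = h := by
  have := congrArg ι AlgOne.f2f1
  simp only [map_sub, map_mul] at this
  exact this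

theorem α_comm (i) (x : KOne) : Commute (α i) x := by
  refine isSkewFractionField.central AlgOne.adjoin_gen (fun y => ?_) x
  rcases y with j | j | _
  · exact (AlgOne.fα j i).symm.map ι
  · exact (AlgOne.αα i j).map ι
  · exact (AlgOne.hα i).symm.map ι

theorem h_comm (x : KOne) : Commute h x := by
  refine isSkewFractionField.central AlgOne.adjoin_gen (fun y => ?_) x
  rcases y with j | j | _
  · exact (AlgOne.fh j).symm.map ι
  · exact (AlgOne.hα j).map ι
  · exact Commute.refl _

theorem k_comm (x : KOne) : Commute k x := (α_comm 0 x).add_left (α_comm 1 x)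

theorem forall_gen {p : KOne → Prop} (h0 : p (f 0)) (h1 : p (f 1)) (h2 : p (f 2)) (hα0 : p (α 0))
    (hα1 : p (α 1)) (hh : p h) (x) : p (ι (gen x)) := by
  rcases x with i | i | _
  · fin_cases i
    exacts [h0, h1, h2]
  · fin_cases i
    exacts [hα0, hα1]
  · exact hh

theorem algEquiv_ext {s t : KOne ≃ₐ[ℂ] KOne} (h0 : s (f 0) = t (f 0)) (h1 : s (f 1) = t (f 1))
    (h2 : s (f 2) = t (f 2)) (hα0 : s (α 0) = t (α 0)) (hα1 : s (α 1) = t (α 1))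
    (hh : s h = t h) : s = t :=
  isSkewFractionField.algEquiv_ext AlgOne.adjoin_gen
    (forall_gen (p := fun x => s x = t x) h0 h1 h2 hα0 hα1 hh)

/-! ### The automorphism `π` -/

theorem sub_eq_mul_neg {R : Type} [Ring R] {a b c d : R} (e : b * a - a * b = d * c) :
    a * b - b * a = d * -c := by
  rw [mul_neg, ← e, neg_sub]

theorem mul_neg_sub_neg_mul {R : Type} [Ring R] (a b : R) : a * -b - -b * a = b * a - a * b := by
  noncomm_ring

theorem neg_mul_sub_mul_neg {R : Type} [Ring R] (a b : R) : -b * a - a * -b = a * b - b * a := by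
  noncomm_ring

theorem exists_isPi : ∃ p, IsPi p := by
  obtain ⟨φ, hf, hα, hh⟩ := AlgOne.exists_lift ![gen (.f 1), gen (.f 0), -gen (.f 2)]
    ![gen (.α 1), gen (.α 0)] (gen .h)
    (sub_eq_mul_neg AlgOne.f1f0)
    ((mul_neg_sub_neg_mul _ _).trans AlgOne.f2f1) ((neg_mul_sub_mul_neg _ _).trans AlgOne.f0f2)
    (by
      intro i j
      fin_cases i <;> fin_cases j
      exacts [AlgOne.fα 1 1, AlgOne.fα 1 0, AlgOne.fα 0 1, AlgOne.fα 0 0,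
        (AlgOne.fα 2 1).neg_left, (AlgOne.fα 2 0).neg_left])
    (by
      intro i j
      fin_cases i <;> fin_cases j
      exacts [AlgOne.αα 1 1, AlgOne.αα 1 0, AlgOne.αα 0 1, AlgOne.αα 0 0])
    (by
      intro j
      fin_cases j
      exacts [AlgOne.hα 1, AlgOne.hα 0])
    (by
      intro i
      fin_cases i
      exacts [AlgOne.fh 1, AlgOne.fh 0, (AlgOne.fh 2).neg_left])
  have f0 : φ (gen (.f 0)) = gen (.f 1) := hf 0
  have f1 : φ (gen (.f 1)) = gen (.f 0) := hf 1
  have f2 : φ (gen (.f 2)) = -gen (.f 2) := hf 2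
  have α0 : φ (gen (.α 0)) = gen (.α 1) := hα 0
  have α1 : φ (gen (.α 1)) = gen (.α 0) := hα 1
  have hφφ : ∀ a, φ (φ a) = a := generated_induction AlgOne.adjoin_gen
    (by
      rintro (i | i | _)
      · fin_cases i
        · show φ (φ (gen (.f 0))) = gen (.f 0)
          rw [f0, f1]
        · show φ (φ (gen (.f 1))) = gen (.f 1)
          rw [f1, f0]
        · show φ (φ (gen (.f 2))) = gen (.f 2)
          rw [f2, map_neg, f2, neg_neg]
      · fin_cases i
        · show φ (φ (gen (.α 0))) = gen (.α 0)
          rw [α0, α1]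
        · show φ (φ (gen (.α 1))) = gen (.α 1)
          rw [α1, α0]
      · rw [hh, hh])
    (by simp) (fun x y hx hy => by rw [map_add, map_add, hx, hy])
    (fun x y hx hy => by rw [map_mul, map_mul, hx, hy])
  have hinj : Function.Injective (ι.comp φ) :=
    isSkewFractionField.injective.comp (Function.LeftInverse.injective hφφ)
  have hinv : ∀ Φ : KOne →ₐ[ℂ] KOne, (∀ a, Φ (ι a) = ι.comp φ a) →
      ∀ x, Φ (ι.comp φ (gen x)) = ι (gen x) := fun Φ hΦ x => by
    rw [AlgHom.comp_apply, hΦ, AlgHom.comp_apply, hφφ]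
  obtain ⟨p, hp⟩ := isSkewFractionField.exists_algEquiv AlgOne.adjoin_gen hinj hinj hinv hinv
  refine ⟨p, ?_, ?_, ?_, ?_, ?_, ?_⟩
  · rw [← ι_f, hp, AlgHom.comp_apply, f0, ι_f]
  · rw [← ι_f, hp, AlgHom.comp_apply, f1, ι_f]
  · rw [← ι_f, hp, AlgHom.comp_apply, f2, map_neg, ι_f]
  · rw [← ι_α, hp, AlgHom.comp_apply, α0, ι_α]
  · rw [← ι_α, hp, AlgHom.comp_apply, α1, ι_α]
  · rw [← ι_h, hp, AlgHom.comp_apply, hh, ι_h]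

theorem IsPi.unique {p q : KOne ≃ₐ[ℂ] KOne} (hp : IsPi p) (hq : IsPi q) : p = q :=
  algEquiv_ext (by rw [hp.map_f0, hq.map_f0]) (by rw [hp.map_f1, hq.map_f1])
    (by rw [hp.map_f2, hq.map_f2]) (by rw [hp.map_α0, hq.map_α0]) (by rw [hp.map_α1, hq.map_α1])
    (by rw [hp.map_h, hq.map_h])

/-! ### The automorphisms `s₀` and `s₁` -/

theorem div_mul_f0 : α 0 / f 0 * f 0 = α 0 := div_mul_cancel₀ _ f0_ne_zero

theorem f0_mul_div : f 0 * (α 0 / f 0) = α 0 := by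
  rw [div_eq_mul_inv, ← mul_assoc, (α_comm 0 (f 0)).symm.eq, mul_assoc,
    mul_inv_cancel₀ f0_ne_zero, mul_one]

theorem sq_div_sq : α 0 ^ 2 / f 0 ^ 2 = (α 0 / f 0) ^ 2 := by
  have hc : Commute (α 0) (f 0)⁻¹ := α_comm 0 _
  rw [div_eq_mul_inv, div_eq_mul_inv, hc.mul_pow, inv_pow]

theorem f2_inv : f 2 * (f 0)⁻¹ = (f 0)⁻¹ * f 2 + h * ((f 0)⁻¹ * (f 0)⁻¹) := by
  have h1 : f 0 * (f 2 * (f 0)⁻¹) = f 2 + h * (f 0)⁻¹ := by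
    rw [← mul_assoc, sub_eq_iff_eq_add.1 f0f2, add_mul, mul_inv_cancel_right₀ f0_ne_zero, add_comm]
  calc f 2 * (f 0)⁻¹ = (f 0)⁻¹ * (f 0 * (f 2 * (f 0)⁻¹)) := (inv_mul_cancel_left₀ f0_ne_zero _).symm
    _ = _ := by rw [h1, mul_add, ← mul_assoc, ← (h_comm (f 0)⁻¹).eq, mul_assoc]

theorem inv_f1 : (f 0)⁻¹ * f 1 = f 1 * (f 0)⁻¹ + 2 * h * ((f 0)⁻¹ * f 2 * (f 0)⁻¹) := by
  have h1 : f 0 * (f 1 * (f 0)⁻¹) = f 1 - 2 * h * f 2 * (f 0)⁻¹ := by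
    rw [← f1f0, sub_mul, mul_inv_cancel_right₀ f0_ne_zero, mul_assoc, sub_sub_cancel]
  have h2 : f 1 * (f 0)⁻¹ = (f 0)⁻¹ * (f 0 * (f 1 * (f 0)⁻¹)) :=
    (inv_mul_cancel_left₀ f0_ne_zero _).symm
  have h3 : Commute (2 * h) (f 0)⁻¹ := (Commute.ofNat_left 2 _).mul_left (h_comm _)
  rw [h2, h1, mul_sub, ← mul_assoc, ← mul_assoc (f 0)⁻¹ (2 * h), ← h3.eq]
  simp only [mul_assoc]
  abel

/-- The commutator of `f₂` with `α₀ / f₀`. -/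
noncomputable def cZero : KOne := h * α 0 * ((f 0)⁻¹ * (f 0)⁻¹)

theorem f2_div : f 2 * (α 0 / f 0) = α 0 / f 0 * f 2 + cZero := by
  rw [cZero, div_eq_mul_inv, ← mul_assoc, (α_comm 0 (f 2)).symm.eq, mul_assoc, f2_inv, mul_add,
    mul_assoc, (h_comm (α 0)).eq]
  simp only [mul_assoc]

/-- Conceptually, `f₁ + f₂²` commutes with `f₀` and hence with `g = α₀/f₀`, so `[g, f₁] = [f₂², g]`,
which expands by the Leibniz rule with `[f₂, g]`. -/
theorem div_f1 : α 0 / f 0 * f 1 = f 1 * (α 0 / f 0) + (f 2 * cZero + cZero * f 2) := by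
  have h1 : f 2 * ((f 0)⁻¹ * (f 0)⁻¹) + (f 0)⁻¹ * (f 0)⁻¹ * f 2 = 2 * ((f 0)⁻¹ * f 2 * (f 0)⁻¹) := by
    have e1 : f 2 * ((f 0)⁻¹ * (f 0)⁻¹) =
        (f 0)⁻¹ * f 2 * (f 0)⁻¹ + h * ((f 0)⁻¹ * (f 0)⁻¹ * (f 0)⁻¹) := by
      rw [← mul_assoc, f2_inv, add_mul]
      simp only [mul_assoc]
    have e2 : (f 0)⁻¹ * f 2 * (f 0)⁻¹ =
        (f 0)⁻¹ * (f 0)⁻¹ * f 2 + h * ((f 0)⁻¹ * (f 0)⁻¹ * (f 0)⁻¹) := by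
      rw [mul_assoc, f2_inv, mul_add, ← mul_assoc, ← mul_assoc, ← (h_comm (f 0)⁻¹).eq]
      simp only [mul_assoc]
    rw [e1, two_mul, add_assoc, add_comm (h * _), ← e2]
  have hc : Commute (h * α 0) (f 2) := (h_comm _).mul_left (α_comm 0 _)
  have h2 : f 2 * cZero + cZero * f 2 = α 0 * (2 * h * ((f 0)⁻¹ * f 2 * (f 0)⁻¹)) := by
    rw [cZero, ← mul_assoc, ← hc.eq, mul_assoc (h * α 0) (f 2),
      mul_assoc (h * α 0) _ (f 2), ← mul_add, h1, (h_comm (α 0)).eq, mul_assoc (α 0) h, ← mul_assoc h 2,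
      (Commute.ofNat_right h 2).eq]
  rw [h2, div_eq_mul_inv, mul_assoc, inv_f1, mul_add, ← mul_assoc, ← mul_assoc (f 1),
    (α_comm 0 (f 1)).eq]

theorem cZero_comm_div : Commute cZero (α 0 / f 0) := by
  have h1 : Commute (f 0)⁻¹ (α 0 / f 0) := by
    rw [div_eq_mul_inv]
    exact (α_comm 0 _).symm.mul_right (Commute.refl _)
  exact ((h_comm _).mul_left (α_comm 0 _)).mul_left (h1.mul_left h1)

theorem map_f1_eq : f 1 - f 2 * (α 0 / f 0) - α 0 / f 0 * f 2 - α 0 ^ 2 / f 0 ^ 2 =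
    f 1 - (f 2 * (α 0 / f 0) + α 0 / f 0 * f 2 + (α 0 / f 0) ^ 2) := by
  rw [sq_div_sq]
  abel

/-- The commutator of the square with `a` is `-(c h + h c) = -2 h c`, which cancels `[b, a]`. It
gives the Ore condition for `f₁`, whose own commutator with `f₀` does not commute with `f₀`. -/
theorem commute_add_sq {R : Type} [Ring R] {a b c h : R} (e0 : b * a - a * b = 2 * h * c)
    (e1 : a * c - c * a = h) (e2 : Commute c h) : Commute (b + c * c) a := by
  rw [commute_iff_eq, ← sub_eq_zero]
  calc _ = (b * a - a * b) - (c * (a * c - c * a) + (a * c - c * a) * c) := by noncomm_ring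
    _ = 0 := by
      rw [e0, e1, e2.eq]
      noncomm_ring

/-- With `g = α₀/f₀` the prescription says that `f₂` goes to `f₂ + g` and that `f₁ + f₂²` is fixed.
The relations then reduce to the commutators of `g` with `f₀`, `f₁`, `f₂`. -/
theorem exists_isS0 : ∃ s, IsS0 s := by
  have hF := isSkewFractionField
  set g := α 0 / f 0 with hg
  have hgf : Commute g (f 0) := div_mul_f0.trans f0_mul_div.symm
  have h20 : f 2 * f 0 = f 0 * f 2 - h := by rw [← f0f2, sub_sub_cancel]
  obtain ⟨φ, hf, hα, hh⟩ := AlgOne.exists_lift ![f 0, f 1 - (f 2 * g + g * f 2 + g ^ 2), f 2 + g]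
    ![-α 0, α 1 + 2 * α 0] h
    (by
      show (f 1 - (f 2 * g + g * f 2 + g ^ 2)) * f 0 - f 0 * (f 1 - (f 2 * g + g * f 2 + g ^ 2)) =
        2 * h * (f 2 + g)
      have e : (f 2 * g + g * f 2 + g ^ 2) * f 0 - f 0 * (f 2 * g + g * f 2 + g ^ 2) =
          -(h * g + g * h) := by
        rw [add_mul, add_mul, mul_add, mul_add, (hgf.pow_left 2).eq, mul_assoc, hgf.eq, mul_assoc g,
          ← mul_assoc (f 2), h20, mul_sub, ← mul_assoc g (f 0), hgf.eq]
        noncomm_ring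
      rw [mul_add, ← f1f0, sub_mul, mul_sub, sub_sub_sub_comm, e, ← (h_comm g).eq]
      noncomm_ring)
    (by
      show f 0 * (f 2 + g) - (f 2 + g) * f 0 = h
      rw [mul_add, add_mul, hgf.eq, add_sub_add_right_eq_sub, f0f2])
    (by
      show (f 2 + g) * (f 1 - (f 2 * g + g * f 2 + g ^ 2)) -
        (f 1 - (f 2 * g + g * f 2 + g ^ 2)) * (f 2 + g) = h
      have e1 := f2_div
      have e2 := div_f1
      have e3 := cZero_comm_div.eq
      rw [← hg] at e1 e2 e3
      have e4 : cZero = f 2 * g - g * f 2 := by rw [e1, add_sub_cancel_left]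
      rw [e4] at e2 e3
      rw [← f2f1, ← sub_eq_zero]
      rw [← sub_eq_zero] at e2 e3
      calc _ = g * f 1 - (f 1 * g + (f 2 * (f 2 * g - g * f 2) + (f 2 * g - g * f 2) * f 2)) := by
              noncomm_ring
        _ = 0 := e2)
    (by
      intro i j
      fin_cases j
      · exact (α_comm 0 _).neg_left.symm
      · exact ((α_comm 1 _).add_left ((Commute.ofNat_left 2 _).mul_left (α_comm 0 _))).symm)
    (by
      intro i j
      fin_cases j
      · exact (α_comm 0 _).neg_left.symm
      · exact ((α_comm 1 _).add_left ((Commute.ofNat_left 2 _).mul_left (α_comm 0 _))).symm)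
    (fun _ => h_comm _) (fun _ => (h_comm _).symm)
  have f0' : φ (gen (.f 0)) = f 0 := hf 0
  have f1' : φ (gen (.f 1)) = f 1 - (f 2 * g + g * f 2 + g ^ 2) := hf 1
  have f2' : φ (gen (.f 2)) = f 2 + g := hf 2
  have α0' : φ (gen (.α 0)) = -α 0 := hα 0
  have α1' : φ (gen (.α 1)) = α 1 + 2 * α 0 := hα 1
  have egf : g * f 0 = α 0 := div_mul_f0
  have hinj : Function.Injective φ := by
    refine hF.injective_of_involutive AlgOne.adjoin_gen AlgOne.f0_ne_zero f0' ?_ ?_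
    · have ore2 : PowOre (gen (.f 0)) (gen (.f 2)) := PowOre.of_commutator (by
        rw [← neg_sub, AlgOne.f0f2]
        exact (AlgOne.fh 0).symm.neg_left)
      rintro (i | i | _)
      · fin_cases i
        · exact PowOre.of_commute (Commute.refl _)
        · have hx : Commute (gen (.f 1) + gen (.f 2) * gen (.f 2)) (gen (.f 0)) :=
            commute_add_sq AlgOne.f1f0 AlgOne.f0f2 (AlgOne.fh 2)
          have := (PowOre.of_commute hx).add (ore2.mul ore2).neg
          rwa [add_neg_cancel_right] at this
        · exact ore2
      · exact PowOre.of_commute (AlgOne.fα 0 i).symm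
      · exact PowOre.of_commute (AlgOne.fh 0).symm
    -- The image of `f₁` has denominator `f₀²`. The term `α₀ h` comes from moving `f₀` past `f₂` in
    -- `g f₂ f₀²`.
    · have key : (f 1 - (f 2 * g + g * f 2 + g ^ 2)) * f 0 ^ 2 =
          f 1 * f 0 ^ 2 - 2 * α 0 * (f 2 * f 0) + α 0 * h - α 0 ^ 2 := by
        have k1 : f 2 * g * f 0 ^ 2 = α 0 * (f 2 * f 0) := by
          rw [pow_two, ← mul_assoc, mul_assoc (f 2), egf, ← (α_comm 0 (f 2)).eq, mul_assoc]
        have k2 : g * f 2 * f 0 ^ 2 = α 0 * (f 2 * f 0) - α 0 * h := by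
          rw [pow_two, ← mul_assoc, mul_assoc g, h20, mul_sub, sub_mul, ← mul_assoc, egf, mul_assoc,
            mul_assoc g, (h_comm (f 0)).eq, ← mul_assoc g, egf, h20]
        have k3 : g ^ 2 * f 0 ^ 2 = α 0 ^ 2 := by rw [← hgf.mul_pow, egf]
        rw [sub_mul, add_mul, add_mul, k1, k2, k3]
        noncomm_ring
      rintro (i | i | _)
      · fin_cases i
        · exact ⟨0, gen (.f 0), by rw [pow_zero, mul_one]; exact f0',
            by rw [pow_zero, mul_one]; exact f0'⟩
        · refine ⟨2, gen (.f 1) * gen (.f 0) ^ 2 - 2 * gen (.α 0) * (gen (.f 2) * gen (.f 0)) +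
            gen (.α 0) * gen .h - gen (.α 0) ^ 2, ?_, ?_⟩
          · show φ (gen (.f 1)) * f 0 ^ 2 = _
            rw [f1', key]
            simp only [map_sub, map_add, map_mul, map_pow, map_ofNat, ι_f, ι_α, ι_h]
          · show _ = f 1 * f 0 ^ 2
            simp only [map_sub, map_add, map_mul, map_pow, map_ofNat, f0', f1', f2', α0', hh, key]
            rw [add_mul (f 2), egf]
            noncomm_ring
        · refine ⟨1, gen (.f 2) * gen (.f 0) + gen (.α 0), ?_, ?_⟩
          · show φ (gen (.f 2)) * f 0 ^ 1 = _
            rw [f2', pow_one, add_mul, egf, map_add, map_mul, ι_f, ι_f, ι_α]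
          · show _ = f 2 * f 0 ^ 1
            rw [map_add, map_mul, f2', f0', α0', add_mul, egf, add_neg_cancel_right, pow_one]
      · fin_cases i
        · refine ⟨0, -gen (.α 0), ?_, ?_⟩
          · show φ (gen (.α 0)) * f 0 ^ 0 = _
            rw [α0', pow_zero, mul_one, map_neg, ι_α]
          · show _ = α 0 * f 0 ^ 0
            rw [map_neg, α0', neg_neg, pow_zero, mul_one]
        · refine ⟨0, gen (.α 1) + 2 * gen (.α 0), ?_, ?_⟩
          · show φ (gen (.α 1)) * f 0 ^ 0 = _
            rw [α1', pow_zero, mul_one, map_add, map_mul, map_ofNat, ι_α, ι_α]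
          · show _ = α 1 * f 0 ^ 0
            rw [map_add, map_mul, map_ofNat, α1', α0', mul_neg, add_neg_cancel_right, pow_zero, mul_one]
      · exact ⟨0, gen .h, by rw [hh, pow_zero, mul_one, ι_h], by rw [hh, pow_zero, mul_one, ι_h]⟩
  have hinv : ∀ Φ : KOne →ₐ[ℂ] KOne, (∀ a, Φ (ι a) = φ a) →
      ∀ x, Φ (φ (gen x)) = ι (gen x) := by
    intro Φ hΦ
    have F0 : Φ (f 0) = f 0 := (hΦ _).trans f0'
    have F1 : Φ (f 1) = f 1 - (f 2 * g + g * f 2 + g ^ 2) := (hΦ _).trans f1'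
    have F2 : Φ (f 2) = f 2 + g := (hΦ _).trans f2'
    have A0 : Φ (α 0) = -α 0 := (hΦ _).trans α0'
    have A1 : Φ (α 1) = α 1 + 2 * α 0 := (hΦ _).trans α1'
    have G : Φ g = -g := by rw [hg, map_div₀, A0, F0, neg_div]
    rintro (i | i | _)
    · fin_cases i
      · show Φ (φ (gen (.f 0))) = f 0
        rw [f0', F0]
      · show Φ (φ (gen (.f 1))) = f 1
        simp only [f1', map_sub, map_add, map_mul, map_pow, F1, F2, G]
        noncomm_ring
      · show Φ (φ (gen (.f 2))) = f 2
        rw [f2', map_add, F2, G, add_neg_cancel_right]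
    · fin_cases i
      · show Φ (φ (gen (.α 0))) = α 0
        rw [α0', map_neg, A0, neg_neg]
      · show Φ (φ (gen (.α 1))) = α 1
        rw [α1', map_add, map_mul, map_ofNat, A0, A1, mul_neg, add_neg_cancel_right]
    · rw [hh, ← ι_h, hΦ, hh, ι_h]
  obtain ⟨s, hs⟩ := hF.exists_algEquiv AlgOne.adjoin_gen hinj hinj hinv hinv
  exact ⟨s, (hs _).trans f0', ((hs _).trans f1').trans map_f1_eq.symm, (hs _).trans f2',
    (hs _).trans α0', (hs _).trans α1', (hs _).trans hh⟩

theorem IsS0.unique {s t : KOne ≃ₐ[ℂ] KOne} (hs : IsS0 s) (ht : IsS0 t) : s = t :=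
  algEquiv_ext (by rw [hs.map_f0, ht.map_f0]) (by rw [hs.map_f1, ht.map_f1])
    (by rw [hs.map_f2, ht.map_f2]) (by rw [hs.map_α0, ht.map_α0]) (by rw [hs.map_α1, ht.map_α1])
    (by rw [hs.map_h, ht.map_h])

theorem IsS1.unique {s t : KOne ≃ₐ[ℂ] KOne} (hs : IsS1 s) (ht : IsS1 t) : s = t :=
  algEquiv_ext (by rw [hs.map_f0, ht.map_f0]) (by rw [hs.map_f1, ht.map_f1])
    (by rw [hs.map_f2, ht.map_f2]) (by rw [hs.map_α0, ht.map_α0]) (by rw [hs.map_α1, ht.map_α1])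
    (by rw [hs.map_h, ht.map_h])

theorem IsS0.conj {s p : KOne ≃ₐ[ℂ] KOne} (hs : IsS0 s) (hp : IsPi p) : IsS1 (p * s * p⁻¹) := by
  have inv : ∀ {x y}, p x = y → p⁻¹ y = x := fun {x y} hxy => by
    rw [← hxy, ← AlgEquiv.mul_apply, inv_mul_cancel, AlgEquiv.one_apply]
  refine ⟨?_, ?_, ?_, ?_, ?_, ?_⟩
  · rw [AlgEquiv.mul_apply, AlgEquiv.mul_apply, inv hp.map_f1, hs.map_f1]
    simp only [map_sub, map_mul, map_div₀, map_pow, hp.map_f0, hp.map_f1, hp.map_f2, hp.map_α0]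
    noncomm_ring
  · rw [AlgEquiv.mul_apply, AlgEquiv.mul_apply, inv hp.map_f0, hs.map_f0, hp.map_f0]
  · rw [AlgEquiv.mul_apply, AlgEquiv.mul_apply, inv (show p (-f 2) = f 2 by
      rw [map_neg, hp.map_f2, neg_neg]), map_neg, hs.map_f2, map_neg, map_add, map_div₀, hp.map_f2,
      hp.map_f0, hp.map_α0, neg_add, neg_neg, sub_eq_add_neg]
  · rw [AlgEquiv.mul_apply, AlgEquiv.mul_apply, inv hp.map_α1, hs.map_α1, map_add, map_mul, map_ofNat,
      hp.map_α1, hp.map_α0]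
  · rw [AlgEquiv.mul_apply, AlgEquiv.mul_apply, inv hp.map_α0, hs.map_α0, map_neg, hp.map_α0]
  · rw [AlgEquiv.mul_apply, AlgEquiv.mul_apply, inv hp.map_h, hs.map_h, hp.map_h]

/-! ### The derivation -/

/-- The values are central, so every differentiated commutator of the `f_i` vanishes; since `f₂` has
value zero, the right side `2 h f₂` of the first relation is constant too. -/
theorem exists_derivation : ∃ E : KOne →ₗ[ℂ] KOne, IsDerivation E ∧
    (∀ i, E (f i) = if i = 0 then k else 0) ∧ (∀ i, E (α i) = 0) ∧ E h = 0 := by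
  obtain ⟨e, he⟩ : ∃ e : Fin 3 → KOne, ∀ i, e i = if i = 0 then k else 0 := ⟨_, fun _ => rfl⟩
  have hc : ∀ i : Fin 3, ∀ x, Commute (e i) x := by
    intro i x
    rw [he]
    split_ifs
    exacts [k_comm x, Commute.zero_left x]
  have hcomm : ∀ z x y : KOne, Commute z x → Commute z y → Commute (TrivSqZeroExt.inl z)
      (TrivSqZeroExt.inl x + TrivSqZeroExt.inr y : TrivSqZeroExt KOne KOne) := by
    intro z x y hx hy
    ext
    · simp [hx.eq]
    · simp [hy.eq]
  have hrel : ∀ i j x, f i * f j - f j * f i = x →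
      (TrivSqZeroExt.inl (f i) + TrivSqZeroExt.inr (e i)) *
      (TrivSqZeroExt.inl (f j) + TrivSqZeroExt.inr (e j)) -
      (TrivSqZeroExt.inl (f j) + TrivSqZeroExt.inr (e j)) *
      (TrivSqZeroExt.inl (f i) + TrivSqZeroExt.inr (e i)) =
      (TrivSqZeroExt.inl x : TrivSqZeroExt KOne KOne) := by
    intro i j x hx
    ext
    · simpa using hx
    · have h1 := (hc i (f j)).eq
      have h2 := (hc j (f i)).eq
      simp only [TrivSqZeroExt.snd_sub, TrivSqZeroExt.snd_mul, TrivSqZeroExt.snd_add,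
        TrivSqZeroExt.snd_inl, TrivSqZeroExt.snd_inr, TrivSqZeroExt.fst_add, TrivSqZeroExt.fst_inl,
        TrivSqZeroExt.fst_inr, zero_add, add_zero, smul_eq_mul, MulOpposite.smul_eq_mul_unop,
        MulOpposite.unop_op]
      rw [h1, h2, add_comm, sub_self]
  obtain ⟨ψ, hf, hα, hh⟩ := AlgOne.exists_lift (T := TrivSqZeroExt KOne KOne)
    (fun i => TrivSqZeroExt.inl (f i) + TrivSqZeroExt.inr (e i))
    (fun i => TrivSqZeroExt.inl (α i)) (TrivSqZeroExt.inl h)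
    (by
      rw [hrel 1 0 _ f1f0, show e 2 = 0 from he 2, TrivSqZeroExt.inr_zero, add_zero, mul_assoc, mul_assoc, two_mul, two_mul, TrivSqZeroExt.inl_add,
        TrivSqZeroExt.inl_mul])
    (hrel 0 2 _ f0f2) (hrel 2 1 _ f2f1)
    (fun i j => (hcomm _ _ _ (α_comm _ _) (α_comm _ _)).symm)
    (fun i j => by simpa using hcomm _ _ 0 (α_comm i (α j)) (Commute.zero_right _))
    (fun i => by simpa using hcomm _ _ 0 (h_comm (α i)) (Commute.zero_right _))
    (fun i => (hcomm _ _ _ (h_comm _) (h_comm _)).symm)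
  obtain ⟨E, hE, hEψ⟩ := isSkewFractionField.exists_derivation ψ
    (generated_induction AlgOne.adjoin_gen
      (by rintro (i | i | _)
          · rw [hf]; simp [ι_f]
          · rw [hα]; simp [ι_α]
          · rw [hh]; simp [ι_h])
      (fun c => by rw [AlgHom.commutes, AlgHom.commutes]; rfl)
      (fun a b ha hb => by rw [map_add, map_add, TrivSqZeroExt.fst_add, ha, hb])
      (fun a b ha hb => by rw [map_mul, map_mul, TrivSqZeroExt.fst_mul, ha, hb]))
  exact ⟨E, hE, fun i => by rw [← ι_f, hEψ, hf, ← he]; simp, fun i => by rw [← ι_α, hEψ, hα]; simp,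
    by rw [← ι_h, hEψ, hh]; simp⟩

theorem existsUnique_isHamiltonianDerivation : ∃! D, IsHamiltonianDerivation D := by
  refine existsUnique_of_exists_of_unique ?_ fun D E hD hE => ?_
  · obtain ⟨E, hE, hEf, hEα, hEh⟩ := exists_derivation
    let D : KOne →ₗ[ℂ] KOne := LinearMap.mulLeft ℂ h⁻¹ ∘ₗ
      (LinearMap.mulLeft ℂ H₀ - LinearMap.mulRight ℂ H₀) + E
    have hD : ∀ x, D x = h⁻¹ * (H₀ * x - x * H₀) + E x := fun _ => rfl
    refine ⟨D, fun x y => ?_, fun i => by rw [hD, hEf], fun i => by rw [hD, hEα, add_zero],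
      by rw [hD, hEh, add_zero]⟩
    have hh : x * h⁻¹ = h⁻¹ * x := ((h_comm x).inv_left₀).eq.symm
    rw [hD, hD, hD, hE, mul_add x, ← mul_assoc x, hh]
    noncomm_ring
  · exact isSkewFractionField.derivation_ext AlgOne.adjoin_gen hD.leibniz hE.leibniz
      (forall_gen (p := fun x => D x = E x) (by rw [hD.map_f, hE.map_f]) (by rw [hD.map_f, hE.map_f])
        (by rw [hD.map_f, hE.map_f]) (by rw [hD.map_α, hE.map_α]) (by rw [hD.map_α, hE.map_α])
        (by rw [hD.map_h, hE.map_h]))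

namespace IsHamiltonianDerivation

variable {D : KOne →ₗ[ℂ] KOne}

theorem map_α_eq_zero (hD : IsHamiltonianDerivation D) (i) : D (α i) = 0 := by
  rw [hD.map_α, (α_comm i _).eq, sub_self, mul_zero]

theorem map_h_eq_zero (hD : IsHamiltonianDerivation D) : D h = 0 := by
  rw [hD.map_h, (h_comm _).eq, sub_self, mul_zero]

/-- The commutator with `H₀` is computed after multiplication by two, so that the scalar `1/2` never
enters the noncommutative calculation. -/
theorem map_f_eq (hD : IsHamiltonianDerivation D) {i : Fin 3} {c : KOne}
    (hc : (f 0 * f 1 + f 1 * f 0) * f i - f i * (f 0 * f 1 + f 1 * f 0) +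
      2 * (α 1 * (f 2 * f i - f i * f 2)) = 2 * h * c) :
    D (f i) = c + if i = 0 then k else 0 := by
  have h2 : (2 : ℂ) ≠ 0 := two_ne_zero
  have hsm : ∀ x : KOne, (2 : ℂ) • x = 2 * x := fun x => by rw [Algebra.smul_def, map_ofNat]
  have key : H₀ * f i - f i * H₀ = h * c := by
    have e1 : f i * (2 * (α 1 * f 2)) = 2 * (α 1 * (f i * f 2)) := by
      rw [two_mul, two_mul, mul_add, ← mul_assoc, ← (α_comm 1 (f i)).eq, mul_assoc]
    have e : (2 : ℂ) • (H₀ * f i - f i * H₀) = (2 : ℂ) • (h * c) := by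
      rw [smul_sub, ← smul_mul_assoc, ← mul_smul_comm, H₀, smul_add, smul_smul, mul_one_div_cancel h2,
        one_smul, hsm, hsm, ← mul_assoc 2 h, ← hc, add_mul, mul_add (f i), e1]
      noncomm_ring
    exact smul_right_injective KOne h2 e
  rw [hD.map_f, key, inv_mul_cancel_left₀ h_ne_zero]

theorem map_f0 (hD : IsHamiltonianDerivation D) : D (f 0) = f 0 * f 2 + f 2 * f 0 + α 0 := by
  rw [hD.map_f_eq (c := f 0 * f 2 + f 2 * f 0 - α 1), if_pos rfl, k]
  · abel
  · have e : (f 0 * f 1 + f 1 * f 0) * f 0 - f 0 * (f 0 * f 1 + f 1 * f 0) =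
        f 0 * (f 1 * f 0 - f 0 * f 1) + (f 1 * f 0 - f 0 * f 1) * f 0 := by noncomm_ring
    have h3 : Commute (2 * h) (f 0) := (Commute.ofNat_left 2 _).mul_left (h_comm _)
    rw [e, f1f0, ← neg_sub (f 0 * f 2), f0f2, ← mul_assoc, ← h3.eq, mul_neg, (α_comm 1 h).eq]
    noncomm_ring

theorem map_f1 (hD : IsHamiltonianDerivation D) : D (f 1) = α 1 - (f 1 * f 2 + f 2 * f 1) := by
  rw [hD.map_f_eq (c := α 1 - (f 1 * f 2 + f 2 * f 1)), if_neg (by decide), add_zero]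
  have e : (f 0 * f 1 + f 1 * f 0) * f 1 - f 1 * (f 0 * f 1 + f 1 * f 0) =
      -(f 1 * (f 1 * f 0 - f 0 * f 1) + (f 1 * f 0 - f 0 * f 1) * f 1) := by noncomm_ring
  have h3 : Commute (2 * h) (f 1) := (Commute.ofNat_left 2 _).mul_left (h_comm _)
  rw [e, f1f0, f2f1, ← mul_assoc, ← h3.eq, (α_comm 1 h).eq]
  noncomm_ring

theorem map_f2 (hD : IsHamiltonianDerivation D) : D (f 2) = f 1 - f 0 := by
  rw [hD.map_f_eq (c := f 1 - f 0), if_neg (by decide), add_zero]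
  have e : (f 0 * f 1 + f 1 * f 0) * f 2 - f 2 * (f 0 * f 1 + f 1 * f 0) =
      (f 0 * f 2 - f 2 * f 0) * f 1 + f 1 * (f 0 * f 2 - f 2 * f 0) -
      (f 0 * (f 2 * f 1 - f 1 * f 2) + (f 2 * f 1 - f 1 * f 2) * f 0) := by noncomm_ring
  rw [e, f0f2, f2f1, ← (h_comm (f 1)).eq, ← (h_comm (f 0)).eq, sub_self]
  noncomm_ring

/-- A Riccati equation for `g = α₀/f₀`, from `D f₀ = f₀ f₂ + f₂ f₀ + α₀`. Its right side is the
amount by which `s₀` changes `f₁`, so `s₀ f₁ = f₁ + D g`. -/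
theorem map_div (hD : IsHamiltonianDerivation D) : D (α 0 / f 0) =
    -(f 2 * (α 0 / f 0) + α 0 / f 0 * f 2 + (α 0 / f 0) ^ 2) := by
  have hc := (α_comm 0 (f 2)).eq
  rw [div_eq_mul_inv, hD.leibniz, hD.map_α_eq_zero, zero_mul, zero_add, hD.leibniz.map_inv, hD.map_f0,
    mul_add, mul_add, inv_mul_cancel_left₀ f0_ne_zero, add_mul, add_mul, ← mul_assoc (f 0)⁻¹,
    mul_inv_cancel_right₀ f0_ne_zero, mul_neg, mul_add, mul_add, ← mul_assoc (α 0) (f 2), hc, pow_two]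
  simp only [mul_assoc]

theorem comm_of_gen (hD : IsHamiltonianDerivation D) {s : KOne ≃ₐ[ℂ] KOne}
    (h0 : D (s (f 0)) = s (D (f 0))) (h1 : D (s (f 1)) = s (D (f 1)))
    (h2 : D (s (f 2)) = s (D (f 2))) (hα0 : D (s (α 0)) = 0) (hα1 : D (s (α 1)) = 0)
    (hh : D (s h) = 0) (x : KOne) : D (s x) = s (D x) :=
  isSkewFractionField.derivation_comm AlgOne.adjoin_gen hD.leibniz
    (forall_gen (p := fun x => D (s x) = s (D x)) h0 h1 h2
      (by rw [hα0, hD.map_α_eq_zero, map_zero]) (by rw [hα1, hD.map_α_eq_zero, map_zero])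
      (by rw [hh, hD.map_h_eq_zero, map_zero])) x

theorem comm_pi (hD : IsHamiltonianDerivation D) {p : KOne ≃ₐ[ℂ] KOne} (hp : IsPi p) (x : KOne) :
    D (p x) = p (D x) := by
  refine hD.comm_of_gen ?_ ?_ ?_ (by rw [hp.map_α0, hD.map_α_eq_zero])
    (by rw [hp.map_α1, hD.map_α_eq_zero]) (by rw [hp.map_h, hD.map_h_eq_zero]) x
  · rw [hp.map_f0, hD.map_f0, hD.map_f1, map_add, map_add, map_mul, map_mul, hp.map_f0, hp.map_f2,
      hp.map_α0]
    noncomm_ring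
  · rw [hp.map_f1, hD.map_f0, hD.map_f1, map_sub, map_add, map_mul, map_mul, hp.map_f1, hp.map_f2,
      hp.map_α1]
    noncomm_ring
  · rw [hp.map_f2, map_neg, hD.map_f2, map_sub, hp.map_f0, hp.map_f1, neg_sub]

/-- For `f₂` the claim is the Riccati equation itself, and for `f₀` it is `f₀ g = g f₀ = α₀`. For
`f₁` the derivative of that equation leaves `f₀ g + g f₀ - 2 α₀`, which vanishes for the same
reason. -/
theorem comm_s0 (hD : IsHamiltonianDerivation D) {s : KOne ≃ₐ[ℂ] KOne} (hs : IsS0 s) (x : KOne) :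
    D (s x) = s (D x) := by
  have e1 := div_mul_f0
  have e2 := f0_mul_div
  have e3 := hD.map_div
  have s1 := hs.map_f1
  have s2 := hs.map_f2
  rw [map_f1_eq] at s1
  set g := α 0 / f 0
  have h2 : D (2 * α 0) = 0 := by
    rw [two_mul, map_add, hD.map_α_eq_zero, add_zero]
  refine hD.comm_of_gen ?_ ?_ ?_ (by rw [hs.map_α0, map_neg, hD.map_α_eq_zero, neg_zero])
    (by rw [hs.map_α1, map_add, h2, hD.map_α_eq_zero, add_zero])
    (by rw [hs.map_h, hD.map_h_eq_zero]) x
  · rw [hs.map_f0, hD.map_f0, map_add, map_add, map_mul, map_mul, hs.map_f0, s2, hs.map_α0, mul_add,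
      add_mul, e1, e2]
    abel
  · have e4 : D (g ^ 2) = D g * g + g * D g := by rw [pow_two, hD.leibniz]
    rw [s1, map_sub, map_add, map_add, hD.leibniz, hD.leibniz, e4, hD.map_f1, hD.map_f2, map_sub,
      map_add, map_mul, map_mul, s1, s2, hs.map_α1, e3, ← sub_eq_zero]
    calc _ = f 0 * g + g * f 0 - 2 * α 0 := by noncomm_ring
      _ = 0 := by rw [e1, e2, two_mul, sub_self]
  · rw [s2, map_add, hD.map_f2, e3, map_sub, s1, hs.map_f0]
    abel

theorem comm_s1 (hD : IsHamiltonianDerivation D) {s : KOne ≃ₐ[ℂ] KOne} (hs : IsS1 s) (x : KOne) :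
    D (s x) = s (D x) := by
  obtain ⟨s₀, hs₀⟩ := exists_isS0
  obtain ⟨p, hp⟩ := exists_isPi
  rw [hs.unique (hs₀.conj hp)]
  have hs₀' : s₀ ∈ Subgroup.closure {s₀, p} := Subgroup.subset_closure (by simp)
  have hp' : p ∈ Subgroup.closure {s₀, p} := Subgroup.subset_closure (by simp)
  refine comm_of_mem_closure ?_ (mul_mem (mul_mem hp' hs₀') (inv_mem hp')) x
  rintro w (rfl | rfl)
  exacts [hD.comm_s0 hs₀, hD.comm_pi hp]

end IsHamiltonianDerivation

end KOne

end QP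

/-- The derivation and the automorphisms `s_i`, `π` exist and are unique, and the derivation commutes
with every element of the group generated by these automorphisms. -/
theorem theorem1p2 :
    -- the case `l = 1`
    ((∃! D, QP.KOne.IsHamiltonianDerivation D) ∧
      (∃! s, QP.KOne.IsS0 s) ∧ (∃! s, QP.KOne.IsS1 s) ∧ (∃! p, QP.KOne.IsPi p) ∧
      ∀ (D : QP.KOne →ₗ[ℂ] QP.KOne) (s₀ s₁ p : QP.KOne ≃ₐ[ℂ] QP.KOne),
        QP.KOne.IsHamiltonianDerivation D →
        QP.KOne.IsS0 s₀ → QP.KOne.IsS1 s₁ → QP.KOne.IsPi p →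
        ∀ w ∈ Subgroup.closure ({s₀, s₁, p} : Set (QP.KOne ≃ₐ[ℂ] QP.KOne)),
          ∀ x, D (w x) = w (D x)) ∧
    -- the case `l ≥ 2`
    ∀ l : ℕ, 2 ≤ l →
      (∃! D, QP.K.IsHamiltonianDerivation l D) ∧
      (∀ i, ∃! s, QP.K.IsS l i s) ∧ (∃! p, QP.K.IsPi l p) ∧
      ∀ (D : QP.K l →ₗ[ℂ] QP.K l) (s : ZMod (l + 1) → (QP.K l ≃ₐ[ℂ] QP.K l))
        (p : QP.K l ≃ₐ[ℂ] QP.K l),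
        QP.K.IsHamiltonianDerivation l D → (∀ i, QP.K.IsS l i (s i)) → QP.K.IsPi l p →
        ∀ w ∈ Subgroup.closure (Set.range s ∪ {p}), ∀ x, D (w x) = w (D x) := by
  refine ⟨⟨QP.KOne.existsUnique_isHamiltonianDerivation, ?_, ?_, ?_, ?_⟩, fun l hl =>
    ⟨QP.K.existsUnique_isHamiltonianDerivation, QP.K.existsUnique_isS l, QP.K.existsUnique_isPi l, ?_⟩⟩
  · obtain ⟨s, hs⟩ := QP.KOne.exists_isS0
    exact ⟨s, hs, fun t ht => ht.unique hs⟩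
  · obtain ⟨s, hs⟩ := QP.KOne.exists_isS0
    obtain ⟨p, hp⟩ := QP.KOne.exists_isPi
    exact ⟨_, hs.conj hp, fun t ht => ht.unique (hs.conj hp)⟩
  · obtain ⟨p, hp⟩ := QP.KOne.exists_isPi
    exact ⟨p, hp, fun q hq => hq.unique hp⟩
  · intro D s₀ s₁ p hD hs₀ hs₁ hp w hw
    refine QP.comm_of_mem_closure ?_ hw
    rintro v (rfl | rfl | rfl)
    exacts [hD.comm_s0 hs₀, hD.comm_s1 hs₁, hD.comm_pi hp]
  · intro D s p hD hs hp w hw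
    refine QP.comm_of_mem_closure ?_ hw
    rintro v (⟨i, rfl⟩ | rfl)
    exacts [(hD.comm hl).1 i _ (hs i), (hD.comm hl).2 _ hp]
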